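/- **Setting.** Let $V=\{x_1,\dots,x_n\}$. A 3-clause is a set of three literals over three different variables. A planted random 3CNF formula $\mathcal F\sim\mathcal P^{\mathrm{plant}}_{n,p}$ is obtained by choosing an assignment $\varphi:V\to\{\mathrm{T},\mathrm{F}\}$ uniformly at random and then including each of the $7\binom n3$ 3-clauses satisfied by $\varphi$ independently with probability $p$. Put $d=n^2p$. Given $\mathcal F$, consider the $3\#\mathcal F$ message edges $C\to x$ ($C\in\mathcal F$, $x$ a variable of $C$); let $\alpha$ be a uniformly random $\{0,1\}$-valued function on the message edges, and let $\pi$ be an independent uniformly random ordering of the message edges. A variable $x$ *supports* $C$ if it is the only variable satisfying $C$ under $\varphi$. Let $N^s(x)$ be the set of clauses of $\mathcal F$ that $x$ supports, $N^{++}(x)$ the set of clauses of $\mathcal F$ in which the literal of $x$ is true under $\varphi$ but which $x$ does not support, and $N^-(x)$ the set of clauses of $\mathcal F$ in which the literal of $x$ is false under $\varphi$. For an edge $e$ and a set of clauses $\mathcal S\subseteq\mathcal F$ let $\mathcal S_{<e}(y)$ be the set of message edges $C'\to y$ with $C'\in\mathcal S$ that precede $e$ in $\pi$, and let $\mathbf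 1_\alpha$ applied to a set of clauses (resp. edges) count the edges $C'\to y$ with $C'$ in the set (resp. the edges in the set) on which $\alpha=1$. * $x$ is *stable* if for every message edge $e=(C\to x)$ and each of the two other variables $y$ of $C$: $|\#N^{++}_{<e}(y)-\#N^-_{<e}(y)|\le d/30$, $|\#N^{++}(y)-\#N^-(y)|\le d/30$, and $\#N^s(y)\ge d/3$. * $x$ is *violated* if for some message edge $e=(C\to x)$ and one of the two other variables $y$ of $C$: $|\mathbf 1_\alpha(N^{++}_{<e}(y))-\mathbf 1_\alpha(N^-_{<e}(y))|>d/30$, or $|\mathbf 1_\alpha(N^{++}(y))-\mathbf 1_\alpha(N^-(y))|>d/30$, or $\mathbf 1_\alpha(N^s(y))<d/7$. For $A\subseteq V$ let $\mathcal F[A]$ be the set of clauses of $\mathcal F$ all of whose variables lie in $A$. The *core* $\mathcal H=\mathcal H(\mathcal F,\varphi,\alpha,\pi)$ is obtained from $V$ by deleting all variables that support at most $d/3$ clauses, all variables that are not stable, and all stable variables that are violated, and then, as long as the current set $A$ has an element that supports fewer than $d/4$ clauses of $\mathcal F[A]$ or appears in more than $d/30$ clauses of $\mathcal F\setminus\mathcal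 F[A]$, deleting such an element from $A$. (The order of deletion does not matter.) The factor graph of $\mathcal F$ is the bipartite graph on $V\cup\mathcal F$ in which $x$ and $C$ are adjacent iff $x$ appears in $C$. The factor graph induced by the non-core variables is the subgraph of it induced by $(V\setminus\mathcal H)\cup\mathcal F$. **Proposition.** There is a constant $d_0>0$ such that for every constant $D$ and every sequence $p=p(n)$ with $d_0/n^2\le p(n)\le D/n^2$ for all sufficiently large $n$, the following holds with probability tending to $1$ as $n\to\infty$ (over the choice of $\varphi,\mathcal F,\alpha,\pi$): every connected component of the factor graph induced by the non-core variables contains at most one simple cycle. -/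

import Mathlib

open Filter Topology
open scoped Classical

noncomputable section

namespace PlantedSAT

/-- A truth assignment to the variables `x_1, …, x_n`, indexed by `Fin n`. -/
abbrev Assignment (n : ℕ) : Type := Fin n → Bool

/-- A 3-clause: a set of three literals over three different variables. The literal `(x, true)` is
the variable `x`, the literal `(x, false)` is its negation. -/
abbrev Clause (n : ℕ) : Type :=
  {C : Finset (Fin n × Bool) // C.card = 3 ∧ (C.image Prod.fst).card = 3}

/-- A 3CNF formula over `n` variables: a set of 3-clauses. -/
abbrev Formula (n : ℕ) : Type := Finset (Clause n)

variable {n : ℕ}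

/-- The variable `x` appears in the clause `C` (positively or negatively). -/
def Clause.Mentions (C : Clause n) (x : Fin n) : Prop := ∃ b : Bool, (x, b) ∈ C.1

/-- The assignment `φ` satisfies the clause `C`. -/
def Satisfies (φ : Assignment n) (C : Clause n) : Prop := ∃ x : Fin n, (x, φ x) ∈ C.1

/-- The `7 * (n choose 3)` clauses satisfied by `φ`. -/
def satClauses (φ : Assignment n) : Formula n := Finset.univ.filter (Satisfies φ)

/-- `F[A]`: the clauses of `F` all of whose variables belong to `A`. -/
def restrict (F : Formula n) (A : Finset (Fin n)) : Formula n :=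
  F.filter fun C => ∀ x, C.Mentions x → x ∈ A

/-- `x` supports `C` with respect to `φ`: it is the only variable that satisfies `C`. -/
def Supports (φ : Assignment n) (x : Fin n) (C : Clause n) : Prop :=
  (x, φ x) ∈ C.1 ∧ ∀ y, (y, φ y) ∈ C.1 → y = x

/-- `N^s(x)`: the clauses of `F` that `x` supports with respect to `φ`. -/
def Ns (F : Formula n) (φ : Assignment n) (x : Fin n) : Formula n :=
  F.filter (Supports φ x)

/-- `N^{++}(x)`: the clauses of `F` in which the literal of `x` is true under `φ` but which `x` does
not support (if `φ` is the all-true assignment: `x` appears positively and does not support). -/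
def Npp (F : Formula n) (φ : Assignment n) (x : Fin n) : Formula n :=
  F.filter fun C => (x, φ x) ∈ C.1 ∧ ¬ Supports φ x C

/-- `N^-(x)`: the clauses of `F` in which the literal of `x` is false under `φ` (if `φ` is the
all-true assignment: `x` appears negatively). -/
def Nm (F : Formula n) (φ : Assignment n) (x : Fin n) : Formula n :=
  F.filter fun C => (x, !φ x) ∈ C.1

/-- The clause-variable message edges `C → x`: pairs of a clause of `F` and a variable in it. -/
abbrev MsgEdge (F : Formula n) : Type :=
  {e : Clause n × Fin n // e.1 ∈ F ∧ e.1.Mentions e.2}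

/-- A vector of 0/1 values of the clause-variable messages (`true` is the value 1, a warning). -/
abbrev Messages (F : Formula n) : Type := MsgEdge F → Bool

/-- An ordering of the clause-variable message edges: `π e` is the place of `e`. -/
abbrev EdgeOrder (F : Formula n) : Type := MsgEdge F ≃ Fin (Fintype.card (MsgEdge F))

/-- The message edges `C → y` with `C` in the set of clauses `S`. -/
def edgesInto (F : Formula n) (S : Formula n) (y : Fin n) : Finset (MsgEdge F) :=
  Finset.univ.filter fun e => e.1.2 = y ∧ e.1.1 ∈ S

/-- The edges of `E` that come strictly before the edge `e` in the order `π`. -/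
def before {F : Formula n} (π : EdgeOrder F) (e : MsgEdge F) (E : Finset (MsgEdge F)) :
    Finset (MsgEdge F) :=
  E.filter fun e' => π e' < π e

/-- The edges of `E` along which the value in `α` is 1. -/
def ones {F : Formula n} (α : Messages F) (E : Finset (MsgEdge F)) : Finset (MsgEdge F) :=
  E.filter fun e => α e = true

/-- The absolute difference of the cardinalities of two finite sets. -/
def gap {ι : Type*} (A B : Finset ι) : ℝ := |(A.card : ℝ) - (B.card : ℝ)|

/-- `x` is stable: for every message edge `C → x` and each of the two other variables `y` of `C`,
the clauses of `N^{++}(y)` and `N^-(y)` are balanced up to `d/30`, both among the messages to `y`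
that come before `C → x` and in total, and `y` supports at least `d/3` clauses. -/
def Stable (d : ℝ) (F : Formula n) (φ : Assignment n) (π : EdgeOrder F) (x : Fin n) : Prop :=
  ∀ e : MsgEdge F, e.1.2 = x → ∀ y : Fin n, e.1.1.Mentions y → y ≠ x →
    gap (before π e (edgesInto F (Npp F φ y) y)) (before π e (edgesInto F (Nm F φ y) y)) ≤ d / 30 ∧
    gap (Npp F φ y) (Nm F φ y) ≤ d / 30 ∧
    d / 3 ≤ ((Ns F φ y).card : ℝ)

/-- `x` is violated by `α` in `π`: for some message edge `C → x` and one of the two other variables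
`y` of `C`, the messages of value 1 that `y` receives from `N^{++}(y)` and from `N^-(y)` differ in
number by more than `d/30`, among those before `C → x` or in total, or `y` receives fewer than
`d/7` messages of value 1 from the clauses it supports. -/
def Violated (d : ℝ) (F : Formula n) (φ : Assignment n) (α : Messages F) (π : EdgeOrder F)
    (x : Fin n) : Prop :=
  ∃ e : MsgEdge F, e.1.2 = x ∧ ∃ y : Fin n, e.1.1.Mentions y ∧ y ≠ x ∧
    (d / 30 < gap (ones α (before π e (edgesInto F (Npp F φ y) y)))
        (ones α (before π e (edgesInto F (Nm F φ y) y))) ∨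
      d / 30 < gap (ones α (edgesInto F (Npp F φ y) y)) (ones α (edgesInto F (Nm F φ y) y)) ∨
      ((ones α (edgesInto F (Ns F φ y) y)).card : ℝ) < d / 7)

/-- `H_0 = V \ (A_1 ∪ A_2 ∪ A_3)`, where `A_1` are the variables of support at most `d/3`, `A_2` the
variables that are not stable, and `A_3` the stable variables that are violated. -/
def initialCore (d : ℝ) (F : Formula n) (φ : Assignment n) (α : Messages F) (π : EdgeOrder F) :
    Finset (Fin n) :=
  Finset.univ \
    ((Finset.univ.filter fun x => ((Ns F φ x).card : ℝ) ≤ d / 3) ∪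
      (Finset.univ.filter fun x => ¬ Stable d F φ π x) ∪
      (Finset.univ.filter fun x => Stable d F φ π x ∧ Violated d F φ α π x))

/-- `a` supports fewer than `d/4` clauses of `F[A]`, or appears in more than `d/30` clauses of `F`
that are not in `F[A]`. -/
def Removable (d : ℝ) (F : Formula n) (φ : Assignment n) (A : Finset (Fin n)) (a : Fin n) : Prop :=
  ((Ns (restrict F A) φ a).card : ℝ) < d / 4 ∨
    d / 30 < ((F.filter fun C => C.Mentions a ∧ C ∉ restrict F A).card : ℝ)

/-- Starting from `A`, remove removable variables one at a time as long as there is one. (A variable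
that is removable stays so when others are removed, so the order of removal is irrelevant.) -/
def peel (d : ℝ) (F : Formula n) (φ : Assignment n) (A : Finset (Fin n)) : Finset (Fin n) :=
  if h : ∃ a, a ∈ A ∧ Removable d F φ A a then peel d F φ (A.erase h.choose) else A
termination_by A.card
decreasing_by exact Finset.card_erase_lt_of_mem h.choose_spec.1

/-- The set of core variables. -/
def core (d : ℝ) (F : Formula n) (φ : Assignment n) (α : Messages F) (π : EdgeOrder F) :
    Finset (Fin n) :=
  peel d F φ (initialCore d F φ α π)

/-- The factor graph of `F`: the bipartite graph on variables and clauses of `F`, in which a variable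
is adjacent to the clauses in which it appears. -/
def factorGraph (F : Formula n) : SimpleGraph (Fin n ⊕ {C : Clause n // C ∈ F}) where
  Adj u v := match u, v with
    | Sum.inl x, Sum.inr C => C.1.Mentions x
    | Sum.inr C, Sum.inl x => C.1.Mentions x
    | _, _ => False
  symm := ⟨by
    rintro (x | C) (y | D) h
    · exact h
    · exact h
    · exact h
    · exact h⟩
  loopless := ⟨by
    rintro (x | C) h
    · exact h
    · exact h⟩

/-- The factor graph induced by the variables outside `H`: the variables of `H` are deleted from the
factor graph, with their edges; all clauses are kept. -/
def nonCoreGraph (F : Formula n) (H : Finset (Fin n)) :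
    SimpleGraph {v : Fin n ⊕ {C : Clause n // C ∈ F} | ∀ x ∈ H, v ≠ Sum.inl x} :=
  (factorGraph F).induce {v | ∀ x ∈ H, v ≠ Sum.inl x}

/-- Every connected component contains at most one cycle: any two (simple) cycles of one component
have the same edges. -/
def ComponentsAtMostOneCycle {V : Type*} (G : SimpleGraph V) : Prop :=
  ∀ K : G.ConnectedComponent, ∀ u ∈ K.supp, ∀ v ∈ K.supp, ∀ (c : G.Walk u u) (c' : G.Walk v v),
    c.IsCycle → c'.IsCycle → ∀ e, e ∈ c.edges ↔ e ∈ c'.edges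

/-- The probability of the formula `F` given the planted assignment `φ`: each clause satisfied by `φ`
is included with probability `p`, independently, and no other clause is. -/
def formulaProb (p : ℝ) (φ : Assignment n) (F : Formula n) : ℝ :=
  if F ⊆ satClauses φ then p ^ F.card * (1 - p) ^ (satClauses φ \ F).card else 0

/-- The probability of the event `E` when `φ` is a uniformly random assignment, `F` is the random
formula planted at `φ` with clause probability `p`, and, given these, `(α, π)` is a uniformly random
pair of a message vector and an ordering of the message edges of `F`. -/
def plantedProb (n : ℕ) (p : ℝ)
    (E : (φ : Assignment n) → (F : Formula n) → Messages F → EdgeOrder F → Prop) : ℝ :=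
  ∑ φ : Assignment n, ∑ F : Formula n, (1 / 2 : ℝ) ^ n * formulaProb p φ F *
    ((Nat.card {ω : Messages F × EdgeOrder F // E φ F ω.1 ω.2} : ℝ) /
      (Nat.card (Messages F × EdgeOrder F) : ℝ))

end PlantedSAT

end

/-! Regard every clause as a hyperedge on its three variables. The surplus of a set `S` of variables
is `∑ max(|C ∩ S| - 1, 0) - |S|`. A nonempty connected set has surplus at least -1, and two
different cycles in one component of the non-core factor graph force surplus at least 1 on the
variables of that component (`card_lt_overlap_compVars`). With high probability no set of at most
`s₀` variables, with `s₀` of order `log n`, has positive surplus (`pexp_not_sparse_le`). A component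
may a priori be larger than `s₀`, so the excess has to be located in a small part of it.

Call a variable faulty if its support is small or if its clauses or messages are out of balance.
Every non-core variable arises from faulty variables and their neighbours by repeatedly adding a
variable that has three clauses leading to earlier ones. Cover the faulty variables by as few
disjoint small connected clusters as possible, each at least a quarter faulty. Clusters that can be
joined through at most three further variables could be merged, unless the union is a rich set:
nearly connected, a quarter faulty, of size between `s₁` and `s₀`. Suppose there are no such rich
sets. Then a variable with three clauses leading to the neighbourhood of the clusters already lies
in this neighbourhood, and a connected subset of the neighbourhood with positive surplus would yield
positive surplus on a cluster and four more variables, against sparsity (`exists_near`).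

It remains to exclude rich sets. At least an eighth of a sparse rich set `S` is faulty because of
private clauses, which meet `S` in one variable only (`exists_privFaulty`). For different variables
these events are independent of each other and of the overlap of `S`. Each has probability
exponentially small in `d` (`pexp_ind_privFaulty_le`), while an overlap of `|S| - 1` costs about
`(|S| d / n) ^ (|S| - 1)`. The union bound over `S` leaves `n` times a quantity exponentially small
in `|S|` (`pexp_badSet_le`), which tends to 0 because `|S| ≥ s₁` and `s₁` is of order `log n`.

The messages and the order live on the edges of the random formula. They are replaced by independent
messages on all potential edges and by a fixed order of the pairs (variable set, target), so that
everything happens in a product space indexed by clauses (`one_sub_le_plantedProb`). -/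

namespace PlantedSAT

/-! ### Surplus, connectivity and clusters in hypergraphs. -/

section Hypergraph

variable {V ι : Type*} [DecidableEq V] {E : Finset ι} {v : ι → Finset V}

/-- The sum over the hyperedges `C` of `E` of `max (#(C ∩ S) - 1) 0`. -/
def overlap (E : Finset ι) (v : ι → Finset V) (S : Finset V) : ℕ :=
  ∑ C ∈ E, ((v C ∩ S).card - 1)

/-- Some hyperedge meets both `A` and `B`. -/
def Touch (E : Finset ι) (v : ι → Finset V) (A B : Finset V) : Prop :=
  ∃ C ∈ E, (v C ∩ A).Nonempty ∧ (v C ∩ B).Nonempty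

/-- Every cut of `S` is crossed by a hyperedge. -/
def Conn (E : Finset ι) (v : ι → Finset V) (S : Finset V) : Prop :=
  ∀ T ⊆ S, T.Nonempty → T ≠ S → Touch E v T (S \ T)

lemma Touch.symm {A B : Finset V} (h : Touch E v A B) : Touch E v B A := by
  obtain ⟨C, hC, h1, h2⟩ := h
  exact ⟨C, hC, h2, h1⟩

lemma Touch.mono {A B A' B' : Finset V} (h : Touch E v A B) (hA : A ⊆ A') (hB : B ⊆ B') :
    Touch E v A' B' := by
  obtain ⟨C, hC, h1, h2⟩ := h
  exact ⟨C, hC, h1.mono (Finset.inter_subset_inter_left hA),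
    h2.mono (Finset.inter_subset_inter_left hB)⟩

lemma touch_of_mem {A B : Finset V} {C : ι} (hC : C ∈ E) {a b : V} (ha : a ∈ v C) (hb : b ∈ v C)
    (haA : a ∈ A) (hbB : b ∈ B) : Touch E v A B :=
  ⟨C, hC, ⟨a, Finset.mem_inter.2 ⟨ha, haA⟩⟩, ⟨b, Finset.mem_inter.2 ⟨hb, hbB⟩⟩⟩

lemma conn_singleton (x : V) : Conn E v {x} := by
  intro T hT hne hneq
  rcases Finset.subset_singleton_iff.1 hT with h | h
  · exact absurd h hne.ne_empty
  · exact absurd h hneq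

/-- A cut that splits `A` or `B` is crossed inside that set; any other cut separates `A` from `B`
and is crossed by the touching hyperedge. -/
lemma Conn.union {A B : Finset V} (hA : Conn E v A) (hB : Conn E v B) (h : Touch E v A B) :
    Conn E v (A ∪ B) := by
  intro T hT hne hneq
  have key : ∀ A' ⊆ A ∪ B, Conn E v A' → (T ∩ A').Nonempty → ¬ A' ⊆ T →
      Touch E v T ((A ∪ B) \ T) := by
    intro A' hA' hc h1 h2
    have h3 := hc (T ∩ A') Finset.inter_subset_right h1
      (fun h => h2 (h ▸ Finset.inter_subset_left))
    refine h3.mono Finset.inter_subset_left ?_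
    intro y hy
    simp only [Finset.mem_sdiff, Finset.mem_inter, not_and] at hy ⊢
    exact ⟨hA' hy.1, fun hyT => hy.2 hyT hy.1⟩
  by_cases h1 : (T ∩ A).Nonempty ∧ ¬ A ⊆ T
  · exact key A Finset.subset_union_left hA h1.1 h1.2
  by_cases h2 : (T ∩ B).Nonempty ∧ ¬ B ⊆ T
  · exact key B Finset.subset_union_right hB h2.1 h2.2
  have dis : ∀ {X : Finset V}, ¬ (T ∩ X).Nonempty → ∀ x ∈ X, x ∉ T := by
    intro X hX x hx hxT
    exact hX ⟨x, Finset.mem_inter.2 ⟨hxT, hx⟩⟩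
  by_cases h3 : A ⊆ T
  · by_cases h4 : B ⊆ T
    · exact absurd (Finset.Subset.antisymm hT (Finset.union_subset h3 h4)) hneq
    · have h5 : ¬ (T ∩ B).Nonempty := fun h => h2 ⟨h, h4⟩
      refine h.mono h3 fun x hx => ?_
      exact Finset.mem_sdiff.2 ⟨Finset.mem_union_right _ hx, dis h5 x hx⟩
  · have h5 : ¬ (T ∩ A).Nonempty := fun h => h1 ⟨h, h3⟩
    obtain ⟨t, ht⟩ := hne
    have htB : t ∈ B := by
      rcases Finset.mem_union.1 (hT ht) with h6 | h6
      · exact absurd ht (dis h5 t h6)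
      · exact h6
    have h4 : B ⊆ T := by
      by_contra h4
      exact h2 ⟨⟨t, Finset.mem_inter.2 ⟨ht, htB⟩⟩, h4⟩
    refine h.symm.mono h4 fun x hx => ?_
    exact Finset.mem_sdiff.2 ⟨Finset.mem_union_left _ hx, dis h5 x hx⟩

/-- Because of the truncated subtraction, a hyperedge through `q` gains one exactly if it already
meets `K`. -/
lemma overlap_insert {K : Finset V} {q : V} (hq : q ∉ K) :
    overlap E v (insert q K) =
      overlap E v K + (E.filter fun C => q ∈ v C ∧ (v C ∩ K).Nonempty).card := by
  rw [overlap, overlap, Finset.card_filter, ← Finset.sum_add_distrib]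
  refine Finset.sum_congr rfl fun C _ => ?_
  by_cases h : q ∈ v C
  · rw [Finset.inter_insert_of_mem h, Finset.card_insert_of_notMem (by simp [hq])]
    by_cases h2 : (v C ∩ K).Nonempty
    · have := h2.card_pos
      simp only [h, h2, and_self, if_true]
      omega
    · have h3 := Finset.not_nonempty_iff_eq_empty.1 h2
      simp [h3]
  · rw [Finset.inter_insert_of_notMem h]
    simp [h]

/-- The surplus of overlaps over vertices. -/
def surplus (E : Finset ι) (v : ι → Finset V) (S : Finset V) : ℤ := overlap E v S - S.card

lemma surplus_insert {K : Finset V} {q : V} (hq : q ∉ K) :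
    surplus E v (insert q K) =
      surplus E v K + (E.filter fun C => q ∈ v C ∧ (v C ∩ K).Nonempty).card - 1 := by
  rw [surplus, surplus, overlap_insert hq, Finset.card_insert_of_notMem hq]
  push_cast
  ring

lemma surplus_insert_ge {K : Finset V} {q : V} (h : q ∈ K ∨ Touch E v {q} K) :
    surplus E v K ≤ surplus E v (insert q K) := by
  by_cases hq : q ∈ K
  · rw [Finset.insert_eq_of_mem hq]
  · obtain ⟨C, hC, ⟨x, hx⟩, h2⟩ := h.resolve_left hq
    have hx' : q ∈ v C := by
      rw [Finset.mem_inter, Finset.mem_singleton] at hx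
      exact hx.2 ▸ hx.1
    have : 0 < (E.filter fun C => q ∈ v C ∧ (v C ∩ K).Nonempty).card :=
      Finset.card_pos.2 ⟨C, by simp [hC, hx', h2]⟩
    rw [surplus_insert hq]
    omega

/-- The set `S` can be absorbed vertex by vertex, each new vertex touching what is already there;
such a vertex costs one and gains at least one. -/
lemma Conn.surplus_union_ge {S A : Finset V} (hS : Conn E v S)
    (h : (A ∩ S).Nonempty ∨ Touch E v A S) : surplus E v A ≤ surplus E v (A ∪ S) := by
  induction hk : (S \ A).card generalizing A with
  | zero =>
    have : S ⊆ A := by rwa [Finset.card_eq_zero, Finset.sdiff_eq_empty_iff_subset] at hk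
    rw [Finset.union_eq_left.2 this]
  | succ k ih =>
    have hne : ¬ S ⊆ A := fun h => by
      rw [Finset.sdiff_eq_empty_iff_subset.2 h] at hk
      simp at hk
    obtain ⟨q, hqS, hqA, hq⟩ : ∃ q ∈ S, q ∉ A ∧ Touch E v {q} A := by
      by_cases h0 : (A ∩ S).Nonempty
      · obtain ⟨C, hC, ⟨a, ha⟩, ⟨b, hb⟩⟩ := hS (A ∩ S) Finset.inter_subset_right h0
          (fun h => hne (h ▸ Finset.inter_subset_left))
        simp only [Finset.mem_inter, Finset.mem_sdiff, not_and] at ha hb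
        exact ⟨b, hb.2.1, fun h => hb.2.2 h hb.2.1,
          touch_of_mem hC hb.1 ha.1 (Finset.mem_singleton_self _) ha.2.1⟩
      · obtain ⟨C, hC, ⟨a, ha⟩, ⟨b, hb⟩⟩ := h.resolve_left h0
        simp only [Finset.mem_inter] at ha hb
        exact ⟨b, hb.2, fun h => h0 ⟨b, Finset.mem_inter.2 ⟨h, hb.2⟩⟩,
          touch_of_mem hC hb.1 ha.1 (Finset.mem_singleton_self _) ha.2⟩
    have h1 : surplus E v A ≤ surplus E v (insert q A) := surplus_insert_ge (Or.inr hq)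
    have h2 : (S \ insert q A).card = k := by
      have : S \ insert q A = (S \ A).erase q := by
        ext y
        simp only [Finset.mem_sdiff, Finset.mem_insert, Finset.mem_erase, not_or]
        tauto
      rw [this, Finset.card_erase_of_mem (by simp [hqS, hqA]), hk]
      rfl
    have h3 := ih (A := insert q A) (Or.inl ⟨q, by simp [hqS]⟩) h2
    have h4 : insert q A ∪ S = A ∪ S := by
      rw [Finset.insert_union, Finset.insert_eq_of_mem (Finset.mem_union_right _ hqS)]
    rw [h4] at h3
    exact h1.trans h3

lemma neg_one_le_surplus_singleton (x : V) : -1 ≤ surplus E v {x} := by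
  simp only [surplus, Finset.card_singleton]
  push_cast
  linarith [Int.natCast_nonneg (overlap E v {x})]

lemma Conn.neg_one_le_surplus {S : Finset V} (hS : Conn E v S) (hne : S.Nonempty) :
    -1 ≤ surplus E v S := by
  obtain ⟨x, hx⟩ := hne
  have h := hS.surplus_union_ge (A := {x}) (Or.inl ⟨x, by simp [hx]⟩)
  rw [Finset.union_eq_right.2 (Finset.singleton_subset_iff.2 hx)] at h
  exact (neg_one_le_surplus_singleton x).trans h

/-- If all vertices of `M` outside `S` touch `S` and the surplus of `M` is larger than that of `S`,
then two more vertices suffice to increase the surplus. -/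
lemma exists_insert_insert_surplus {S M : Finset V} (hSM : S ⊆ M)
    (h : ∀ q ∈ M, q ∉ S → Touch E v {q} S) (hlt : surplus E v S < surplus E v M) :
    ∃ w ∈ M, ∃ q ∈ M, surplus E v S + 1 ≤ surplus E v (insert q (insert w S)) := by
  -- When the vertices of `M` are added to `S` one at a time, some single insertion must increase
  -- the surplus.
  obtain ⟨K, q, hSK, hKM, hqM, hqK, hK⟩ : ∃ K q, S ⊆ K ∧ K ⊆ M ∧ q ∈ M ∧ q ∉ K ∧
      surplus E v K < surplus E v (insert q K) := by
    by_contra! hcon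
    have : ∀ k : ℕ, ∀ K, S ⊆ K → K ⊆ M → (M \ K).card = k → surplus E v M ≤ surplus E v K := by
      intro k
      induction k with
      | zero =>
        intro K _ hKM hk
        rw [Finset.card_eq_zero, Finset.sdiff_eq_empty_iff_subset] at hk
        rw [Finset.Subset.antisymm hk hKM]
      | succ k ih =>
        intro K hSK hKM hk
        obtain ⟨q, hq⟩ := Finset.card_pos.1 (by omega : 0 < (M \ K).card)
        have hq' := Finset.mem_sdiff.1 hq
        have h1 := hcon K q hSK hKM hq'.1 hq'.2
        have h2 := ih (insert q K) (hSK.trans (Finset.subset_insert _ _))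
          (Finset.insert_subset hq'.1 hKM) (by
            have : M \ insert q K = (M \ K).erase q := by
              ext y
              simp only [Finset.mem_sdiff, Finset.mem_insert, Finset.mem_erase, not_or]
              tauto
            rw [this, Finset.card_erase_of_mem hq, hk]
            rfl)
        exact h2.trans h1
    exact absurd (this _ S subset_rfl hSM rfl) (not_le.2 hlt)
  -- Thus `q` has two hyperedges into `K`. One can be taken as `C0`, which reaches `S`; another one
  -- reaches some `w`. Inserting `w` first loses nothing, and then `q` gains at least 2 - 1.
  rw [surplus_insert hqK] at hK
  have h2 : 1 < (E.filter fun C => q ∈ v C ∧ (v C ∩ K).Nonempty).card := by omega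
  have hqS : q ∉ S := fun h => hqK (hSK h)
  obtain ⟨C0, hC0, ⟨x, hx⟩, hC0S⟩ := h q hqM hqS
  have hq0 : q ∈ v C0 := by
    rw [Finset.mem_inter, Finset.mem_singleton] at hx
    exact hx.2 ▸ hx.1
  obtain ⟨C1, hC1, hne⟩ := Finset.exists_mem_ne h2 C0
  simp only [Finset.mem_filter] at hC1
  obtain ⟨hC1E, hq1, ⟨w, hw⟩⟩ := hC1
  rw [Finset.mem_inter] at hw
  refine ⟨w, hKM hw.2, q, hqM, ?_⟩
  have hwq : q ≠ w := fun h => hqK (h ▸ hw.2)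
  have h3 : surplus E v S ≤ surplus E v (insert w S) := by
    refine surplus_insert_ge ?_
    by_cases hwS : w ∈ S
    · exact Or.inl hwS
    · exact Or.inr (h w (hKM hw.2) hwS)
  have h4 : 2 ≤ (E.filter fun C => q ∈ v C ∧ (v C ∩ insert w S).Nonempty).card := by
    rw [← Finset.card_pair hne]
    refine Finset.card_le_card ?_
    intro C hC
    rw [Finset.mem_insert, Finset.mem_singleton] at hC
    rw [Finset.mem_filter]
    rcases hC with rfl | rfl
    · exact ⟨hC1E, hq1, w, by simp [hw.1]⟩
    · exact ⟨hC0, hq0, hC0S.mono (Finset.inter_subset_inter_left (Finset.subset_insert _ _))⟩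
  rw [surplus_insert (by simp [hwq, hqS])]
  omega

/-- Clusters: connected sets, a quarter of which belongs to `Y`, with fewer than `s₁` elements. -/
structure IsCluster (E : Finset ι) (v : ι → Finset V) (Y : Finset V) (s₁ : ℕ) (S : Finset V) :
    Prop where
  conn : Conn E v S
  rich : S.card + 3 ≤ 4 * (Y ∩ S).card
  small : S.card < s₁

/-- Families of pairwise disjoint clusters that cover `Y`. -/
structure IsClustering (E : Finset ι) (v : ι → Finset V) (Y : Finset V) (s₁ : ℕ)
    (P : Finset (Finset V)) : Prop where
  cluster : ∀ S ∈ P, IsCluster E v Y s₁ S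
  disj : ∀ S ∈ P, ∀ T ∈ P, S ≠ T → Disjoint S T
  cover : ∀ y ∈ Y, ∃ S ∈ P, y ∈ S

lemma IsCluster.nonempty {Y S : Finset V} {s₁ : ℕ} (h : IsCluster E v Y s₁ S) : S.Nonempty := by
  have h1 : 0 < (Y ∩ S).card := by have := h.rich; omega
  exact (Finset.card_pos.1 h1).mono Finset.inter_subset_right

/-- No set of at most `s₀` vertices has positive surplus. -/
def Sparse (E : Finset ι) (v : ι → Finset V) (s₀ : ℕ) : Prop :=
  ∀ S : Finset V, S.card ≤ s₀ → overlap E v S ≤ S.card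

/-- The set `S` has about the overlaps of a connected set, and a quarter of it belongs to `Y`. -/
def Rich (E : Finset ι) (v : ι → Finset V) (Y S : Finset V) : Prop :=
  S.card ≤ overlap E v S + 1 ∧ S.card + 3 ≤ 4 * (Y ∩ S).card

/-- The singletons of `Y` form a clustering, with equality `1 + 3 = 4 * 1` in `rich`; a smallest
clustering is then chosen. -/
lemma exists_clustering {Y : Finset V} {s₁ : ℕ} (h : 2 ≤ s₁) :
    ∃ P, IsClustering E v Y s₁ P ∧ ∀ Q, IsClustering E v Y s₁ Q → P.card ≤ Q.card := by
  have h0 : ∃ k, ∃ P, IsClustering E v Y s₁ P ∧ P.card = k := by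
    refine ⟨_, Y.image fun y => {y}, ⟨?_, ?_, ?_⟩, rfl⟩
    · intro S hS
      obtain ⟨y, hy, rfl⟩ := Finset.mem_image.1 hS
      refine ⟨conn_singleton y, ?_, by rw [Finset.card_singleton]; omega⟩
      rw [Finset.inter_singleton_of_mem hy]
      simp
    · intro S hS T hT hne
      obtain ⟨y, hy, rfl⟩ := Finset.mem_image.1 hS
      obtain ⟨z, hz, rfl⟩ := Finset.mem_image.1 hT
      rw [Finset.disjoint_singleton]
      rintro rfl
      exact hne rfl
    · intro y hy
      exact ⟨{y}, Finset.mem_image_of_mem _ hy, Finset.mem_singleton_self y⟩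
  obtain ⟨P, hP, hk⟩ := Nat.find_spec h0
  exact ⟨P, hP, fun Q hQ => hk ▸ Nat.find_min' h0 ⟨Q, hQ, rfl⟩⟩

/-- The slack 3 in `rich` pays for the connecting vertices: adding the inequalities for `S` and `T`
leaves room for three vertices of `R`. The union is therefore a cluster, against minimality, or it
has at least `s₁` elements and is one of the excluded rich sets. -/
lemma merge_clusters {Y : Finset V} {s₀ s₁ : ℕ} (hs : 2 * s₁ + 3 ≤ s₀)
    (hbad : ∀ S : Finset V, s₁ ≤ S.card → S.card ≤ s₀ → ¬ Rich E v Y S)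
    {P : Finset (Finset V)} (hP : IsClustering E v Y s₁ P)
    (hmin : ∀ Q, IsClustering E v Y s₁ Q → P.card ≤ Q.card)
    {S T : Finset V} (hS : S ∈ P) (hT : T ∈ P) (hne : S ≠ T) {R : Finset V} (hR : R.card ≤ 3)
    (hRP : ∀ U ∈ P, Disjoint R U) (hc : Conn E v (S ∪ T ∪ R)) : False := by
  have hdis := hP.disj S hS T hT hne
  have cS := hP.cluster S hS
  have cT := hP.cluster T hT
  have hcard : (S ∪ T ∪ R).card = S.card + T.card + R.card := by
    rw [Finset.card_union_of_disjoint, Finset.card_union_of_disjoint hdis]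
    exact Finset.disjoint_union_left.2 ⟨(hRP S hS).symm, (hRP T hT).symm⟩
  have hY : (Y ∩ S).card + (Y ∩ T).card ≤ (Y ∩ (S ∪ T ∪ R)).card := by
    rw [← Finset.card_union_of_disjoint (hdis.mono Finset.inter_subset_right
      Finset.inter_subset_right), ← Finset.inter_union_distrib_left]
    exact Finset.card_le_card (Finset.inter_subset_inter_left Finset.subset_union_left)
  have hrich : (S ∪ T ∪ R).card + 3 ≤ 4 * (Y ∩ (S ∪ T ∪ R)).card := by
    have := cS.rich
    have := cT.rich
    omega
  have hsmall : (S ∪ T ∪ R).card < s₁ := by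
    by_contra! hge
    refine hbad _ hge ?_ ⟨?_, hrich⟩
    · have := cS.small
      have := cT.small
      omega
    · have h1 := hc.neg_one_le_surplus (cS.nonempty.mono
        (Finset.subset_union_left.trans Finset.subset_union_left))
      rw [surplus] at h1
      omega
  set Q := insert (S ∪ T ∪ R) ((P.erase S).erase T) with hQ
  have hQc : IsClustering E v Y s₁ Q := by
    have hdd : ∀ U ∈ (P.erase S).erase T, Disjoint (S ∪ T ∪ R) U := by
      intro U hU
      simp only [Finset.mem_erase] at hU
      rw [Finset.disjoint_union_left, Finset.disjoint_union_left]
      exact ⟨⟨hP.disj S hS U hU.2.2 (Ne.symm hU.2.1), hP.disj T hT U hU.2.2 (Ne.symm hU.1)⟩,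
        hRP U hU.2.2⟩
    refine ⟨?_, ?_, ?_⟩
    · intro U hU
      rcases Finset.mem_insert.1 hU with rfl | hU
      · exact ⟨hc, hrich, hsmall⟩
      · exact hP.cluster U (Finset.mem_of_mem_erase (Finset.mem_of_mem_erase hU))
    · intro U hU W hW hUW
      rcases Finset.mem_insert.1 hU with rfl | hU <;> rcases Finset.mem_insert.1 hW with rfl | hW
      · exact absurd rfl hUW
      · exact hdd W hW
      · exact (hdd U hU).symm
      · exact hP.disj U (Finset.mem_of_mem_erase (Finset.mem_of_mem_erase hU)) W
          (Finset.mem_of_mem_erase (Finset.mem_of_mem_erase hW)) hUW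
    · intro y hy
      obtain ⟨U, hU, hyU⟩ := hP.cover y hy
      by_cases h1 : U = S
      · exact ⟨_, Finset.mem_insert_self _ _, by simp [← h1, hyU]⟩
      by_cases h2 : U = T
      · exact ⟨_, Finset.mem_insert_self _ _, by simp [← h2, hyU]⟩
      exact ⟨U, Finset.mem_insert_of_mem (by simp [h1, h2, hU]), hyU⟩
  have h1 := hmin Q hQc
  have h2 : Q.card ≤ ((P.erase S).erase T).card + 1 := Finset.card_insert_le _ _
  rw [Finset.card_erase_of_mem (Finset.mem_erase.2 ⟨hne.symm, hT⟩), Finset.card_erase_of_mem hS]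
    at h2
  have h3 : 1 < P.card := Finset.one_lt_card.2 ⟨S, hS, T, hT, hne⟩
  omega

/-- `x` lies in the cluster `S`, or touches it and lies in no cluster of `P`. -/
def Attached (E : Finset ι) (v : ι → Finset V) (P : Finset (Finset V)) (x : V) (S : Finset V) :
    Prop :=
  x ∈ S ∨ ((∀ U ∈ P, x ∉ U) ∧ Touch E v {x} S)

/-- Otherwise the two clusters would merge through those of `x` and `y` that lie in no cluster. -/
lemma attached_unique {Y : Finset V} {s₀ s₁ : ℕ} (hs : 2 * s₁ + 3 ≤ s₀)
    (hbad : ∀ S : Finset V, s₁ ≤ S.card → S.card ≤ s₀ → ¬ Rich E v Y S)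
    {P : Finset (Finset V)} (hP : IsClustering E v Y s₁ P)
    (hmin : ∀ Q, IsClustering E v Y s₁ Q → P.card ≤ Q.card)
    {S T : Finset V} (hS : S ∈ P) (hT : T ∈ P) {x y : V} (hx : Attached E v P x S)
    (hy : Attached E v P y T) (hxy : Touch E v {x} {y}) : S = T := by
  by_contra hne
  have cS := (hP.cluster S hS).conn
  have cT := (hP.cluster T hT).conn
  rcases hx with hx | ⟨hx, hxS⟩ <;> rcases hy with hy | ⟨hy, hyT⟩
  · refine merge_clusters hs hbad hP hmin hS hT hne (R := ∅) (by simp) (by simp) ?_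
    rw [Finset.union_empty]
    exact cS.union cT (hxy.mono (by simpa using hx) (by simpa using hy))
  · refine merge_clusters hs hbad hP hmin hS hT hne (R := {y}) (by simp)
      (fun U hU => by simpa using hy U hU) ?_
    have h1 := cT.union (conn_singleton y) hyT.symm
    have h2 := cS.union h1 (hxy.mono (by simpa using hx) (by simp))
    rwa [Finset.union_assoc]
  · refine merge_clusters hs hbad hP hmin hS hT hne (R := {x}) (by simp)
      (fun U hU => by simpa using hx U hU) ?_
    have h1 := cS.union (conn_singleton x) hxS.symm
    have h2 := h1.union cT (hxy.mono (by simp) (by simpa using hy))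
    rwa [Finset.union_right_comm]
  · refine merge_clusters hs hbad hP hmin hS hT hne (R := {x, y})
      (Finset.card_le_two.trans (by norm_num)) (fun U hU => ?_) ?_
    · rw [Finset.disjoint_left]
      intro z hz
      rcases Finset.mem_insert.1 hz with rfl | hz
      · exact hx U hU
      · exact Finset.mem_singleton.1 hz ▸ hy U hU
    · have h1 := cS.union (conn_singleton x) hxS.symm
      have h2 := cT.union (conn_singleton y) hyT.symm
      have h3 := h1.union h2 (hxy.mono (by simp) (by simp))
      convert h3 using 1
      ext z
      simp only [Finset.mem_union, Finset.mem_insert, Finset.mem_singleton]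
      tauto

/-- If `x` touches no cluster, then at most two hyperedges join it to vertices that do. -/
lemma near_of_three {Y : Finset V} {s₀ s₁ : ℕ} (hs : 2 * s₁ + 3 ≤ s₀) (hs₁ : 2 ≤ s₁)
    (hsp : Sparse E v s₀)
    (hbad : ∀ S : Finset V, s₁ ≤ S.card → S.card ≤ s₀ → ¬ Rich E v Y S)
    {P : Finset (Finset V)} (hP : IsClustering E v Y s₁ P)
    (hmin : ∀ Q, IsClustering E v Y s₁ Q → P.card ≤ Q.card)
    {x : V} {C : Fin 3 → ι} (hCi : Function.Injective C) (hCE : ∀ i, C i ∈ E)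
    (hxC : ∀ i, x ∈ v (C i)) {w : Fin 3 → V} (hwC : ∀ i, w i ∈ v (C i)) (hwx : ∀ i, w i ≠ x)
    (hw : ∀ i, ∃ S ∈ P, Attached E v P (w i) S) : ∃ S ∈ P, Attached E v P x S := by
  by_contra! hx
  have hxn : ∀ U ∈ P, x ∉ U := fun U hU h => hx U hU (Or.inl h)
  have hxT : ∀ U ∈ P, ¬ Touch E v {x} U := fun U hU h => hx U hU (Or.inr ⟨hxn, h⟩)
  choose S hSP hS using hw
  have hxw : ∀ i, Touch E v {x} {w i} := fun i =>
    touch_of_mem (hCE i) (hxC i) (hwC i) (Finset.mem_singleton_self _)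
      (Finset.mem_singleton_self _)
  -- If `w i` were in its cluster, `x` would touch that cluster.
  have hwn : ∀ i, (∀ U ∈ P, w i ∉ U) ∧ Touch E v {w i} (S i) := by
    intro i
    rcases hS i with h | h
    · exact absurd ((hxw i).mono subset_rfl (by simpa using h)) (hxT _ (hSP i))
    · exact h
  -- Two different clusters would merge along the path `w i`, `x`, `w j`.
  have hall : ∀ i j, S i = S j := by
    intro i j
    by_contra hne
    refine merge_clusters hs hbad hP hmin (hSP i) (hSP j) hne (R := {w i, x, w j})
      Finset.card_le_three (fun U hU => ?_) ?_
    · rw [Finset.disjoint_left]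
      intro z hz
      simp only [Finset.mem_insert, Finset.mem_singleton] at hz
      rcases hz with rfl | rfl | rfl
      · exact (hwn i).1 U hU
      · exact hxn U hU
      · exact (hwn j).1 U hU
    · have h1 := ((hP.cluster _ (hSP i)).conn).union (conn_singleton (w i)) (hwn i).2.symm
      have h2 := ((hP.cluster _ (hSP j)).conn).union (conn_singleton (w j)) (hwn j).2.symm
      have h3 := h1.union (conn_singleton x) ((hxw i).symm.mono (by simp) (by simp))
      have h4 := h3.union h2 ((hxw j).mono (by simp) (by simp))
      convert h4 using 1
      ext z
      simp only [Finset.mem_union, Finset.mem_insert, Finset.mem_singleton]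
      tauto
  set T := S 0 with hT
  have hTw : ∀ i, Touch E v {w i} T := fun i => by
    have h := (hwn i).2
    rwa [hall i 0] at h
  have cT := hP.cluster T (hSP 0)
  -- The surplus starts at -1 or more, does not drop when the `w i` are added, and rises by at least
  -- 3 - 1 with `x`. This gives positive surplus on at most `T.card + 4 ≤ s₀` vertices.
  have g0 := cT.conn.neg_one_le_surplus cT.nonempty
  have g1 : surplus E v T ≤ surplus E v (insert (w 0) T) := surplus_insert_ge (Or.inr (hTw 0))
  have g2 : surplus E v (insert (w 0) T) ≤ surplus E v (insert (w 1) (insert (w 0) T)) :=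
    surplus_insert_ge (Or.inr ((hTw 1).mono subset_rfl (Finset.subset_insert _ _)))
  have g3 : surplus E v (insert (w 1) (insert (w 0) T)) ≤
      surplus E v (insert (w 2) (insert (w 1) (insert (w 0) T))) :=
    surplus_insert_ge (Or.inr ((hTw 2).mono subset_rfl
      ((Finset.subset_insert _ _).trans (Finset.subset_insert _ _))))
  set K := insert (w 2) (insert (w 1) (insert (w 0) T)) with hK
  have hwK : ∀ i, w i ∈ K := by
    intro i
    fin_cases i <;> simp [hK]
  have hxK : x ∉ K := by
    simp only [hK, Finset.mem_insert, not_or]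
    exact ⟨(hwx 2).symm, (hwx 1).symm, (hwx 0).symm, hxn T (hSP 0)⟩
  have h3 : 3 ≤ (E.filter fun C => x ∈ v C ∧ (v C ∩ K).Nonempty).card := by
    have : (Finset.univ.image C).card = 3 := by
      classical
      rw [Finset.card_image_of_injective _ hCi, Finset.card_univ, Fintype.card_fin]
    rw [← this]
    refine Finset.card_le_card fun D hD => ?_
    obtain ⟨i, -, rfl⟩ := Finset.mem_image.1 hD
    rw [Finset.mem_filter]
    exact ⟨hCE i, hxC i, w i, Finset.mem_inter.2 ⟨hwC i, hwK i⟩⟩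
  have g4 := surplus_insert (E := E) (v := v) hxK
  have hcard : (insert x K).card ≤ s₀ := by
    have e1 := Finset.card_insert_le x K
    have e2 := Finset.card_insert_le (w 2) (insert (w 1) (insert (w 0) T))
    have e3 := Finset.card_insert_le (w 1) (insert (w 0) T)
    have e4 := Finset.card_insert_le (w 0) T
    have := cT.small
    rw [← hK] at e2
    omega
  have g5 := hsp _ hcard
  rw [surplus] at g4
  omega

/-- Sets of vertices attached to clusters have no positive surplus if they are connected. -/
lemma overlap_le_card_of_attached {Y : Finset V} {s₀ s₁ : ℕ} (hs : 2 * s₁ + 3 ≤ s₀) (hs₁ : 2 ≤ s₁)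
    (hsp : Sparse E v s₀)
    (hbad : ∀ S : Finset V, s₁ ≤ S.card → S.card ≤ s₀ → ¬ Rich E v Y S)
    {P : Finset (Finset V)} (hP : IsClustering E v Y s₁ P)
    (hmin : ∀ Q, IsClustering E v Y s₁ Q → P.card ≤ Q.card)
    {W : Finset V} (hW : ∀ x ∈ W, ∃ S ∈ P, Attached E v P x S) (hc : Conn E v W) :
    overlap E v W ≤ W.card := by
  rcases W.eq_empty_or_nonempty with rfl | ⟨x, hx⟩
  · simp [overlap]
  by_contra! hlt
  have hWs : 1 ≤ surplus E v W := by
    rw [surplus]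
    omega
  obtain ⟨S, hS, hxS⟩ := hW x hx
  -- Otherwise connectivity gives a hyperedge between vertices attached to different clusters, which
  -- `attached_unique` forbids.
  have hall : ∀ y ∈ W, Attached E v P y S := by
    by_contra! hcon
    obtain ⟨y, hyW, hy⟩ := hcon
    have hne : (W.filter fun z => Attached E v P z S) ≠ W := by
      intro h
      have := h ▸ hyW
      exact hy (Finset.mem_filter.1 this).2
    obtain ⟨C, hC, ⟨a, ha⟩, ⟨b, hb⟩⟩ := hc (W.filter fun z => Attached E v P z S)
      (Finset.filter_subset _ _) ⟨x, Finset.mem_filter.2 ⟨hx, hxS⟩⟩ hne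
    simp only [Finset.mem_inter, Finset.mem_filter, Finset.mem_sdiff, not_and] at ha hb
    obtain ⟨T, hT, hbT⟩ := hW b hb.2.1
    have hST := attached_unique hs hbad hP hmin hS hT ha.2.2 hbT (touch_of_mem hC ha.1 hb.1
      (Finset.mem_singleton_self _) (Finset.mem_singleton_self _))
    exact hb.2.2 hb.2.1 (hST ▸ hbT)
  have cS := hP.cluster S hS
  have h1 : surplus E v W ≤ surplus E v (W ∪ S) := by
    refine cS.conn.surplus_union_ge ?_
    rcases hxS with h | ⟨_, h⟩
    · exact Or.inl ⟨x, Finset.mem_inter.2 ⟨hx, h⟩⟩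
    · exact Or.inr (h.mono (by simpa using hx) subset_rfl)
  have h2 : ∀ q ∈ W ∪ S, q ∉ S → Touch E v {q} S := by
    intro q hq hqS
    rcases hall q ((Finset.mem_union.1 hq).resolve_right hqS) with h | h
    · exact absurd h hqS
    · exact h.2
  have g0 := cS.conn.neg_one_le_surplus cS.nonempty
  have hsmall := cS.small
  have bound : ∀ K : Finset V, K.card ≤ s₀ → surplus E v K ≤ 0 := by
    intro K hK
    have := hsp K hK
    rw [surplus]
    omega
  -- Two rounds raise the surplus from at least -1 on `S` to at least 1, at the cost of four
  -- vertices, which `s₀` still allows.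
  obtain ⟨a, ha, b, hb, h3⟩ := exists_insert_insert_surplus (Finset.subset_union_right) h2
    (lt_of_le_of_lt (bound S (by omega)) (by omega))
  set K := insert b (insert a S) with hK
  have e1 := Finset.card_insert_le b (insert a S)
  have e2 := Finset.card_insert_le a S
  rw [← hK] at e1
  have hSK : S ⊆ K := (Finset.subset_insert _ _).trans (Finset.subset_insert _ _)
  obtain ⟨a', _, b', _, h4⟩ := exists_insert_insert_surplus (E := E) (v := v) (S := K) (M := W ∪ S)
    (Finset.insert_subset hb (Finset.insert_subset ha Finset.subset_union_right))
    (fun q hq hqK => (h2 q hq fun h => hqK (hSK h)).mono subset_rfl hSK)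
    (lt_of_le_of_lt (bound K (by omega)) (by omega))
  have e3 := Finset.card_insert_le b' (insert a' K)
  have e4 := Finset.card_insert_le a' K
  have := bound _ (show (insert b' (insert a' K)).card ≤ s₀ by omega)
  omega

/-- If no set of moderate size is rich, then there is a class of vertices that contains `Y` and the
neighbours of `Y`, is closed under adding vertices with three hyperedges to it, and whose connected
subsets have no positive surplus. -/
theorem exists_near {Y : Finset V} {s₀ s₁ : ℕ} (hs : 2 * s₁ + 3 ≤ s₀) (hs₁ : 2 ≤ s₁)
    (hsp : Sparse E v s₀)
    (hbad : ∀ S : Finset V, s₁ ≤ S.card → S.card ≤ s₀ → ¬ Rich E v Y S) :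
    ∃ Near : V → Prop, (∀ y ∈ Y, Near y) ∧
      (∀ C ∈ E, ∀ y ∈ v C, y ∈ Y → ∀ x ∈ v C, Near x) ∧
      (∀ x, ∀ T ⊆ E, 3 ≤ T.card → (∀ C ∈ T, x ∈ v C ∧ ∃ w ∈ v C, w ≠ x ∧ Near w) → Near x) ∧
      ∀ W : Finset V, (∀ x ∈ W, Near x) → Conn E v W → overlap E v W ≤ W.card := by
  obtain ⟨P, hP, hmin⟩ := exists_clustering (E := E) (v := v) (Y := Y) hs₁
  refine ⟨fun x => ∃ S ∈ P, Attached E v P x S, ?_, ?_, ?_, ?_⟩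
  · intro y hy
    obtain ⟨S, hS, hyS⟩ := hP.cover y hy
    exact ⟨S, hS, Or.inl hyS⟩
  · intro C hC y hyC hyY x hxC
    by_cases h : ∃ U ∈ P, x ∈ U
    · obtain ⟨U, hU, hxU⟩ := h
      exact ⟨U, hU, Or.inl hxU⟩
    · push Not at h
      obtain ⟨S, hS, hyS⟩ := hP.cover y hyY
      exact ⟨S, hS, Or.inr ⟨h, touch_of_mem hC hxC hyC (Finset.mem_singleton_self _) hyS⟩⟩
  · intro x T hTE hT hx
    obtain ⟨T', hT', hcard⟩ := Finset.exists_subset_card_eq hT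
    let f := (T'.equivFinOfCardEq hcard).symm
    have hmem : ∀ i, (f i : ι) ∈ T := fun i => hT' (f i).2
    choose w hw using fun i => (hx _ (hmem i)).2
    exact near_of_three hs hs₁ hsp hbad hP hmin (C := fun i => (f i : ι))
      (fun i j h => f.injective (Subtype.ext h)) (fun i => hTE (hmem i))
      (fun i => (hx _ (hmem i)).1) (fun i => (hw i).1) (fun i => (hw i).2.1) fun i => (hw i).2.2
  · intro W hW hc
    exact overlap_le_card_of_attached hs hs₁ hsp hbad hP hmin hW hc

end Hypergraph

end PlantedSAT

/-! ### Two cycles in a component force positive surplus. -/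

namespace PlantedSAT

/-- Deleting `e` leaves the graph connected and `c'` intact; deleting an edge of `c'` as well still
leaves it connected. So the graph has two edges more than some connected graph on the same vertices.
-/
lemma card_add_one_le_card_edgeSet {V : Type*} [Finite V] {G : SimpleGraph V} (hG : G.Connected)
    {u v : V} {c : G.Walk u u} {c' : G.Walk v v} (hc : c.IsCycle) (hc' : c'.IsCycle) {e : Sym2 V}
    (he : e ∈ c.edges) (he' : e ∉ c'.edges) : Nat.card V + 1 ≤ Nat.card G.edgeSet := by
  have hdel : ∀ (G : SimpleGraph V), G.Connected → ∀ {u : V} {c : G.Walk u u}, c.IsCycle →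
      ∀ {e : Sym2 V}, e ∈ c.edges → (G.deleteEdges {e}).Connected ∧
        Nat.card (G.deleteEdges {e}).edgeSet + 1 = Nat.card G.edgeSet := by
    intro G hG u c hc e he
    have heG : e ∈ G.edgeSet := c.edges_subset_edgeSet he
    refine ⟨?_, ?_⟩
    · have h : ¬ G.IsBridge e := fun h => h.notMem_edges_of_isCycle hc he
      induction e using Sym2.ind with
      | _ x y => exact hG.connected_delete_edge_of_not_isBridge h
    · rw [SimpleGraph.edgeSet_deleteEdges]
      exact Set.ncard_sdiff_singleton_add_one heG (Set.toFinite _)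
  obtain ⟨h1, h2⟩ := hdel G hG hc he
  have hn : ∀ f ∈ c'.edges, f ∉ ({e} : Set (Sym2 V)) := by
    rintro f hf rfl
    exact he' hf
  have hc2 := SimpleGraph.Walk.IsCycle.toDeleteEdges G {e} hc' hn
  obtain ⟨f, hf⟩ := List.exists_mem_of_length_pos (l := (c'.toDeleteEdges {e} hn).edges)
    (by have := hc2.three_le_length; rw [SimpleGraph.Walk.length_edges]; omega)
  obtain ⟨h3, h4⟩ := hdel _ h1 hc2 hf
  have := h3.card_vert_le_card_edgeSet_add_one
  omega

variable {n : ℕ}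

/-- The variables of a clause. -/
def Clause.vars (C : Clause n) : Finset (Fin n) := C.1.image Prod.fst

lemma Clause.mem_vars {C : Clause n} {x : Fin n} : x ∈ C.vars ↔ C.Mentions x := by
  simp [Clause.vars, Clause.Mentions]

lemma Clause.card_vars (C : Clause n) : C.vars.card = 3 := by
  unfold Clause.vars
  convert C.2.2

/-- The variables of a component of the factor graph induced by the variables outside `H`. -/
noncomputable def compVars (F : Formula n) (H : Finset (Fin n)) (K : (nonCoreGraph F H).ConnectedComponent) :
    Finset (Fin n) :=
  Finset.univ.filter fun x => ∃ h, (⟨Sum.inl x, h⟩ :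
    {v : Fin n ⊕ {C : Clause n // C ∈ F} | ∀ x ∈ H, v ≠ Sum.inl x}) ∈ K.supp

variable {F : Formula n} {H : Finset (Fin n)} {K : (nonCoreGraph F H).ConnectedComponent}

lemma notMem_of_mem_compVars {x : Fin n} (hx : x ∈ compVars F H K) : x ∉ H := by
  obtain ⟨h, _⟩ := (Finset.mem_filter.1 hx).2
  exact fun hH => h x hH rfl

lemma conn_compVars : Conn F Clause.vars (compVars F H K) := by
  intro T hT ⟨t, ht⟩ hne
  by_contra hno
  have htW := hT ht
  obtain ⟨ht0, htK⟩ := (Finset.mem_filter.1 htW).2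
  -- If no clause crosses the cut, then `T` together with the clauses meeting it is closed under
  -- adjacency inside the component.
  let Z : Set {v : Fin n ⊕ {C : Clause n // C ∈ F} | ∀ x ∈ H, v ≠ Sum.inl x} :=
    {w | Sum.elim (fun x => x ∈ T) (fun C => (C.1.vars ∩ T).Nonempty) w.1}
  have hstep : ∀ a b, (nonCoreGraph F H).Adj a b → a ∈ K.supp → a ∈ Z → b ∈ Z := by
    rintro ⟨a, ha⟩ ⟨b, hb⟩ hab haK haZ
    have hbK : (⟨b, hb⟩ : {v : Fin n ⊕ {C : Clause n // C ∈ F} | ∀ x ∈ H, v ≠ Sum.inl x}) ∈ K.supp :=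
      K.mem_supp_of_adj_mem_supp haK hab
    rcases a with x | C <;> rcases b with y | D
    · exact hab.elim
    · exact ⟨x, Finset.mem_inter.2 ⟨Clause.mem_vars.2 hab, haZ⟩⟩
    · have hyC : y ∈ C.1.vars := Clause.mem_vars.2 hab
      by_contra hy
      have hyW : y ∈ compVars F H K := Finset.mem_filter.2 ⟨Finset.mem_univ _, hb, hbK⟩
      exact hno ⟨C.1, C.2, haZ, y, Finset.mem_inter.2 ⟨hyC, Finset.mem_sdiff.2 ⟨hyW, hy⟩⟩⟩
    · exact hab.elim
  have hwalk : ∀ a b, (nonCoreGraph F H).Walk a b → a ∈ K.supp → a ∈ Z → b ∈ Z := by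
    intro a b w
    induction w with
    | nil => exact fun _ h => h
    | cons h _ ih =>
      intro haK haZ
      exact ih (K.mem_supp_of_adj_mem_supp haK h) (hstep _ _ h haK haZ)
  refine hne (Finset.Subset.antisymm hT fun x hx => ?_)
  obtain ⟨hx0, hxK⟩ := (Finset.mem_filter.1 hx).2
  obtain ⟨w⟩ := K.reachable_of_mem_supp htK hxK
  exact hwalk _ _ w htK ht

/-- In the component, count variables plus clauses as vertices and `|C ∩ W|` edges at each clause
`C`. The excess of edges over vertices becomes the surplus of `W` once one edge per clause is
cancelled against the clause itself. -/
lemma card_lt_overlap_compVars {u v : {v : Fin n ⊕ {C : Clause n // C ∈ F} | ∀ x ∈ H, v ≠ Sum.inl x}}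
    (hu : u ∈ K.supp) (hv : v ∈ K.supp) {c : (nonCoreGraph F H).Walk u u}
    {c' : (nonCoreGraph F H).Walk v v} (hc : c.IsCycle) (hc' : c'.IsCycle)
    {e : Sym2 {v : Fin n ⊕ {C : Clause n // C ∈ F} | ∀ x ∈ H, v ≠ Sum.inl x}}
    (he : e ∈ c.edges) (he' : e ∉ c'.edges) :
    (compVars F H K).card < overlap F Clause.vars (compVars F H K) := by
  set W := compVars F H K with hW
  have hsupp : ∀ {u} (c : (nonCoreGraph F H).Walk u u), u ∈ K.supp → ∀ x ∈ c.support, x ∈ K.supp := by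
    intro u c hu x hx
    have := SimpleGraph.ConnectedComponent.sound ⟨c.takeUntil x hx⟩
    rw [SimpleGraph.ConnectedComponent.mem_supp_iff] at hu ⊢
    rw [← this, hu]
  let f := (SimpleGraph.Embedding.induce (G := nonCoreGraph F H) K.supp).toHom
  have hf : Function.Injective f := Subtype.val_injective
  let c₁ := c.induce K.supp (hsupp c hu)
  let c₂ := c'.induce K.supp (hsupp c' hv)
  have hm₁ : c₁.map f = c := c.map_induce _
  have hm₂ : c₂.map f = c' := c'.map_induce _
  have hc₁ : c₁.IsCycle := SimpleGraph.Walk.IsCycle.of_map (f := f) (by rw [hm₁]; exact hc)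
  have hc₂ : c₂.IsCycle := SimpleGraph.Walk.IsCycle.of_map (f := f) (by rw [hm₂]; exact hc')
  obtain ⟨e₀, he₀, rfl⟩ : ∃ e₀ ∈ c₁.edges, Sym2.map f e₀ = e := by
    have h : c.edges = c₁.edges.map (Sym2.map f) :=
      (congrArg SimpleGraph.Walk.edges hm₁).symm.trans (c₁.edges_map f)
    exact List.mem_map.1 (h ▸ he)
  have he₀' : e₀ ∉ c₂.edges := by
    intro h
    apply he'
    have h2 : c'.edges = c₂.edges.map (Sym2.map f) :=
      (congrArg SimpleGraph.Walk.edges hm₂).symm.trans (c₂.edges_map f)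
    exact h2 ▸ List.mem_map_of_mem h
  have hmain := card_add_one_le_card_edgeSet (G := (nonCoreGraph F H).induce K.supp)
    K.connected_toSimpleGraph hc₁ hc₂ he₀ he₀'
  let CK : Finset {C : Clause n // C ∈ F} := Finset.univ.filter fun C => ∃ h, (⟨Sum.inr C, h⟩ :
    {v : Fin n ⊕ {C : Clause n // C ∈ F} | ∀ x ∈ H, v ≠ Sum.inl x}) ∈ K.supp
  have hV : W.card + CK.card ≤ Nat.card K.supp := by
    rw [← Finset.card_disjSum, ← Set.ncard_coe_finset]
    let g : {v : Fin n ⊕ {C : Clause n // C ∈ F} | ∀ x ∈ H, v ≠ Sum.inl x} →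
      Fin n ⊕ {C : Clause n // C ∈ F} := Subtype.val
    have hsub : (↑(W.disjSum CK) : Set (Fin n ⊕ {C : Clause n // C ∈ F})) ⊆ g '' K.supp := by
      rintro (x | C) h
      · obtain ⟨h0, h1⟩ := (Finset.mem_filter.1 (Finset.inl_mem_disjSum.1 h)).2
        exact ⟨_, h1, rfl⟩
      · obtain ⟨h0, h1⟩ := (Finset.mem_filter.1 (Finset.inr_mem_disjSum.1 h)).2
        exact ⟨_, h1, rfl⟩
    exact (Set.ncard_le_ncard hsub (Set.toFinite _)).trans (Set.ncard_image_le (Set.toFinite _))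
  have hE : Nat.card ((nonCoreGraph F H).induce K.supp).edgeSet ≤
      ∑ C ∈ CK, (C.1.vars ∩ W).card := by
    let g : K.supp → Fin n ⊕ {C : Clause n // C ∈ F} := fun w => w.1.1
    have hg : Function.Injective g := Subtype.val_injective.comp Subtype.val_injective
    let PP : Finset (Sym2 (Fin n ⊕ {C : Clause n // C ∈ F})) :=
      CK.biUnion fun C => (C.1.vars ∩ W).image fun x => s(Sum.inl x, Sum.inr C)
    have h1 : Nat.card ((nonCoreGraph F H).induce K.supp).edgeSet ≤ PP.card := by
      rw [← Set.ncard_coe_finset]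
      change (((nonCoreGraph F H).induce K.supp).edgeSet).ncard ≤ _
      rw [← Set.ncard_image_of_injective _ (Sym2.map.injective hg)]
      refine Set.ncard_le_ncard ?_ (Set.toFinite _)
      rintro _ ⟨e, he, rfl⟩
      induction e using Sym2.ind with
      | _ a b =>
        have hab : (nonCoreGraph F H).Adj a.1 b.1 := he
        have key : ∀ (x : Fin n) (C : {C : Clause n // C ∈ F}) (a b : K.supp),
            g a = Sum.inl x → g b = Sum.inr C → (nonCoreGraph F H).Adj a.1 b.1 →
            s(Sum.inl x, Sum.inr C) ∈ PP := by
          rintro x C ⟨⟨a, ha⟩, haK⟩ ⟨⟨b, hb⟩, hbK⟩ h1 h2 hab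
          change a = _ at h1
          change b = _ at h2
          subst h1 h2
          refine Finset.mem_biUnion.2 ⟨C, Finset.mem_filter.2 ⟨Finset.mem_univ _, hb, hbK⟩, ?_⟩
          exact Finset.mem_image_of_mem _ (Finset.mem_inter.2 ⟨Clause.mem_vars.2 hab,
            Finset.mem_filter.2 ⟨Finset.mem_univ _, ha, haK⟩⟩)
        change s(g a, g b) ∈ (PP : Set _)
        rw [Finset.mem_coe]
        rcases hga : g a with x | C <;> rcases hgb : g b with y | D
        · have : (factorGraph F).Adj (g a) (g b) := hab
          rw [hga, hgb] at this
          exact this.elim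
        · exact key x D a b hga hgb hab
        · rw [Sym2.eq_swap]
          exact key y C b a hgb hga hab.symm
        · have : (factorGraph F).Adj (g a) (g b) := hab
          rw [hga, hgb] at this
          exact this.elim
    refine h1.trans (Finset.card_biUnion_le.trans (Finset.sum_le_sum fun C _ => ?_))
    exact Finset.card_image_le
  have hsum : ∑ C ∈ CK, ((C.1.vars ∩ W).card - 1) ≤ overlap F Clause.vars W := by
    have : ∑ C ∈ CK, ((C.1.vars ∩ W).card - 1) =
        ∑ C ∈ CK.map (Function.Embedding.subtype _), ((C.vars ∩ W).card - 1) := by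
      rw [Finset.sum_map]
      rfl
    rw [this]
    refine Finset.sum_le_sum_of_subset ?_
    intro C hC
    obtain ⟨D, -, rfl⟩ := Finset.mem_map.1 hC
    exact D.2
  have h5 : ∑ C ∈ CK, (C.1.vars ∩ W).card ≤ ∑ C ∈ CK, ((C.1.vars ∩ W).card - 1) + CK.card := by
    rw [Finset.card_eq_sum_ones, ← Finset.sum_add_distrib]
    exact Finset.sum_le_sum fun C _ => by omega
  omega

end PlantedSAT

/-! ### Non-core variables are near faulty variables. -/

namespace PlantedSAT

variable {n : ℕ}

/-- The variable `y` has small support, or its clauses or the messages that it receives are out of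
balance. -/
def Faulty (d : ℝ) (F : Formula n) (φ : Assignment n) (α : Messages F) (π : EdgeOrder F)
    (y : Fin n) : Prop :=
  ((Ns F φ y).card : ℝ) ≤ d / 3 ∨
    d / 30 < gap (Npp F φ y) (Nm F φ y) ∨
    (∃ e : MsgEdge F, d / 30 <
      gap (before π e (edgesInto F (Npp F φ y) y)) (before π e (edgesInto F (Nm F φ y) y))) ∨
    d / 30 < gap (ones α (edgesInto F (Npp F φ y) y)) (ones α (edgesInto F (Nm F φ y) y)) ∨
    (∃ e : MsgEdge F, d / 30 <
      gap (ones α (before π e (edgesInto F (Npp F φ y) y)))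
        (ones α (before π e (edgesInto F (Nm F φ y) y)))) ∨
    ((ones α (edgesInto F (Ns F φ y) y)).card : ℝ) < d / 7

/-- Induction along the peeling; `hstep` is needed only for sets whose complement already consists
of near variables. -/
lemma notMem_peel {d : ℝ} {F : Formula n} {φ : Assignment n} {Near : Fin n → Prop}
    (hstep : ∀ A a, (∀ x ∉ A, Near x) → a ∈ A → Removable d F φ A a → Near a)
    {A : Finset (Fin n)} (hA : ∀ x ∉ A, Near x) : ∀ x ∉ peel d F φ A, Near x := by
  induction hk : A.card using Nat.strong_induction_on generalizing A with
  | _ k ih =>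
    rw [peel]
    split_ifs with h
    · have hs := h.choose_spec
      refine ih _ (hk ▸ Finset.card_erase_lt_of_mem hs.1) (fun x hx => ?_) rfl
      by_cases hxa : x = h.choose
      · exact hxa ▸ hstep A _ hA hs.1 hs.2
      · exact hA x fun hxA => hx (Finset.mem_erase.2 ⟨hxa, hxA⟩)
    · exact hA

lemma mem_Ns {F : Formula n} {φ : Assignment n} {x : Fin n} {C : Clause n} :
    C ∈ Ns F φ x ↔ C ∈ F ∧ Supports φ x C := Finset.mem_filter

/-- A drop of the support from above `d/3` to below `d/4` puts more than `d/12` clauses outside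
`F[A]`. So more than `d/30 ≥ 3` clauses leave `A` in either case. -/
lemma three_le_of_removable {d : ℝ} (hd : 90 ≤ d) {F : Formula n} {φ : Assignment n}
    {A : Finset (Fin n)} {a : Fin n} (ha : d / 3 < ((Ns F φ a).card : ℝ))
    (h : Removable d F φ A a) :
    3 ≤ (F.filter fun C => C.Mentions a ∧ C ∉ restrict F A).card := by
  suffices h : d / 30 < ((F.filter fun C => C.Mentions a ∧ C ∉ restrict F A).card : ℝ) by
    have : (3 : ℝ) < ((F.filter fun C => C.Mentions a ∧ C ∉ restrict F A).card : ℝ) := by linarith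
    exact_mod_cast this.le
  rcases h with h | h
  · have hsub : Ns F φ a ⊆ Ns (restrict F A) φ a ∪
        F.filter fun C => C.Mentions a ∧ C ∉ restrict F A := by
      intro C hC
      obtain ⟨hCF, hCs⟩ := mem_Ns.1 hC
      rw [Finset.mem_union, mem_Ns, Finset.mem_filter]
      by_cases hCr : C ∈ restrict F A
      · exact Or.inl ⟨hCr, hCs⟩
      · exact Or.inr ⟨hCF, ⟨_, hCs.1⟩, hCr⟩
    have h1 := (Finset.card_le_card hsub).trans (Finset.card_union_le _ _)
    have h2 : ((Ns F φ a).card : ℝ) ≤ ((Ns (restrict F A) φ a).card : ℝ) +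
        ((F.filter fun C => C.Mentions a ∧ C ∉ restrict F A).card : ℝ) := by exact_mod_cast h1
    linarith
  · exact h

/-- If the formula is sparse and has no rich sets of faulty variables, then the components of the
factor graph induced by the non-core variables have at most one cycle. -/
theorem componentsAtMostOneCycle_of_sparse {d : ℝ} (hd : 90 ≤ d) {F : Formula n}
    {φ : Assignment n} {α : Messages F} {π : EdgeOrder F} {s₀ s₁ : ℕ} (hs : 2 * s₁ + 3 ≤ s₀)
    (hs₁ : 2 ≤ s₁) (hsp : Sparse F Clause.vars s₀)
    (hbad : ∀ S : Finset (Fin n), s₁ ≤ S.card → S.card ≤ s₀ →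
      ¬ Rich F Clause.vars (Finset.univ.filter (Faulty d F φ α π)) S) :
    ComponentsAtMostOneCycle (nonCoreGraph F (core d F φ α π)) := by
  obtain ⟨Near, hN1, hN2, hN3, hN4⟩ := exists_near hs hs₁ hsp hbad
  have hF : ∀ y, Faulty d F φ α π y → Near y := fun y hy => hN1 y (by simpa using hy)
  have hF2 : ∀ (e : MsgEdge F) (y : Fin n), e.1.1.Mentions y → Faulty d F φ α π y → Near e.1.2 :=
    fun e y hy hf => hN2 e.1.1 e.2.1 y (Clause.mem_vars.2 hy) (by simpa using hf) e.1.2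
      (Clause.mem_vars.2 e.2.2)
  have hcore : ∀ x ∉ core d F φ α π, Near x := by
    refine notMem_peel (fun A a hA ha hr => ?_) fun x hx => ?_
    · by_cases hfa : ((Ns F φ a).card : ℝ) ≤ d / 3
      · exact hF a (Or.inl hfa)
      · refine hN3 a _ (Finset.filter_subset _ F) (three_le_of_removable hd (not_le.1 hfa) hr) ?_
        intro C hC
        obtain ⟨hCF, hCa, hCr⟩ := Finset.mem_filter.1 hC
        refine ⟨Clause.mem_vars.2 hCa, ?_⟩
        -- A clause outside `F[A]` contains a variable outside `A`, which is near and differs from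
        -- `a`.
        by_contra! hcon
        refine hCr (Finset.mem_filter.2 ⟨hCF, fun x hx => ?_⟩)
        by_contra hxA
        exact hcon x (Clause.mem_vars.2 hx) (fun h => hxA (h ▸ ha)) (hA x hxA)
    · have hviol : Violated d F φ α π x → Near x := by
        rintro ⟨e, rfl, y, hy, _, h | h | h⟩
        · exact hF2 e y hy (Or.inr (Or.inr (Or.inr (Or.inr (Or.inl ⟨e, h⟩)))))
        · exact hF2 e y hy (Or.inr (Or.inr (Or.inr (Or.inl h))))
        · exact hF2 e y hy (Or.inr (Or.inr (Or.inr (Or.inr (Or.inr h)))))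
      simp only [initialCore, Finset.mem_sdiff, Finset.mem_univ, true_and, not_not,
        Finset.mem_union, Finset.mem_filter] at hx
      rcases hx with (hx | hx) | hx
      · exact hF x (Or.inl hx)
      · by_contra hne
        refine hx fun e he y hy hyx => ?_
        subst he
        refine ⟨?_, ?_, ?_⟩ <;> by_contra hcon <;> rw [not_le] at hcon
        · exact hne (hF2 e y hy (Or.inr (Or.inr (Or.inl ⟨e, hcon⟩))))
        · exact hne (hF2 e y hy (Or.inr (Or.inl hcon)))
        · exact hne (hF2 e y hy (Or.inl hcon.le))
      · exact hviol hx.2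
  have hno : ∀ (K : (nonCoreGraph F (core d F φ α π)).ConnectedComponent), ∀ u ∈ K.supp,
      ∀ v ∈ K.supp, ∀ (c : (nonCoreGraph F (core d F φ α π)).Walk u u)
      (c' : (nonCoreGraph F (core d F φ α π)).Walk v v), c.IsCycle → c'.IsCycle →
      ∀ e, e ∈ c.edges → e ∈ c'.edges := by
    intro K u hu v hv c c' hc hc' e he
    by_contra he'
    exact absurd (hN4 _ (fun x hx => hcore x (notMem_of_mem_compVars hx)) conn_compVars)
      (not_le.2 (card_lt_overlap_compVars hu hv hc hc' he he'))
  intro K u hu v hv c c' hc hc' e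
  exact ⟨hno K u hu v hv c c' hc hc' e, hno K v hv u hu c' c hc' hc e⟩

end PlantedSAT

/-! ### From faulty variables to faulty private clauses. -/

namespace PlantedSAT

variable {n : ℕ}

/-- `1` if `C` belongs to `N^{++}(y)`, `-1` if it belongs to `N^-(y)`. -/
noncomputable def sgn (φ : Assignment n) (y : Fin n) (C : Clause n) : ℝ :=
  (if (y, φ y) ∈ C.1 ∧ ¬ Supports φ y C then 1 else 0) - (if (y, !φ y) ∈ C.1 then 1 else 0)

/-- `y` is the only variable of `C` that belongs to `S`. -/
def Priv (S : Finset (Fin n)) (y : Fin n) (C : Clause n) : Prop := C.vars ∩ S = {y}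

/-- The version of `Faulty` that looks only at the clauses that meet `S` in `y` alone, for the
order of the message edges given by the positions `κ`. -/
def PrivFaulty (d : ℝ) (φ : Assignment n) (κ : Finset (Fin n) × Fin n → ℕ) (S : Finset (Fin n))
    (y : Fin n) (F : Formula n) (a : Clause n → Fin n → Bool) : Prop :=
  ((F.filter fun C => Priv S y C ∧ Supports φ y C).card : ℝ) ≤ d / 3 ∨
    ((F.filter fun C => (Priv S y C ∧ Supports φ y C) ∧ a C y = true).card : ℝ) ≤ d / 7 ∨
    (∃ t, d / 60 < |∑ C ∈ F with Priv S y C ∧ κ (C.vars, y) < t, sgn φ y C|) ∨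
    ∃ t, d / 60 < |∑ C ∈ F with Priv S y C ∧ κ (C.vars, y) < t,
      if a C y = true then sgn φ y C else 0|

lemma abs_sgn_le (φ : Assignment n) (y : Fin n) (C : Clause n) : |sgn φ y C| ≤ 1 := by
  unfold sgn
  split_ifs <;> norm_num

lemma sgn_eq_zero {φ : Assignment n} {y : Fin n} {C : Clause n} (h : y ∉ C.vars) :
    sgn φ y C = 0 := by
  have h' : ∀ b, (y, b) ∉ C.1 := fun b hb => h (Clause.mem_vars.2 ⟨b, hb⟩)
  simp [sgn, h']

lemma card_edges {F S : Formula n} (y : Fin n) (hSF : S ⊆ F) (hS : ∀ C ∈ S, C.Mentions y)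
    (q : MsgEdge F → Prop) (q' : Clause n → Prop) [DecidablePred q] [DecidablePred q']
    (hq : ∀ e : MsgEdge F, e.1.2 = y → (q e ↔ q' e.1.1)) :
    ((edgesInto F S y).filter q).card = (S.filter q').card := by
  refine Finset.card_bij (fun e _ => e.1.1) ?_ ?_ ?_
  · intro e he
    simp only [edgesInto, Finset.mem_filter, Finset.mem_univ, true_and] at he ⊢
    exact ⟨he.1.2, (hq e he.1.1).1 he.2⟩
  · intro e he e' he' h
    simp only [edgesInto, Finset.mem_filter, Finset.mem_univ, true_and] at he he'
    exact Subtype.ext (Prod.ext h (he.1.1.trans he'.1.1.symm))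
  · intro C hC
    obtain ⟨hCS, hCq⟩ := Finset.mem_filter.1 hC
    refine ⟨⟨(C, y), hSF hCS, hS C hCS⟩, ?_, rfl⟩
    simp only [edgesInto, Finset.mem_filter, Finset.mem_univ, true_and]
    exact ⟨hCS, (hq _ rfl).2 hCq⟩

lemma card_Npp_sub_card_Nm (F : Formula n) (φ : Assignment n) (y : Fin n) (q : Clause n → Prop)
    [DecidablePred q] :
    (((Npp F φ y).filter q).card : ℝ) - (((Nm F φ y).filter q).card : ℝ) =
      ∑ C ∈ F with q C, sgn φ y C := by
  simp only [sgn, Finset.sum_sub_distrib, Finset.sum_boole, Npp, Nm, Finset.filter_filter,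
    and_comm]

/-- The number of clauses of `F` that contain `y` and at least two elements of `S`. -/
noncomputable def innerDegree (F : Formula n) (S : Finset (Fin n)) (y : Fin n) : ℕ :=
  (F.filter fun C => y ∈ C.vars ∧ 2 ≤ (C.vars ∩ S).card).card

/-- A clause with `k ≥ 2` variables in `S` is counted `k` times on the left and `k ≤ 2 * (k - 1)`.
-/
lemma sum_innerDegree_le (F : Formula n) (S : Finset (Fin n)) :
    ∑ y ∈ S, innerDegree F S y ≤ 2 * overlap F Clause.vars S := by
  simp only [innerDegree, Finset.card_filter]
  rw [Finset.sum_comm, overlap, Finset.mul_sum]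
  refine Finset.sum_le_sum fun C _ => ?_
  rw [← Finset.card_filter]
  by_cases h : 2 ≤ (C.vars ∩ S).card
  · have : (S.filter fun y => y ∈ C.vars ∧ 2 ≤ (C.vars ∩ S).card) = C.vars ∩ S := by
      ext y
      simp [h, and_comm]
    rw [this]
    omega
  · simp [h]

lemma not_priv {S : Finset (Fin n)} {y : Fin n} (hy : y ∈ S) {C : Clause n} (hyC : y ∈ C.vars)
    (h : ¬ Priv S y C) : 2 ≤ (C.vars ∩ S).card := by
  by_contra hlt
  have hm : y ∈ C.vars ∩ S := Finset.mem_inter.2 ⟨hyC, hy⟩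
  have h1 : (C.vars ∩ S).card = 1 := by
    have := Finset.card_pos.2 ⟨y, hm⟩
    omega
  obtain ⟨z, hz⟩ := Finset.card_eq_one.1 h1
  rw [hz, Finset.mem_singleton] at hm
  exact h (by rw [Priv, hz, hm])

/-- The omitted terms come from clauses counted by `innerDegree` and have absolute value at most 1.
-/
lemma abs_sum_priv_ge {F : Formula n} {S : Finset (Fin n)} {y : Fin n} (hy : y ∈ S)
    (f : Clause n → ℝ) (hf : ∀ C, |f C| ≤ 1) (hf0 : ∀ C, y ∉ C.vars → f C = 0)
    (q : Clause n → Prop) [DecidablePred q] :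
    |∑ C ∈ F with q C, f C| ≤ |∑ C ∈ F with Priv S y C ∧ q C, f C| + innerDegree F S y := by
  have h1 : ∑ C ∈ F with q C, f C = ∑ C ∈ F with Priv S y C ∧ q C, f C +
      ∑ C ∈ F with ¬ Priv S y C ∧ q C, f C := by
    rw [← Finset.sum_filter_add_sum_filter_not (F.filter q) (Priv S y), Finset.filter_filter,
      Finset.filter_filter]
    simp only [and_comm]
  have h2 : |∑ C ∈ F with ¬ Priv S y C ∧ q C, f C| ≤ innerDegree F S y := by
    refine (Finset.abs_sum_le_sum_abs _ _).trans ?_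
    rw [innerDegree, Finset.card_filter, Finset.sum_filter]
    push_cast
    refine Finset.sum_le_sum fun C _ => ?_
    by_cases hyC : y ∈ C.vars
    · by_cases h : ¬ Priv S y C ∧ q C
      · rw [if_pos h, if_pos ⟨hyC, not_priv hy hyC h.1⟩]
        exact hf C
      · rw [if_neg h]
        positivity
    · rw [hf0 C hyC]
      simp
      positivity
  rw [h1]
  exact (abs_add_le _ _).trans (by linarith)

section

variable {d : ℝ} {F : Formula n} {φ : Assignment n} {α : Messages F} {π : EdgeOrder F}
  {κ : Finset (Fin n) × Fin n → ℕ} {a : Clause n → Fin n → Bool}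

lemma Npp_subset (y : Fin n) : Npp F φ y ⊆ F := Finset.filter_subset _ _

lemma Nm_subset (y : Fin n) : Nm F φ y ⊆ F := Finset.filter_subset _ _

lemma mentions_of_mem_Npp {y : Fin n} : ∀ C ∈ Npp F φ y, C.Mentions y :=
  fun _ hC => ⟨_, (Finset.mem_filter.1 hC).2.1⟩

lemma mentions_of_mem_Nm {y : Fin n} : ∀ C ∈ Nm F φ y, C.Mentions y :=
  fun _ hC => ⟨_, (Finset.mem_filter.1 hC).2⟩

lemma gap_edges (y : Fin n) (q : MsgEdge F → Prop) (q' : Clause n → Prop) [DecidablePred q]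
    [DecidablePred q']
    (hq : ∀ e : MsgEdge F, e.1.2 = y → (q e ↔ q' e.1.1)) :
    gap ((edgesInto F (Npp F φ y) y).filter q) ((edgesInto F (Nm F φ y) y).filter q) =
      |∑ C ∈ F with q' C, sgn φ y C| := by
  rw [gap, card_edges y (Npp_subset y) mentions_of_mem_Npp q q' hq,
    card_edges y (Nm_subset y) mentions_of_mem_Nm q q' hq, card_Npp_sub_card_Nm]

/-- Dropping the inner clauses changes a balance by at most `16 ≤ d / 60`, which lowers the
threshold from `d / 30` to `d / 60`. The support counts can only decrease. -/
lemma Faulty.privFaulty (hd : 960 ≤ d) (hα : ∀ e, α e = a e.1.1 e.1.2)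
    (hπ : ∀ e e', π e < π e' ↔ κ (e.1.1.vars, e.1.2) < κ (e'.1.1.vars, e'.1.2))
    {S : Finset (Fin n)} {y : Fin n} (hy : y ∈ S) (hdeg : innerDegree F S y ≤ 16)
    (h : Faulty d F φ α π y) : PrivFaulty d φ κ S y F a := by
  have hdeg' : (innerDegree F S y : ℝ) ≤ 16 := by exact_mod_cast hdeg
  have hplain : ∀ (q : Clause n → Prop) [DecidablePred q], d / 30 < |∑ C ∈ F with q C, sgn φ y C| →
      d / 60 < |∑ C ∈ F with Priv S y C ∧ q C, sgn φ y C| := by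
    intro q _ hq
    have := abs_sum_priv_ge (F := F) hy (sgn φ y) (abs_sgn_le φ y) (fun _ => sgn_eq_zero) q
    linarith
  have hones : ∀ (q : Clause n → Prop) [DecidablePred q],
      d / 30 < |∑ C ∈ F with q C ∧ a C y = true, sgn φ y C| →
      d / 60 < |∑ C ∈ F with Priv S y C ∧ q C, if a C y = true then sgn φ y C else 0| := by
    intro q _ hq
    have := abs_sum_priv_ge (F := F) hy (fun C => if a C y = true then sgn φ y C else 0)
      (fun C => by
        split_ifs
        · exact abs_sgn_le φ y C
        · simp) (fun C hC => by simp [sgn_eq_zero hC]) q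
    rw [← Finset.filter_filter, Finset.sum_filter] at hq
    linarith
  -- A bound beyond all positions makes the total balance a special case of the balance of a prefix.
  obtain ⟨t₀, ht₀⟩ : ∃ t, ∀ C : Clause n, κ (C.vars, y) < t := by
    obtain ⟨t, ht⟩ := (Set.finite_range fun C : Clause n => κ (C.vars, y)).bddAbove
    exact ⟨t + 1, fun C => Nat.lt_succ_of_le (ht ⟨C, rfl⟩)⟩
  have hbefore : ∀ e e' : MsgEdge F, e'.1.2 = y →
      (π e' < π e ↔ κ (e'.1.1.vars, y) < κ (e.1.1.vars, e.1.2)) := by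
    rintro e e' rfl
    exact hπ e' e
  have hone : ∀ e' : MsgEdge F, e'.1.2 = y → (α e' = true ↔ a e'.1.1 y = true) := by
    rintro e' rfl
    rw [hα]
  rcases h with h | h | ⟨e, h⟩ | h | ⟨e, h⟩ | h
  · left
    refine le_trans ?_ h
    have : (F.filter fun C => Priv S y C ∧ Supports φ y C) ⊆ Ns F φ y := by
      intro C hC
      obtain ⟨h1, h2⟩ := Finset.mem_filter.1 hC
      exact mem_Ns.2 ⟨h1, h2.2⟩
    exact_mod_cast Finset.card_le_card this
  · right; right; left
    refine ⟨t₀, hplain (fun C => κ (C.vars, y) < t₀) ?_⟩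
    simp only [ht₀, Finset.filter_true]
    have := card_Npp_sub_card_Nm F φ y (fun _ => True)
    simp only [Finset.filter_true] at this
    rwa [← this]
  · right; right; left
    refine ⟨κ (e.1.1.vars, e.1.2), hplain (fun C => κ (C.vars, y) < κ (e.1.1.vars, e.1.2)) ?_⟩
    rw [before, before, gap_edges y _ (fun C => κ (C.vars, y) < κ (e.1.1.vars, e.1.2))
      (hbefore e)] at h
    exact h
  · right; right; right
    refine ⟨t₀, hones (fun C => κ (C.vars, y) < t₀) ?_⟩
    simp only [ht₀, true_and]
    rw [ones, ones, gap_edges y _ (fun C => a C y = true) hone] at h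
    exact h
  · right; right; right
    refine ⟨κ (e.1.1.vars, e.1.2), hones (fun C => κ (C.vars, y) < κ (e.1.1.vars, e.1.2)) ?_⟩
    rw [before, before, ones, ones, Finset.filter_filter, Finset.filter_filter,
      gap_edges y _ (fun C => κ (C.vars, y) < κ (e.1.1.vars, e.1.2) ∧ a C y = true)
      (fun e' he' => and_congr (hbefore e e' he') (hone e' he'))] at h
    exact h
  · right; left
    rw [ones, card_edges y (show Ns F φ y ⊆ F from Finset.filter_subset _ _)
      (fun C hC => ⟨_, (mem_Ns.1 hC).2.1⟩) _ (fun C => a C y = true) hone] at h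
    refine le_trans ?_ h.le
    have : (F.filter fun C => (Priv S y C ∧ Supports φ y C) ∧ a C y = true) ⊆
        (Ns F φ y).filter fun C => a C y = true := by
      intro C hC
      obtain ⟨h1, h2⟩ := Finset.mem_filter.1 hC
      exact Finset.mem_filter.2 ⟨mem_Ns.2 ⟨h1, h2.1.2⟩, h2.2⟩
    exact_mod_cast Finset.card_le_card this

/-- An eighth of a sparse rich set consists of variables whose private clauses are faulty. -/
lemma exists_privFaulty (hd : 960 ≤ d) (hα : ∀ e, α e = a e.1.1 e.1.2)
    (hπ : ∀ e e', π e < π e' ↔ κ (e.1.1.vars, e.1.2) < κ (e'.1.1.vars, e'.1.2))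
    {S : Finset (Fin n)} (hov : overlap F Clause.vars S ≤ S.card)
    (hr : Rich F Clause.vars (Finset.univ.filter (Faulty d F φ α π)) S) :
    ∃ Y ⊆ S, S.card ≤ 8 * Y.card ∧ ∀ y ∈ Y, PrivFaulty d φ κ S y F a := by
  refine ⟨S.filter fun y => Faulty d F φ α π y ∧ innerDegree F S y ≤ 16, Finset.filter_subset _ _,
    ?_, fun y hy => ?_⟩
  · have h1 : 17 * (S.filter fun y => ¬ innerDegree F S y ≤ 16).card ≤ 2 * S.card := by
      calc 17 * (S.filter fun y => ¬ innerDegree F S y ≤ 16).card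
          = ∑ y ∈ S with ¬ innerDegree F S y ≤ 16, 17 := by
            rw [Finset.sum_const, smul_eq_mul, mul_comm]
        _ ≤ ∑ y ∈ S with ¬ innerDegree F S y ≤ 16, innerDegree F S y := by
            refine Finset.sum_le_sum fun y hy => ?_
            have := (Finset.mem_filter.1 hy).2
            omega
        _ ≤ ∑ y ∈ S, innerDegree F S y := Finset.sum_le_sum_of_subset (Finset.filter_subset _ _)
        _ ≤ 2 * overlap F Clause.vars S := sum_innerDegree_le F S
        _ ≤ 2 * S.card := by omega
    have h2 : (Finset.univ.filter (Faulty d F φ α π) ∩ S).card ≤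
        (S.filter fun y => Faulty d F φ α π y ∧ innerDegree F S y ≤ 16).card +
          (S.filter fun y => ¬ innerDegree F S y ≤ 16).card := by
      refine (Finset.card_le_card ?_).trans (Finset.card_union_le _ _)
      intro y hy
      simp only [Finset.mem_inter, Finset.mem_filter, Finset.mem_univ, true_and,
        Finset.mem_union] at hy ⊢
      tauto
    have := hr.2
    omega
  · obtain ⟨hyS, hf, hdeg⟩ := Finset.mem_filter.1 hy
    exact hf.privFaulty hd hα hπ hyS hdeg

end

end PlantedSAT

/-! ### Expectations with respect to product weights. -/

namespace PlantedSAT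

/-- Take the coordinates in `A` from `ω` and the others from `ω'`. -/
noncomputable def mix {ι β : Type*} (A : Set ι) (ω ω' : ι → β) : ι → β := fun i => if i ∈ A then ω i else ω' i

lemma mix_mix {ι β : Type*} (A : Set ι) (ω ω' : ι → β) : mix A (mix A ω ω') (mix A ω' ω) = ω := by
  funext i
  by_cases h : i ∈ A <;> simp [mix, h]

section ProductExpectation

variable {ι β κ : Type*} [Fintype ι] [Fintype β] [DecidableEq ι]

/-- The expectation of `f` with respect to the product of the weights `μ i`. -/
def pexp (μ : ι → β → ℝ) (f : (ι → β) → ℝ) : ℝ := ∑ ω : ι → β, (∏ i, μ i (ω i)) * f ω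

variable {μ : ι → β → ℝ}

lemma pexp_mono (hμ : ∀ i b, 0 ≤ μ i b) {f g : (ι → β) → ℝ} (h : ∀ ω, f ω ≤ g ω) :
    pexp μ f ≤ pexp μ g :=
  Finset.sum_le_sum fun ω _ =>
    mul_le_mul_of_nonneg_left (h ω) (Finset.prod_nonneg fun i _ => hμ i (ω i))

lemma pexp_nonneg (hμ : ∀ i b, 0 ≤ μ i b) {f : (ι → β) → ℝ} (h : ∀ ω, 0 ≤ f ω) : 0 ≤ pexp μ f :=
  Finset.sum_nonneg fun ω _ => mul_nonneg (Finset.prod_nonneg fun i _ => hμ i (ω i)) (h ω)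

lemma pexp_sum (s : Finset κ) (f : κ → (ι → β) → ℝ) :
    pexp μ (fun ω => ∑ k ∈ s, f k ω) = ∑ k ∈ s, pexp μ (f k) := by
  simp only [pexp, Finset.mul_sum]
  exact Finset.sum_comm

lemma pexp_add (f g : (ι → β) → ℝ) :
    pexp μ (fun ω => f ω + g ω) = pexp μ f + pexp μ g := by
  simp only [pexp, mul_add, Finset.sum_add_distrib]

lemma pexp_const_mul (c : ℝ) (f : (ι → β) → ℝ) : pexp μ (fun ω => c * f ω) = c * pexp μ f := by
  simp only [pexp, Finset.mul_sum]
  exact Finset.sum_congr rfl fun ω _ => by ring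

lemma pexp_prod (h : ι → β → ℝ) :
    pexp μ (fun ω => ∏ i, h i (ω i)) = ∏ i, ∑ b, μ i b * h i b := by
  rw [Finset.prod_univ_sum, Fintype.piFinset_univ, pexp]
  exact Finset.sum_congr rfl fun ω _ => Finset.prod_mul_distrib.symm

lemma pexp_one (hμ : ∀ i, ∑ b, μ i b = 1) : pexp μ (fun _ => 1) = 1 := by
  have h := pexp_prod (μ := μ) (fun _ _ => 1)
  simpa [hμ] using h

/-- Take two independent copies and exchange their coordinates outside `A`. This preserves the
product weight and turns `f x.1 * g x.1` into `f x.1 * g x.2`. -/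
lemma pexp_mul (hμ : ∀ i, ∑ b, μ i b = 1) {A B : Set ι} (hAB : Disjoint A B)
    {f g : (ι → β) → ℝ} (hf : DependsOn f A) (hg : DependsOn g B) :
    pexp μ (fun ω => f ω * g ω) = pexp μ f * pexp μ g := by
  let Φ : (ι → β) × (ι → β) ≃ (ι → β) × (ι → β) :=
    { toFun := fun x => (mix A x.1 x.2, mix A x.2 x.1)
      invFun := fun x => (mix A x.1 x.2, mix A x.2 x.1)
      left_inv := fun x => Prod.ext (mix_mix A x.1 x.2) (mix_mix A x.2 x.1)
      right_inv := fun x => Prod.ext (mix_mix A x.1 x.2) (mix_mix A x.2 x.1) }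
  have hW : ∀ ω ω' : ι → β, (∏ i, μ i (mix A ω ω' i)) * ∏ i, μ i (mix A ω' ω i) =
      (∏ i, μ i (ω i)) * ∏ i, μ i (ω' i) := by
    intro ω ω'
    rw [← Finset.prod_mul_distrib, ← Finset.prod_mul_distrib]
    refine Finset.prod_congr rfl fun i _ => ?_
    by_cases h : i ∈ A <;> simp [mix, h, mul_comm]
  have hfm : ∀ ω ω' : ι → β, f (mix A ω ω') = f ω := fun ω ω' =>
    hf fun i hi => by simp [mix, hi]
  have hgm : ∀ ω ω' : ι → β, g (mix A ω ω') = g ω' := fun ω ω' =>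
    hg fun i hi => by simp [mix, Set.disjoint_right.1 hAB hi]
  calc pexp μ (fun ω => f ω * g ω) = pexp μ (fun ω => f ω * g ω) * pexp μ (fun _ => 1) := by
        rw [pexp_one hμ, mul_one]
    _ = ∑ x : (ι → β) × (ι → β),
          ((∏ i, μ i (x.1 i)) * (f x.1 * g x.1)) * ((∏ i, μ i (x.2 i)) * 1) := by
        rw [pexp, pexp, Finset.sum_mul_sum, Fintype.sum_prod_type]
    _ = ∑ x : (ι → β) × (ι → β), ((∏ i, μ i ((Φ x).1 i)) * (f (Φ x).1 * g (Φ x).1)) *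
          ((∏ i, μ i ((Φ x).2 i)) * 1) := (Equiv.sum_comp Φ _).symm
    _ = ∑ x : (ι → β) × (ι → β), ((∏ i, μ i (x.1 i)) * f x.1) * ((∏ i, μ i (x.2 i)) * g x.2) := by
        refine Finset.sum_congr rfl fun x _ => ?_
        change ((∏ i, μ i (mix A x.1 x.2 i)) * (f (mix A x.1 x.2) * g (mix A x.1 x.2))) *
          ((∏ i, μ i (mix A x.2 x.1 i)) * 1) = _
        rw [hfm, hgm]
        linear_combination (f x.1 * g x.2) * hW x.1 x.2
    _ = pexp μ f * pexp μ g := by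
        rw [pexp, pexp, Finset.sum_mul_sum, Fintype.sum_prod_type]

lemma pexp_mul_prod [DecidableEq κ] (hμ : ∀ i, ∑ b, μ i b = 1) {A : Set ι} {B : κ → Set ι}
    {f : (ι → β) → ℝ} {g : κ → (ι → β) → ℝ} (hf : DependsOn f A) {s : Finset κ}
    (hg : ∀ k ∈ s, DependsOn (g k) (B k)) (hAB : ∀ k ∈ s, Disjoint A (B k))
    (hB : ∀ k ∈ s, ∀ l ∈ s, k ≠ l → Disjoint (B k) (B l)) :
    pexp μ (fun ω => f ω * ∏ k ∈ s, g k ω) = pexp μ f * ∏ k ∈ s, pexp μ (g k) := by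
  induction s using Finset.induction_on generalizing f A with
  | empty => simp
  | insert k s hk ih =>
    simp only [Finset.mem_insert, forall_eq_or_imp] at hg hAB hB
    have h1 : DependsOn (fun ω => f ω * g k ω) (A ∪ B k) := fun x y h => by
      change f x * g k x = f y * g k y
      rw [hf fun i hi => h i (Or.inl hi), hg.1 fun i hi => h i (Or.inr hi)]
    have h2 := ih h1 hg.2 (fun l hl => Set.disjoint_union_left.2 ⟨hAB.2 l hl,
      hB.1.2 l hl (fun h => hk (h ▸ hl))⟩) fun l hl m hm => (hB.2 l hl).2 m hm
    simp only [Finset.prod_insert hk, ← mul_assoc]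
    rw [h2, pexp_mul hμ hAB.1 hf hg.1]

end ProductExpectation

end PlantedSAT

/-! ### The random formula with its messages as a product space. -/

namespace PlantedSAT

variable {n : ℕ}

/-- The joint weight of the presence of the clause `C` and the messages along its edges. -/
noncomputable def wt (p : ℝ) (φ : Assignment n) (C : Clause n) (b : Bool × (Fin n → Bool)) : ℝ :=
  (1 / 2) ^ n * (if Satisfies φ C then (if b.1 = true then p else 1 - p)
    else (if b.1 = true then 0 else 1))

/-- The average over all `0/1`-vectors. -/
noncomputable def avg (u : (Fin n → Bool) → ℝ) : ℝ := (1 / 2) ^ n * ∑ a, u a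

lemma half_pow_mul_card : (1 / 2 : ℝ) ^ n * (Fintype.card (Fin n → Bool) : ℝ) = 1 := by
  simp

lemma avg_const (c : ℝ) : avg (fun _ : Fin n → Bool => c) = c := by
  rw [avg, Finset.sum_const, nsmul_eq_mul, ← mul_assoc, Finset.card_univ, half_pow_mul_card,
    one_mul]

lemma avg_nonneg {u : (Fin n → Bool) → ℝ} (hu : ∀ a, 0 ≤ u a) : 0 ≤ avg u :=
  mul_nonneg (by positivity) (Finset.sum_nonneg fun a _ => hu a)

lemma avg_apply (y : Fin n) (g : Bool → ℝ) :
    avg (fun a => g (a y)) = (g true + g false) / 2 := by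
  have h1 : ∑ a : Fin n → Bool, g (a y) = ∑ a : Fin n → Bool, g (!a y) := by
    let e : (Fin n → Bool) ≃ (Fin n → Bool) :=
      Function.Involutive.toPerm (fun a i => !a i) fun a => by funext i; simp
    exact (Equiv.sum_comp e fun a => g (a y)).symm
  have h2 : ∑ a : Fin n → Bool, g (a y) + ∑ a : Fin n → Bool, g (!a y) =
      ∑ _a : Fin n → Bool, (g true + g false) := by
    rw [← Finset.sum_add_distrib]
    refine Finset.sum_congr rfl fun a _ => ?_
    cases a y
    · simp [add_comm]
    · simp
  have h3 := avg_const (n := n) (g true + g false)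
  rw [avg] at h3 ⊢
  rw [← h2, ← h1] at h3
  linarith

lemma sum_wt_mul (p : ℝ) (φ : Assignment n) (C : Clause n) (u w : (Fin n → Bool) → ℝ) :
    ∑ b, wt p φ C b * (if b.1 = true then u b.2 else w b.2) =
      if Satisfies φ C then p * avg u + (1 - p) * avg w else avg w := by
  rw [Fintype.sum_prod_type, Fintype.sum_bool]
  by_cases h : Satisfies φ C
  · simp only [wt, h, if_true, avg, Finset.mul_sum]
    congr 1 <;> exact Finset.sum_congr rfl fun a _ => by simp; ring
  · simp only [wt, h, if_false, avg, Finset.mul_sum]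
    simp

lemma sum_wt (p : ℝ) (φ : Assignment n) (C : Clause n) : ∑ b, wt p φ C b = 1 := by
  have h := sum_wt_mul p φ C (fun _ => 1) (fun _ => 1)
  simp only [ite_self, mul_one, avg_const] at h
  rw [h]
  split_ifs <;> ring

lemma wt_nonneg {p : ℝ} (h0 : 0 ≤ p) (h1 : p ≤ 1) (φ : Assignment n) (C : Clause n)
    (b : Bool × (Fin n → Bool)) : 0 ≤ wt p φ C b := by
  unfold wt
  have : 0 ≤ 1 - p := by linarith
  split_ifs <;> positivity

/-- Independence and `1 + x ≤ exp x`; clauses that `φ` does not satisfy are absent and contribute a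
factor 1. -/
lemma pexp_prod_le {p : ℝ} (h0 : 0 ≤ p) (h1 : p ≤ 1) (φ : Assignment n)
    {u : Clause n → (Fin n → Bool) → ℝ} (hu : ∀ C a, 0 ≤ u C a) :
    pexp (wt p φ) (fun ω => ∏ C, if (ω C).1 = true then u C (ω C).2 else 1) ≤
      Real.exp (p * ∑ C with Satisfies φ C, (avg (u C) - 1)) := by
  rw [pexp_prod (fun C (b : Bool × (Fin n → Bool)) => if b.1 = true then u C b.2 else 1)]
  rw [Finset.mul_sum, Finset.sum_filter, Real.exp_sum]
  have h3 : 0 ≤ 1 - p := by linarith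
  refine Finset.prod_le_prod (fun C _ => ?_) fun C _ => ?_
  · rw [sum_wt_mul p φ C (u C) (fun _ => 1), avg_const]
    have := avg_nonneg (hu C)
    split_ifs <;> positivity
  · rw [sum_wt_mul p φ C (u C) (fun _ => 1), avg_const]
    split_ifs
    · have := Real.add_one_le_exp (p * (avg (u C) - 1))
      linarith
    · simp

/-- The formula given by an element of the product space. -/
def formulaOf (ω : Clause n → Bool × (Fin n → Bool)) : Formula n :=
  Finset.univ.filter fun C => (ω C).1 = true

lemma mem_formulaOf {ω : Clause n → Bool × (Fin n → Bool)} {C : Clause n} :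
    C ∈ formulaOf ω ↔ (ω C).1 = true := by
  simp [formulaOf]

lemma prod_formulaOf (ω : Clause n → Bool × (Fin n → Bool)) (u : Clause n → ℝ) :
    ∏ C ∈ formulaOf ω, u C = ∏ C, if (ω C).1 = true then u C else 1 := by
  rw [formulaOf, Finset.prod_filter]

/-- The presence of a given clause costs a factor of `p`. -/
lemma pexp_mem_mul_prod_le {p : ℝ} (h0 : 0 ≤ p) (h1 : p ≤ 1) (φ : Assignment n) (C₀ : Clause n)
    {u : Clause n → (Fin n → Bool) → ℝ} (hu : ∀ C a, 0 ≤ u C a) (hu₀ : ∀ a, u C₀ a = 1) :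
    pexp (wt p φ) (fun ω => (if (ω C₀).1 = true then 1 else 0) *
      ∏ C, if (ω C).1 = true then u C (ω C).2 else 1) ≤
      p * Real.exp (p * ∑ C with Satisfies φ C, (avg (u C) - 1)) := by
  have hone : ∀ b : Bool × (Fin n → Bool), (if b.1 = true then u C₀ b.2 else 1) = 1 := fun b => by
    rw [hu₀, ite_self]
  -- Since `u C₀` is constantly 1, the product does not depend on the coordinate `C₀`, and the
  -- indicator splits off.
  rw [pexp_mul (A := {C₀}) (B := {C₀}ᶜ) (sum_wt p φ) disjoint_compl_right]
  · refine mul_le_mul ?_ (pexp_prod_le h0 h1 φ hu) ?_ h0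
    · have h2 : (fun ω : Clause n → Bool × (Fin n → Bool) => if (ω C₀).1 = true then (1 : ℝ) else 0) =
          fun ω => ∏ C, if C = C₀ then (if (ω C).1 = true then 1 else 0) else 1 := by
        funext ω
        rw [Finset.prod_ite_eq']
        simp
      rw [h2, pexp_prod (fun C (b : Bool × (Fin n → Bool)) =>
        if C = C₀ then (if b.1 = true then (1 : ℝ) else 0) else 1), Finset.prod_eq_single C₀]
      · simp only [if_true]
        rw [sum_wt_mul p φ C₀ (fun _ => 1) (fun _ => 0), avg_const, avg_const]
        split_ifs <;> linarith
      · intro C _ hC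
        simp [hC, sum_wt]
      · simp
    · refine pexp_nonneg (wt_nonneg h0 h1 φ) fun ω => Finset.prod_nonneg fun C _ => ?_
      split_ifs
      · exact hu _ _
      · exact zero_le_one
  · intro x y h
    simp only [h C₀ rfl]
  · intro x y h
    refine Finset.prod_congr rfl fun C _ => ?_
    by_cases hC : C = C₀
    · subst hC
      rw [hone, hone]
    · rw [h C hC]

/-! ### Negating a variable in a clause. -/

section Flip

/-- Negate the variable `y` in a literal. -/
def flipLit (y : Fin n) : Equiv.Perm (Fin n × Bool) :=
  Function.Involutive.toPerm (fun l => if l.1 = y then (l.1, !l.2) else l) fun l => by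
    by_cases h : l.1 = y <;> simp [h]
    exact Prod.ext h.symm rfl

lemma flipLit_apply (y : Fin n) (l : Fin n × Bool) :
    flipLit y l = if l.1 = y then (l.1, !l.2) else l := rfl

lemma flipLit_flipLit (y : Fin n) (l : Fin n × Bool) : flipLit y (flipLit y l) = l :=
  (flipLit y).left_inv l

lemma fst_flipLit (y : Fin n) (l : Fin n × Bool) : (flipLit y l).1 = l.1 := by
  rw [flipLit_apply]
  split_ifs <;> rfl

lemma image_fst_map_flipLit (y : Fin n) (s : Finset (Fin n × Bool)) :
    (s.map (flipLit y).toEmbedding).image Prod.fst = s.image Prod.fst := by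
  rw [Finset.map_eq_image, Finset.image_image]
  exact Finset.image_congr fun l _ => fst_flipLit y l

/-- Negate the variable `y` in a clause. -/
def flipClause (y : Fin n) (C : Clause n) : Clause n :=
  ⟨C.1.map (flipLit y).toEmbedding, by
    rw [Finset.card_map]
    exact C.2.1, by
    rw [image_fst_map_flipLit]
    exact C.2.2⟩

lemma mem_flipClause {y : Fin n} {C : Clause n} {l : Fin n × Bool} :
    l ∈ (flipClause y C).1 ↔ flipLit y l ∈ C.1 := by
  rw [flipClause, Finset.mem_map_equiv]
  rfl

lemma flipClause_flipClause (y : Fin n) (C : Clause n) : flipClause y (flipClause y C) = C :=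
  Subtype.ext (Finset.ext fun l => by rw [mem_flipClause, mem_flipClause, flipLit_flipLit])

lemma vars_flipClause (y : Fin n) (C : Clause n) : (flipClause y C).vars = C.vars := by
  ext x
  rw [Clause.mem_vars, Clause.mem_vars]
  constructor
  · rintro ⟨b, hb⟩
    rw [mem_flipClause, flipLit_apply] at hb
    split_ifs at hb
    exacts [⟨_, hb⟩, ⟨_, hb⟩]
  · rintro ⟨b, hb⟩
    by_cases h : x = y
    · exact ⟨!b, by rw [mem_flipClause, flipLit_apply, if_pos h]; simpa using hb⟩
    · exact ⟨b, by rw [mem_flipClause, flipLit_apply, if_neg h]; exact hb⟩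

lemma eq_of_mem_of_mem {C : Clause n} {x : Fin n} {b b' : Bool} (h : (x, b) ∈ C.1)
    (h' : (x, b') ∈ C.1) : b = b' := by
  have hinj : Set.InjOn Prod.fst (C.1 : Set (Fin n × Bool)) := by
    apply Finset.card_image_iff.1
    rw [C.2.1]
    convert C.2.2
  exact congrArg Prod.snd (hinj h h' rfl)

/-- A clause of `N^{++}(y)`, or a satisfied clause of `N^-(y)`, is satisfied by a variable other
than `y`. Negating `y` therefore keeps it satisfied and exchanges the two classes. -/
lemma flipClause_spec {φ : Assignment n} {y : Fin n} {C : Clause n} (hsat : Satisfies φ C)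
    (hs : sgn φ y C ≠ 0) :
    Satisfies φ (flipClause y C) ∧ sgn φ y (flipClause y C) = - sgn φ y C := by
  have key : ∀ C : Clause n, ∀ b z, (y, b) ∈ C.1 → z ≠ y → (z, φ z) ∈ C.1 →
      Satisfies φ C ∧ sgn φ y C = if b = φ y then 1 else -1 := by
    intro C b z hb hz hzC
    refine ⟨⟨z, hzC⟩, ?_⟩
    have hns : ¬ Supports φ y C := fun h => hz (h.2 z hzC)
    by_cases hbφ : b = φ y
    · subst hbφ
      have : (y, !φ y) ∉ C.1 := fun h => by
        have := eq_of_mem_of_mem hb h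
        simp at this
      simp [sgn, hns, hb, this]
    · have hbn : b = !φ y := by cases b <;> cases h : φ y <;> simp_all
      have : (y, φ y) ∉ C.1 := fun h => hbφ (eq_of_mem_of_mem hb h)
      rw [hbn] at hb
      simp [sgn, hb, this, hbφ]
  obtain ⟨b, z, hb, hz, hzC⟩ : ∃ b z, (y, b) ∈ C.1 ∧ z ≠ y ∧ (z, φ z) ∈ C.1 := by
    by_cases hy : (y, φ y) ∈ C.1
    · have hns : ¬ Supports φ y C := by
        intro h
        have : (y, !φ y) ∉ C.1 := fun h' => by
          have := eq_of_mem_of_mem hy h'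
          simp at this
        exact hs (by simp [sgn, h, this])
      have : ∃ z, (z, φ z) ∈ C.1 ∧ z ≠ y := by
        by_contra! hcon
        exact hns ⟨hy, hcon⟩
      obtain ⟨z, h1, h2⟩ := this
      exact ⟨_, z, hy, h2, h1⟩
    · have hy' : (y, !φ y) ∈ C.1 := by
        by_contra h
        exact hs (by simp [sgn, hy, h])
      obtain ⟨z, hz⟩ := hsat
      exact ⟨_, z, hy', fun h => hy (h ▸ hz), hz⟩
  have h1 := key C b z hb hz hzC
  have hb' : (y, !b) ∈ (flipClause y C).1 := by
    rw [mem_flipClause, flipLit_apply]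
    simpa using hb
  have hz' : (z, φ z) ∈ (flipClause y C).1 := by
    rw [mem_flipClause, flipLit_apply, if_neg hz]
    exact hzC
  have h2 := key _ _ z hb' hz hz'
  refine ⟨h2.1, ?_⟩
  rw [h1.2, h2.2]
  cases b <;> cases φ y <;> simp

end Flip

/-! ### Counting clauses by their intersection with a set. -/

section Counting

/-- There are at most `8 a b c` clauses with one variable in each of three sets of sizes `a`, `b`
and `c`. -/
lemma card_clauses_le (A B D : Finset (Fin n)) (s : Finset (Clause n))
    (hs : ∀ C ∈ s, ∃ x ∈ A, ∃ y ∈ B, ∃ z ∈ D, C.vars = {x, y, z}) :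
    s.card ≤ 8 * (A.card * B.card * D.card) := by
  let U : Finset Bool := Finset.univ
  let f : (Fin n × Bool) × (Fin n × Bool) × (Fin n × Bool) → Finset (Fin n × Bool) :=
    fun l => {l.1, l.2.1, l.2.2}
  have hsub : s.map (Function.Embedding.subtype _) ⊆ ((A ×ˢ U) ×ˢ (B ×ˢ U) ×ˢ (D ×ˢ U)).image f := by
    intro T hT
    obtain ⟨C, hC, rfl⟩ := Finset.mem_map.1 hT
    obtain ⟨x, hx, y, hy, z, hz, hv⟩ := hs C hC
    have hm : ∀ w ∈ ({x, y, z} : Finset (Fin n)), ∃ b, (w, b) ∈ C.1 :=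
      fun w hw => Clause.mem_vars.1 (hv ▸ hw)
    obtain ⟨bx, hbx⟩ := hm x (by simp)
    obtain ⟨by', hby⟩ := hm y (by simp)
    obtain ⟨bz, hbz⟩ := hm z (by simp)
    rw [Finset.mem_image]
    refine ⟨((x, bx), (y, by'), (z, bz)), by simp [U, hx, hy, hz], ?_⟩
    ext ⟨w, b⟩
    simp only [f, Finset.mem_insert, Finset.mem_singleton, Function.Embedding.subtype_apply]
    constructor
    · rintro (h | h | h) <;> rw [h] <;> assumption
    · intro h
      have hw : w ∈ ({x, y, z} : Finset (Fin n)) := hv ▸ Clause.mem_vars.2 ⟨b, h⟩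
      simp only [Finset.mem_insert, Finset.mem_singleton] at hw
      rcases hw with rfl | rfl | rfl
      · exact Or.inl (by rw [eq_of_mem_of_mem h hbx])
      · exact Or.inr (Or.inl (by rw [eq_of_mem_of_mem h hby]))
      · exact Or.inr (Or.inr (by rw [eq_of_mem_of_mem h hbz]))
  have h1 := (Finset.card_le_card hsub).trans Finset.card_image_le
  rw [Finset.card_map] at h1
  refine h1.trans (le_of_eq ?_)
  simp only [Finset.card_product, U, Finset.card_univ, Fintype.card_bool]
  ring

lemma card_clauses_of_mem_le (y : Fin n) (s : Finset (Clause n)) (hs : ∀ C ∈ s, y ∈ C.vars) :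
    s.card ≤ 8 * n ^ 2 := by
  refine (card_clauses_le {y} Finset.univ Finset.univ s fun C hC => ?_).trans (le_of_eq ?_)
  · have h := Finset.card_erase_of_mem (hs C hC)
    rw [C.card_vars] at h
    obtain ⟨a, b, -, hab⟩ := Finset.card_eq_two.1 h
    exact ⟨y, by simp, a, by simp, b, by simp, by rw [← hab, Finset.insert_erase (hs C hC)]⟩
  · simp
    ring

lemma card_clauses_of_two_le (S : Finset (Fin n)) (s : Finset (Clause n))
    (hs : ∀ C ∈ s, 2 ≤ (C.vars ∩ S).card) : s.card ≤ 8 * (S.card ^ 2 * n) := by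
  refine (card_clauses_le S S Finset.univ s fun C hC => ?_).trans (le_of_eq ?_)
  · obtain ⟨T, hT, hcard⟩ := Finset.exists_subset_card_eq (hs C hC)
    obtain ⟨a, b, hab, rfl⟩ := Finset.card_eq_two.1 hcard
    have ha := Finset.mem_inter.1 (hT (Finset.mem_insert_self a {b}))
    have hb := Finset.mem_inter.1 (hT (Finset.mem_insert_of_mem (Finset.mem_singleton_self b)))
    have h := Finset.card_erase_of_mem (Finset.mem_erase.2 ⟨hab.symm, hb.1⟩)
    rw [Finset.card_erase_of_mem ha.1, C.card_vars] at h
    obtain ⟨c, hc⟩ := Finset.card_eq_one.1 h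
    refine ⟨a, ha.2, b, hb.2, c, by simp, ?_⟩
    rw [← hc, Finset.insert_erase (Finset.mem_erase.2 ⟨hab.symm, hb.1⟩), Finset.insert_erase ha.1]
  · rw [Finset.card_univ, Fintype.card_fin]
    ring

lemma card_clauses_of_three_le (S : Finset (Fin n)) (s : Finset (Clause n))
    (hs : ∀ C ∈ s, 3 ≤ (C.vars ∩ S).card) : s.card ≤ 8 * S.card ^ 3 := by
  refine (card_clauses_le S S S s fun C hC => ?_).trans (le_of_eq ?_)
  · have h : C.vars ∩ S = C.vars :=
      Finset.eq_of_subset_of_card_le Finset.inter_subset_left (by rw [C.card_vars]; exact hs C hC)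
    obtain ⟨a, b, c, -, -, -, habc⟩ := Finset.card_eq_three.1 C.card_vars
    have hm : ∀ w ∈ ({a, b, c} : Finset (Fin n)), w ∈ S := by
      intro w hw
      rw [← habc, ← h] at hw
      exact (Finset.mem_inter.1 hw).2
    exact ⟨a, hm a (by simp), b, hm b (by simp), c, hm c (by simp), habc⟩
  · ring

/-- The private support clauses of `y` correspond to the pairs of variables outside `S`. -/
lemma choose_le_card_support (φ : Assignment n) {S : Finset (Fin n)} {y : Fin n} (hy : y ∈ S) :
    (n - S.card).choose 2 ≤
      (Finset.univ.filter fun C : Clause n => Priv S y C ∧ Supports φ y C).card := by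
  have hc : (n - S.card).choose 2 = ((Sᶜ).powersetCard 2).card := by
    rw [Finset.card_powersetCard, Finset.card_compl, Fintype.card_fin]
  -- The clause over `y` and `T` in which only the literal of `y` is true.
  let f : Finset (Fin n) → Finset (Fin n × Bool) := fun T =>
    insert (y, φ y) (T.image fun x => (x, !φ x))
  have hf : ∀ T b x, (x, b) ∈ f T ↔ (x = y ∧ b = φ y) ∨ (x ∈ T ∧ b = !φ x) := by
    intro T b x
    simp only [f, Finset.mem_insert, Prod.mk.injEq, Finset.mem_image]
    constructor
    · rintro (h | ⟨a, ha, rfl, rfl⟩)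
      · exact Or.inl h
      · exact Or.inr ⟨ha, rfl⟩
    · rintro (h | ⟨h, rfl⟩)
      · exact Or.inl h
      · exact Or.inr ⟨x, h, rfl, rfl⟩
  have himg : ∀ T, (f T).image Prod.fst = insert y T := by
    intro T
    ext x
    simp only [Finset.mem_image, Prod.exists, exists_and_right, exists_eq_right, hf,
      Finset.mem_insert]
    constructor
    · rintro ⟨b, h | h⟩
      exacts [Or.inl h.1, Or.inr h.1]
    · rintro (h | h)
      exacts [⟨_, Or.inl ⟨h, rfl⟩⟩, ⟨_, Or.inr ⟨h, rfl⟩⟩]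
  have hyT : ∀ T ∈ (Sᶜ).powersetCard 2, y ∉ T ∧ T.card = 2 ∧ ∀ x ∈ T, x ∉ S := by
    intro T hT
    obtain ⟨h1, h2⟩ := Finset.mem_powersetCard.1 hT
    exact ⟨fun h => Finset.mem_compl.1 (h1 h) hy, h2, fun x hx => Finset.mem_compl.1 (h1 hx)⟩
  have hcl : ∀ T ∈ (Sᶜ).powersetCard 2, (f T).card = 3 ∧ ((f T).image Prod.fst).card = 3 := by
    intro T hT
    obtain ⟨h1, h2, -⟩ := hyT T hT
    rw [himg, Finset.card_insert_of_notMem h1, h2]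
    refine ⟨?_, rfl⟩
    rw [Finset.card_insert_of_notMem, Finset.card_image_of_injective _
      (fun a b h => congrArg Prod.fst h), h2]
    simp only [Finset.mem_image, Prod.mk.injEq, not_exists, not_and]
    rintro x hx rfl
    exact absurd hx h1
  have hinj : Set.InjOn f ((Sᶜ).powersetCard 2 : Finset (Finset (Fin n))) := by
    intro T hT T' hT' h
    have h1 := himg T
    rw [h, himg T'] at h1
    rw [← Finset.erase_insert (hyT T hT).1, ← h1, Finset.erase_insert (hyT T' hT').1]
  rw [hc, ← Finset.card_image_of_injOn hinj, ← Finset.card_map (Function.Embedding.subtype _)]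
  refine Finset.card_le_card fun U hU => ?_
  obtain ⟨T, hT, rfl⟩ := Finset.mem_image.1 hU
  obtain ⟨h1, h2, h3⟩ := hyT T hT
  refine Finset.mem_map.2 ⟨⟨f T, by convert hcl T hT⟩, ?_, rfl⟩
  rw [Finset.mem_filter]
  refine ⟨Finset.mem_univ _, ?_, (hf T _ y).2 (Or.inl ⟨rfl, rfl⟩), fun x hx => ?_⟩
  · have : (f T).image Prod.fst ∩ S = {y} := by
      rw [himg]
      ext x
      simp only [Finset.mem_inter, Finset.mem_insert, Finset.mem_singleton]
      constructor
      · rintro ⟨rfl | h, hx⟩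
        · rfl
        · exact absurd hx (h3 x h)
      · rintro rfl
        exact ⟨Or.inl rfl, hy⟩
    rw [Priv, Clause.vars]
    convert this
  · rcases (hf T _ x).1 hx with h | h
    · exact h.1
    · exact absurd h.2 (by simp)

end Counting

end PlantedSAT

/-! ### Exponential moments of overlaps, supports and balances. -/

namespace PlantedSAT

variable {n : ℕ}

/-- The indicator of a proposition. -/
noncomputable def ind (P : Prop) : ℝ := if P then 1 else 0

lemma ind_nonneg (P : Prop) : 0 ≤ ind P := by
  unfold ind
  split_ifs <;> norm_num

lemma ind_mono {P Q : Prop} (h : P → Q) : ind P ≤ ind Q := by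
  unfold ind
  split_ifs with h1 h2
  · exact le_rfl
  · exact absurd (h h1) h2
  · exact zero_le_one
  · exact le_rfl

lemma ind_or_le (P Q : Prop) : ind (P ∨ Q) ≤ ind P + ind Q := by
  unfold ind
  by_cases hP : P <;> by_cases hQ : Q <;> simp [hP, hQ]

lemma ind_exists_le {κ : Type*} (s : Finset κ) (P : κ → Prop) :
    ind (∃ k ∈ s, P k) ≤ ∑ k ∈ s, ind (P k) := by
  by_cases h : ∃ k ∈ s, P k
  · obtain ⟨k, hk, hP⟩ := h
    calc ind (∃ k ∈ s, P k) ≤ 1 := by unfold ind; split_ifs <;> norm_num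
      _ = ind (P k) := by simp [ind, hP]
      _ ≤ _ := Finset.single_le_sum (fun k _ => ind_nonneg (P k)) hk
  · rw [ind, if_neg h]
    exact Finset.sum_nonneg fun k _ => ind_nonneg _

lemma ind_le_exp {P : Prop} {x : ℝ} (h : P → 0 ≤ x) : ind P ≤ Real.exp x := by
  unfold ind
  split_ifs with hP
  · exact Real.one_le_exp (h hP)
  · exact (Real.exp_pos x).le

lemma ind_and (P Q : Prop) : ind (P ∧ Q) = ind P * ind Q := by
  unfold ind
  by_cases hP : P <;> by_cases hQ : Q <;> simp [hP, hQ]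

/-- Exponential moment of the overlap. -/
lemma pexp_pow_overlap_le {p : ℝ} (h0 : 0 ≤ p) (h1 : p ≤ 1) (φ : Assignment n)
    (S : Finset (Fin n)) {z : ℝ} (hz : 1 ≤ z) :
    pexp (wt p φ) (fun ω => z ^ overlap (formulaOf ω) Clause.vars S) ≤
      Real.exp (p * (8 * (S.card ^ 2 * n) * z + 8 * S.card ^ 3 * z ^ 2)) := by
  have h2 : (fun ω : Clause n → Bool × (Fin n → Bool) => z ^ overlap (formulaOf ω) Clause.vars S) =
      fun ω => ∏ C, if (ω C).1 = true then z ^ ((C.vars ∩ S).card - 1) else 1 := by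
    funext ω
    rw [overlap, ← Finset.prod_pow_eq_pow_sum, prod_formulaOf]
  rw [h2]
  refine (pexp_prod_le h0 h1 φ (u := fun C _ => z ^ ((C.vars ∩ S).card - 1))
    (fun C _ => by positivity)).trans (Real.exp_le_exp.2 (mul_le_mul_of_nonneg_left ?_ h0))
  have hz0 : 0 ≤ z := by linarith
  have hz2 : 1 ≤ z ^ 2 := one_le_pow₀ hz
  calc ∑ C with Satisfies φ C, (avg (fun _ => z ^ ((C.vars ∩ S).card - 1)) - 1)
      ≤ ∑ C : Clause n, ((if 2 ≤ (C.vars ∩ S).card then z else 0) +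
          if 3 ≤ (C.vars ∩ S).card then z ^ 2 else 0) := by
        refine (Finset.sum_le_sum fun C _ => ?_).trans
          (Finset.sum_le_sum_of_subset_of_nonneg (Finset.filter_subset _ _) fun C _ _ => ?_)
        · rw [avg_const]
          have h3 : (C.vars ∩ S).card ≤ 3 :=
            (Finset.card_le_card Finset.inter_subset_left).trans C.card_vars.le
          interval_cases (C.vars ∩ S).card <;> (norm_num; try linarith)
        · split_ifs <;> positivity
    _ = (Finset.univ.filter fun C : Clause n => 2 ≤ (C.vars ∩ S).card).card * z +
          (Finset.univ.filter fun C : Clause n => 3 ≤ (C.vars ∩ S).card).card * z ^ 2 := by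
        rw [Finset.sum_add_distrib, ← Finset.sum_filter, ← Finset.sum_filter, Finset.sum_const,
          Finset.sum_const, nsmul_eq_mul, nsmul_eq_mul]
    _ ≤ 8 * (S.card ^ 2 * n) * z + 8 * S.card ^ 3 * z ^ 2 := by
        have e2 := card_clauses_of_two_le S
          (Finset.univ.filter fun C : Clause n => 2 ≤ (C.vars ∩ S).card)
          (fun C hC => (Finset.mem_filter.1 hC).2)
        have e3 := card_clauses_of_three_le S
          (Finset.univ.filter fun C : Clause n => 3 ≤ (C.vars ∩ S).card)
          (fun C hC => (Finset.mem_filter.1 hC).2)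
        refine add_le_add (mul_le_mul_of_nonneg_right ?_ hz0)
          (mul_le_mul_of_nonneg_right ?_ (by positivity))
        · exact_mod_cast e2
        · exact_mod_cast e3

/-- Source of the constant 0.39 = 1 - 0.61 in the lower tail bound, where each counted clause is
weighted by `exp (-1/2)`. -/
lemma exp_neg_half_le : Real.exp (-(1 / 2)) ≤ 0.61 := by
  have h1 : Real.exp (-(1 / 2)) ^ 2 = Real.exp (-1) := by
    rw [← Real.exp_nat_mul]
    norm_num
  have h2 := Real.exp_neg_one_lt_d9
  by_contra! h
  nlinarith

/-- Lower tail of the number of clauses of a class, counted with probability `θ` each. -/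
lemma pexp_ind_card_le {p : ℝ} (h0 : 0 ≤ p) (h1 : p ≤ 1) (φ : Assignment n)
    (Q : Clause n → Prop) [DecidablePred Q] (hQ : ∀ C, Q C → Satisfies φ C)
    (r : (Fin n → Bool) → Prop) [DecidablePred r] {θ : ℝ}
    (hr : avg (fun a => ind (r a)) = θ) (c : ℝ) :
    pexp (wt p φ) (fun ω =>
        ind ((((formulaOf ω).filter fun C => Q C ∧ r (ω C).2).card : ℝ) ≤ c)) ≤
      Real.exp (c / 2 - p * (Finset.univ.filter Q).card * (θ * 0.39)) := by
  have hθ : 0 ≤ θ := hr ▸ avg_nonneg fun a => ind_nonneg _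
  let u : Clause n → (Fin n → Bool) → ℝ := fun C a => if Q C ∧ r a then Real.exp (-(1 / 2)) else 1
  have hu : ∀ C a, 0 ≤ u C a := fun C a => by
    simp only [u]
    split_ifs <;> positivity
  have h2 : ∀ ω : Clause n → Bool × (Fin n → Bool),
      ind ((((formulaOf ω).filter fun C => Q C ∧ r (ω C).2).card : ℝ) ≤ c) ≤
        Real.exp (c / 2) * ∏ C, if (ω C).1 = true then u C (ω C).2 else 1 := by
    intro ω
    rw [← prod_formulaOf ω fun C => u C (ω C).2, ← Finset.prod_filter, Finset.prod_const,
      ← Real.exp_nat_mul, ← Real.exp_add]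
    exact ind_le_exp fun h => by linarith
  have havg : ∀ C, avg (u C) - 1 ≤ if Q C then -(θ * 0.39) else 0 := by
    intro C
    by_cases hC : Q C
    · have h3 : u C = fun a => 1 + (Real.exp (-(1 / 2)) - 1) * ind (r a) := by
        funext a
        simp only [u, ind, hC, true_and]
        split_ifs <;> ring
      have h4 : avg (u C) = 1 + (Real.exp (-(1 / 2)) - 1) * θ := by
        rw [h3, ← hr, avg, avg, Finset.sum_add_distrib, mul_add, ← Finset.mul_sum]
        have := avg_const (n := n) 1
        rw [avg] at this
        rw [this]
        ring
      rw [if_pos hC, h4]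
      have := exp_neg_half_le
      nlinarith
    · have h3 : u C = fun a => 1 := by
        funext a
        simp [u, hC]
      rw [if_neg hC, h3, avg_const]
      norm_num
  refine (pexp_mono (wt_nonneg h0 h1 φ) h2).trans ?_
  rw [pexp_const_mul, sub_eq_add_neg, Real.exp_add]
  refine mul_le_mul_of_nonneg_left ((pexp_prod_le h0 h1 φ hu).trans (Real.exp_le_exp.2 ?_))
    (Real.exp_pos _).le
  have h5 : ∑ C with Satisfies φ C, (avg (u C) - 1) ≤ (Finset.univ.filter Q).card * -(θ * 0.39) := by
    refine (Finset.sum_le_sum fun C _ => havg C).trans (le_of_eq ?_)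
    rw [← Finset.sum_filter, Finset.filter_filter, Finset.sum_const, nsmul_eq_mul]
    congr 3
    ext C
    simp only [Finset.mem_filter, Finset.mem_univ, true_and]
    exact ⟨fun h => h.2, fun h => ⟨hQ C h, h⟩⟩
  calc p * ∑ C with Satisfies φ C, (avg (u C) - 1)
      ≤ p * ((Finset.univ.filter Q).card * -(θ * 0.39)) := mul_le_mul_of_nonneg_left h5 h0
    _ = _ := by ring

/-- The contribution of `C` to the balance at `y`: all clauses count if `o` is false, those that
send the message `1` if `o` is true. -/
noncomputable def contrib (φ : Assignment n) (y : Fin n) (o : Bool) (C : Clause n)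
    (a : Fin n → Bool) : ℝ := if o = false ∨ a y = true then sgn φ y C else 0

lemma cosh_sub_one_le {l : ℝ} (h0 : 0 ≤ l) (h1 : l ≤ 1) : Real.cosh l - 1 ≤ l ^ 2 := by
  have h2 := Real.cosh_le_exp_half_sq l
  have h3 : Real.exp (l ^ 2 / 2) ≤ 1 + l ^ 2 := by
    have h4 : |l ^ 2 / 2| ≤ 1 := by
      rw [abs_of_nonneg (by positivity)]
      nlinarith
    have h5 := Real.abs_exp_sub_one_le h4
    rw [abs_of_nonneg (by positivity : 0 ≤ l ^ 2 / 2)] at h5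
    have := (abs_le.1 h5).2
    linarith
  linarith

/-- The clauses of `N^{++}(y)` and `N^-(y)` over given triples of variables are balanced. -/
lemma sum_exp_sgn_le (φ : Assignment n) (y : Fin n) (q : Clause n → Prop)
    (hq : ∀ C, q (flipClause y C) ↔ q C) {l : ℝ} (h0 : 0 ≤ l) (h1 : l ≤ 1) (ε : ℝ) (hε : |ε| ≤ 1) :
    ∑ C with Satisfies φ C, (if q C then Real.exp (l * (ε * sgn φ y C)) - 1 else 0) ≤
      8 * n ^ 2 * l ^ 2 := by
  -- Flipping `y` is an involution of `A` that negates `sgn`. Averaging over it replaces `exp` by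
  -- `cosh`, so the linear term disappears and a quadratic bound remains.
  let A : Finset (Clause n) := Finset.univ.filter fun C => Satisfies φ C ∧ q C ∧ sgn φ y C ≠ 0
  have hA : ∀ C ∈ A, flipClause y C ∈ A ∧ sgn φ y (flipClause y C) = - sgn φ y C := by
    intro C hC
    simp only [A, Finset.mem_filter, Finset.mem_univ, true_and] at hC ⊢
    obtain ⟨h2, h3, h4⟩ := hC
    obtain ⟨h5, h6⟩ := flipClause_spec h2 h4
    exact ⟨⟨h5, (hq C).2 h3, by rw [h6]; exact neg_ne_zero.2 h4⟩, h6⟩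
  have hsum : ∑ C with Satisfies φ C, (if q C then Real.exp (l * (ε * sgn φ y C)) - 1 else 0) =
      ∑ C ∈ A, (Real.exp (l * (ε * sgn φ y C)) - 1) := by
    rw [← Finset.sum_filter, Finset.filter_filter]
    symm
    refine Finset.sum_subset (fun C hC => ?_) fun C hC hCA => ?_
    · simp only [A, Finset.mem_filter, Finset.mem_univ, true_and] at hC ⊢
      exact ⟨hC.1, hC.2.1⟩
    · simp only [A, Finset.mem_filter, Finset.mem_univ, true_and, not_and, not_not] at hC hCA
      rw [hCA hC.1 hC.2]
      simp
  have hflip : ∑ C ∈ A, (Real.exp (l * (ε * sgn φ y C)) - 1) =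
      ∑ C ∈ A, (Real.exp (-(l * (ε * sgn φ y C))) - 1) := by
    refine Finset.sum_bij (fun C _ => flipClause y C) (fun C hC => (hA C hC).1)
      (fun C _ C' _ h => ?_) (fun C hC => ⟨flipClause y C, (hA C hC).1, flipClause_flipClause y C⟩)
      fun C hC => ?_
    · rw [← flipClause_flipClause y C, h, flipClause_flipClause]
    · rw [(hA C hC).2]
      ring_nf
  have hcosh : ∑ C ∈ A, (Real.exp (l * (ε * sgn φ y C)) - 1) =
      ∑ C ∈ A, (Real.cosh (l * (ε * sgn φ y C)) - 1) := by
    have h2 : ∑ C ∈ A, (Real.cosh (l * (ε * sgn φ y C)) - 1) =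
        (∑ C ∈ A, (Real.exp (l * (ε * sgn φ y C)) - 1) +
          ∑ C ∈ A, (Real.exp (-(l * (ε * sgn φ y C))) - 1)) / 2 := by
      rw [← Finset.sum_add_distrib, Finset.sum_div]
      exact Finset.sum_congr rfl fun C _ => by rw [Real.cosh_eq]; ring
    rw [h2, ← hflip]
    ring
  have hAcard : A.card ≤ 8 * n ^ 2 := by
    refine card_clauses_of_mem_le y A fun C hC => ?_
    by_contra h
    exact (Finset.mem_filter.1 hC).2.2.2 (sgn_eq_zero h)
  rw [hsum, hcosh]
  calc ∑ C ∈ A, (Real.cosh (l * (ε * sgn φ y C)) - 1) ≤ ∑ C ∈ A, l ^ 2 := by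
        refine Finset.sum_le_sum fun C _ => ?_
        refine le_trans (sub_le_sub_right (Real.cosh_le_cosh.2 ?_) 1) (cosh_sub_one_le h0 h1)
        rw [abs_mul, abs_mul]
        have := abs_sgn_le φ y C
        have h3 : |ε| * |sgn φ y C| ≤ 1 := mul_le_one₀ hε (abs_nonneg _) this
        exact mul_le_of_le_one_right (abs_nonneg _) h3
    _ = A.card * l ^ 2 := by rw [Finset.sum_const, nsmul_eq_mul]
    _ ≤ 8 * n ^ 2 * l ^ 2 := by
        refine mul_le_mul_of_nonneg_right ?_ (by positivity)
        exact_mod_cast hAcard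

/-- If only messages with value 1 count, a fair coin halves the deviation from 1. -/
lemma avg_exp_contrib (φ : Assignment n) (y : Fin n) (o : Bool) (C : Clause n) (l ε : ℝ) :
    avg (fun a => Real.exp (l * (ε * contrib φ y o C a))) - 1 =
      (if o = true then 1 / 2 else 1) * (Real.exp (l * (ε * sgn φ y C)) - 1) := by
  rw [show (fun a => Real.exp (l * (ε * contrib φ y o C a))) = fun a : Fin n → Bool =>
    (fun b : Bool => Real.exp (l * (ε * (if o = false ∨ b = true then sgn φ y C else 0)))) (a y)
    from rfl, avg_apply y fun b : Bool => Real.exp (l * (ε * (if o = false ∨ b = true then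
      sgn φ y C else 0)))]
  cases o
  · simp
  · simp
    ring

lemma sum_avg_contrib_le (φ : Assignment n) (y : Fin n) (o : Bool) (q : Clause n → Prop)
    (hq : ∀ C, q (flipClause y C) ↔ q C) {l : ℝ} (h0 : 0 ≤ l) (h1 : l ≤ 1) (ε : ℝ) (hε : |ε| ≤ 1) :
    ∑ C with Satisfies φ C,
      (avg (fun a => if q C then Real.exp (l * (ε * contrib φ y o C a)) else 1) - 1) ≤
      8 * n ^ 2 * l ^ 2 := by
  have h2 : ∀ C, avg (fun a => if q C then Real.exp (l * (ε * contrib φ y o C a)) else 1) - 1 =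
      (if o = true then 1 / 2 else 1) *
        (if q C then Real.exp (l * (ε * sgn φ y C)) - 1 else 0) := by
    intro C
    by_cases hC : q C
    · simp only [hC, if_true]
      exact avg_exp_contrib φ y o C l ε
    · simp only [hC, if_false, avg_const]
      ring
  simp only [h2]
  rw [← Finset.mul_sum]
  have h3 := sum_exp_sgn_le φ y q hq h0 h1 ε hε
  have h4 : (0 : ℝ) ≤ 8 * n ^ 2 * l ^ 2 := by positivity
  split_ifs <;> linarith

end PlantedSAT

/-! ### The probability that the private clauses of a variable are faulty. -/

namespace PlantedSAT

variable {n : ℕ}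

lemma exp_sum_contrib (φ : Assignment n) (y : Fin n) (o : Bool) (q : Clause n → Prop) (l ε : ℝ)
    (ω : Clause n → Bool × (Fin n → Bool)) :
    Real.exp (l * (ε * ∑ C ∈ formulaOf ω with q C, contrib φ y o C (ω C).2)) =
      ∏ C, if (ω C).1 = true then
        (if q C then Real.exp (l * (ε * contrib φ y o C (ω C).2)) else 1) else 1 := by
  rw [← prod_formulaOf ω fun C => if q C then Real.exp (l * (ε * contrib φ y o C (ω C).2)) else 1,
    ← Finset.prod_filter, ← Real.exp_sum, Finset.mul_sum, Finset.mul_sum]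

/-- Maximal inequality for the balance of the private clauses of `y`, in the order given by `κ`. -/
lemma pexp_ind_exists_lt_le {p : ℝ} (h0 : 0 ≤ p) (h1 : p ≤ 1) (φ : Assignment n)
    (κ : Finset (Fin n) × Fin n → ℕ) (S : Finset (Fin n)) (y : Fin n) (o : Bool) {l : ℝ}
    (hl0 : 0 ≤ l) (hl1 : l ≤ 1) {ε : ℝ} (hε : |ε| ≤ 1) (c : ℝ) :
    pexp (wt p φ) (fun ω => ind (∃ t, c < ε * ∑ C ∈ formulaOf ω with
        Priv S y C ∧ κ (C.vars, y) < t, contrib φ y o C (ω C).2)) ≤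
      (1 + 8 * (n ^ 2 * p)) * Real.exp (8 * (n ^ 2 * p) * l ^ 2 - l * c) := by
  let g : (Clause n → Prop) → (Clause n → Bool × (Fin n → Bool)) → ℝ := fun q ω =>
    ∏ C, if (ω C).1 = true then
        (if q C then Real.exp (l * (ε * contrib φ y o C (ω C).2)) else 1) else 1
  let P : Finset (Clause n) := Finset.univ.filter (Priv S y)
  have hmem : ∀ C, Priv S y C → y ∈ C.vars := fun C hC => by
    have : y ∈ C.vars ∩ S := by rw [hC]; exact Finset.mem_singleton_self y
    exact (Finset.mem_inter.1 this).1
  have hP : P.card ≤ 8 * n ^ 2 := card_clauses_of_mem_le y P fun C hC =>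
    hmem C (Finset.mem_filter.1 hC).2
  have hg : ∀ q ω, c < ε * ∑ C ∈ formulaOf ω with q C, contrib φ y o C (ω C).2 →
      1 ≤ Real.exp (-(l * c)) * g q ω := by
    intro q ω h
    rw [show g q ω = _ from (exp_sum_contrib φ y o q l ε ω).symm, ← Real.exp_add]
    refine Real.one_le_exp ?_
    have := mul_le_mul_of_nonneg_left h.le hl0
    linarith
  have hg0 : ∀ q ω, 0 ≤ g q ω := fun q ω => Finset.prod_nonneg fun C _ => by
    split_ifs <;> positivity
  -- The present private clauses before `t` are either all of them or those before the first present
  -- one, `C₀`, at or after `t`. Summing over `C₀` costs a factor `p` for each of at most `8 n²`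
  -- clauses, hence only `8 d` instead of the number of all prefixes.
  have hpt : ∀ ω, ind (∃ t, c < ε * ∑ C ∈ formulaOf ω with
      Priv S y C ∧ κ (C.vars, y) < t, contrib φ y o C (ω C).2) ≤
      Real.exp (-(l * c)) * (g (Priv S y) ω + ∑ C₀ ∈ P, (if (ω C₀).1 = true then 1 else 0) *
        g (fun C => Priv S y C ∧ κ (C.vars, y) < κ (C₀.vars, y)) ω) := by
    intro ω
    have hs0 : ∀ C₀ ∈ P, 0 ≤ (if (ω C₀).1 = true then (1 : ℝ) else 0) *
        g (fun C => Priv S y C ∧ κ (C.vars, y) < κ (C₀.vars, y)) ω := fun C₀ _ =>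
      mul_nonneg (by split_ifs <;> norm_num) (hg0 _ _)
    by_cases h : ∃ t, c < ε * ∑ C ∈ formulaOf ω with
      Priv S y C ∧ κ (C.vars, y) < t, contrib φ y o C (ω C).2
    · rw [ind, if_pos h]
      obtain ⟨t, ht⟩ := h
      rw [mul_add]
      by_cases hlast : ∃ C ∈ formulaOf ω, Priv S y C ∧ ¬ κ (C.vars, y) < t
      · obtain ⟨C₁, hC₁, hC₁'⟩ := hlast
        obtain ⟨C₀, hC₀, hmin⟩ := Finset.exists_min_image
          ((formulaOf ω).filter fun C => Priv S y C ∧ ¬ κ (C.vars, y) < t) (fun C => κ (C.vars, y))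
          ⟨C₁, Finset.mem_filter.2 ⟨hC₁, hC₁'⟩⟩
        rw [Finset.mem_filter] at hC₀
        have heq : ((formulaOf ω).filter fun C => Priv S y C ∧ κ (C.vars, y) < t) =
            (formulaOf ω).filter fun C => Priv S y C ∧ κ (C.vars, y) < κ (C₀.vars, y) := by
          refine Finset.filter_congr fun C hC => and_congr_right fun hCp => ?_
          constructor
          · intro h
            exact h.trans_le (not_lt.1 hC₀.2.2)
          · intro h
            by_contra hnt
            exact absurd (hmin C (Finset.mem_filter.2 ⟨hC, hCp, hnt⟩)) (not_le.2 h)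
        have hle : (if (ω C₀).1 = true then (1 : ℝ) else 0) *
            g (fun C => Priv S y C ∧ κ (C.vars, y) < κ (C₀.vars, y)) ω ≤ _ :=
          Finset.single_le_sum hs0 (Finset.mem_filter.2 ⟨Finset.mem_univ C₀, hC₀.2.1⟩)
        rw [if_pos (mem_formulaOf.1 hC₀.1), one_mul] at hle
        have h5 : c < ε * ∑ C ∈ formulaOf ω with
            Priv S y C ∧ κ (C.vars, y) < κ (C₀.vars, y), contrib φ y o C (ω C).2 := by
          rw [← heq]
          exact ht
        have h6 := hg (fun C => Priv S y C ∧ κ (C.vars, y) < κ (C₀.vars, y)) ω (by convert h5)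
        have h7 := mul_le_mul_of_nonneg_left hle (Real.exp_pos (-(l * c))).le
        have h8 := mul_nonneg (Real.exp_pos (-(l * c))).le (hg0 (Priv S y) ω)
        linarith
      · push Not at hlast
        have heq : ((formulaOf ω).filter fun C => Priv S y C ∧ κ (C.vars, y) < t) =
            (formulaOf ω).filter (Priv S y) := by
          refine Finset.filter_congr fun C hC => ?_
          exact ⟨fun h => h.1, fun h => ⟨h, hlast C hC h⟩⟩
        rw [heq] at ht
        have h7 := mul_nonneg (Real.exp_pos (-(l * c))).le (Finset.sum_nonneg hs0)
        linarith [hg (Priv S y) ω (by convert ht)]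
    · rw [ind, if_neg h]
      exact mul_nonneg (Real.exp_pos _).le (add_nonneg (hg0 _ _) (Finset.sum_nonneg hs0))
  -- Being private and the position in `κ` depend only on the variables of a clause, so prefixes are
  -- invariant under flips.
  have hpriv : ∀ C, Priv S y (flipClause y C) ↔ Priv S y C := fun C => by
    rw [Priv, Priv, vars_flipClause]
  have hu : ∀ (q : Clause n → Prop) (C : Clause n) (a : Fin n → Bool),
      0 ≤ (if q C then Real.exp (l * (ε * contrib φ y o C a)) else 1) := fun q C a => by
    split_ifs <;> positivity
  have hE1 : pexp (wt p φ) (g (Priv S y)) ≤ Real.exp (8 * (n ^ 2 * p) * l ^ 2) := by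
    refine (pexp_prod_le h0 h1 φ (hu (Priv S y))).trans (Real.exp_le_exp.2 ?_)
    have := mul_le_mul_of_nonneg_left
      (sum_avg_contrib_le φ y o (Priv S y) hpriv hl0 hl1 ε hε) h0
    linarith
  have hE2 : ∀ C₀ ∈ P, pexp (wt p φ) (fun ω => (if (ω C₀).1 = true then 1 else 0) *
      g (fun C => Priv S y C ∧ κ (C.vars, y) < κ (C₀.vars, y)) ω) ≤
      p * Real.exp (8 * (n ^ 2 * p) * l ^ 2) := by
    intro C₀ _
    -- The strict inequality excludes `C₀` from its own prefix, so its factor is 1 as required.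
    refine (pexp_mem_mul_prod_le h0 h1 φ C₀
      (hu fun C => Priv S y C ∧ κ (C.vars, y) < κ (C₀.vars, y)) (fun a => by simp)).trans
      (mul_le_mul_of_nonneg_left (Real.exp_le_exp.2 ?_) h0)
    have := mul_le_mul_of_nonneg_left (sum_avg_contrib_le φ y o
      (fun C => Priv S y C ∧ κ (C.vars, y) < κ (C₀.vars, y))
      (fun C => by rw [hpriv, vars_flipClause]) hl0 hl1 ε hε) h0
    linarith
  refine (pexp_mono (wt_nonneg h0 h1 φ) hpt).trans ?_
  rw [pexp_const_mul, pexp_add, pexp_sum]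
  have hP' : (P.card : ℝ) ≤ 8 * n ^ 2 := by exact_mod_cast hP
  have hE := Real.exp_pos (8 * (n ^ 2 * p) * l ^ 2)
  have hsum : ∑ C₀ ∈ P, pexp (wt p φ) (fun ω => (if (ω C₀).1 = true then 1 else 0) *
      g (fun C => Priv S y C ∧ κ (C.vars, y) < κ (C₀.vars, y)) ω) ≤
      8 * (n ^ 2 * p) * Real.exp (8 * (n ^ 2 * p) * l ^ 2) := by
    refine (Finset.sum_le_sum hE2).trans ?_
    rw [Finset.sum_const, nsmul_eq_mul]
    have := mul_le_mul_of_nonneg_right hP' (mul_nonneg h0 hE.le)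
    linarith
  rw [sub_eq_add_neg, Real.exp_add]
  have := mul_le_mul_of_nonneg_left (add_le_add hE1 hsum) (Real.exp_pos (-(l * c))).le
  linarith

lemma pexp_ind_balance_le {p : ℝ} (h0 : 0 ≤ p) (h1 : p ≤ 1) (φ : Assignment n)
    (κ : Finset (Fin n) × Fin n → ℕ) (S : Finset (Fin n)) (y : Fin n) (o : Bool) :
    pexp (wt p φ) (fun ω => ind (∃ t, n ^ 2 * p / 60 < |∑ C ∈ formulaOf ω with
        Priv S y C ∧ κ (C.vars, y) < t, contrib φ y o C (ω C).2|)) ≤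
      (2 + 16 * (n ^ 2 * p)) * Real.exp (-(n ^ 2 * p / 120000)) := by
  have h2 : ∀ ω : Clause n → Bool × (Fin n → Bool),
      ind (∃ t, n ^ 2 * p / 60 < |∑ C ∈ formulaOf ω with
        Priv S y C ∧ κ (C.vars, y) < t, contrib φ y o C (ω C).2|) ≤
      ind (∃ t, n ^ 2 * p / 60 < 1 * ∑ C ∈ formulaOf ω with
        Priv S y C ∧ κ (C.vars, y) < t, contrib φ y o C (ω C).2) +
      ind (∃ t, n ^ 2 * p / 60 < (-1) * ∑ C ∈ formulaOf ω with
        Priv S y C ∧ κ (C.vars, y) < t, contrib φ y o C (ω C).2) := by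
    intro ω
    refine le_trans (ind_mono ?_) (ind_or_le _ _)
    rintro ⟨t, ht⟩
    rcases lt_abs.1 ht with h | h
    · exact Or.inl ⟨t, by rwa [one_mul]⟩
    · exact Or.inr ⟨t, by rwa [neg_one_mul]⟩
  refine (pexp_mono (wt_nonneg h0 h1 φ) h2).trans ?_
  rw [pexp_add]
  -- The value 1/960 minimises `8 l² - l / 60`; the minimum is -1/115200.
  have h3 := pexp_ind_exists_lt_le h0 h1 φ κ S y o (l := 1 / 960) (by norm_num) (by norm_num)
    (ε := 1) (by norm_num) (n ^ 2 * p / 60)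
  have h4 := pexp_ind_exists_lt_le h0 h1 φ κ S y o (l := 1 / 960) (by norm_num) (by norm_num)
    (ε := -1) (by norm_num) (n ^ 2 * p / 60)
  have hd : 0 ≤ n ^ 2 * p := by positivity
  have h5 : Real.exp (8 * (n ^ 2 * p) * (1 / 960) ^ 2 - 1 / 960 * (n ^ 2 * p / 60)) ≤
      Real.exp (-(n ^ 2 * p / 120000)) := Real.exp_le_exp.2 (by linarith)
  have h6 := mul_le_mul_of_nonneg_left h5 (by linarith : 0 ≤ 1 + 8 * (n ^ 2 * p))
  linarith

/-- The private clauses of a variable are unlikely to be faulty. -/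
lemma pexp_ind_privFaulty_le {p : ℝ} (h0 : 0 ≤ p) (h1 : p ≤ 1) (φ : Assignment n)
    (κ : Finset (Fin n) × Fin n → ℕ) {S : Finset (Fin n)} {y : Fin n} (hy : y ∈ S)
    (hS : 0.49 * (n : ℝ) ^ 2 ≤ ((n - S.card).choose 2 : ℕ)) :
    pexp (wt p φ) (fun ω => ind (PrivFaulty (n ^ 2 * p) φ κ S y (formulaOf ω) fun C => (ω C).2)) ≤
      (6 + 32 * (n ^ 2 * p)) * Real.exp (-(n ^ 2 * p / 120000)) := by
  set d := n ^ 2 * p with hd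
  have hd0 : 0 ≤ d := by positivity
  have h2 : ∀ ω : Clause n → Bool × (Fin n → Bool),
      ind (PrivFaulty d φ κ S y (formulaOf ω) fun C => (ω C).2) ≤
      ind ((((formulaOf ω).filter fun C => (Priv S y C ∧ Supports φ y C) ∧ True).card : ℝ) ≤ d / 3) +
      (ind ((((formulaOf ω).filter fun C =>
        (Priv S y C ∧ Supports φ y C) ∧ (ω C).2 y = true).card : ℝ) ≤ d / 7) +
      (ind (∃ t, d / 60 < |∑ C ∈ formulaOf ω with
        Priv S y C ∧ κ (C.vars, y) < t, contrib φ y false C (ω C).2|) +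
      ind (∃ t, d / 60 < |∑ C ∈ formulaOf ω with
        Priv S y C ∧ κ (C.vars, y) < t, contrib φ y true C (ω C).2|))) := by
    intro ω
    refine le_trans (ind_mono ?_) ((ind_or_le _ _).trans (add_le_add_right ((ind_or_le _ _).trans
      (add_le_add_right (ind_or_le _ _) _)) _))
    simp only [PrivFaulty, contrib, and_true, true_or, if_true, Bool.true_eq_false, false_or]
    exact id
  refine (pexp_mono (wt_nonneg h0 h1 φ) h2).trans ?_
  rw [pexp_add, pexp_add, pexp_add]
  have hcard : 0.49 * (n : ℝ) ^ 2 ≤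
      ((Finset.univ.filter fun C : Clause n => Priv S y C ∧ Supports φ y C).card : ℝ) :=
    hS.trans (by exact_mod_cast choose_le_card_support φ hy)
  have hm := mul_le_mul_of_nonneg_left hcard h0
  have hsat : ∀ C : Clause n, Priv S y C ∧ Supports φ y C → Satisfies φ C :=
    fun C hC => ⟨y, hC.2.1⟩
  have a1 := pexp_ind_card_le h0 h1 φ _ hsat (fun _ => True) (θ := 1)
    (by simp [ind, avg_const]) (d / 3)
  have a2 := pexp_ind_card_le h0 h1 φ _ hsat (fun a => a y = true) (θ := 1 / 2)
    (by rw [avg_apply y fun b => ind (b = true)]; simp [ind]) (d / 7)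
  have a3 := pexp_ind_balance_le h0 h1 φ κ S y false
  have a4 := pexp_ind_balance_le h0 h1 φ κ S y true
  rw [← hd] at a3 a4
  -- Here 0.49 · 0.39 exceeds 1/6 and, in `b2`, half of it exceeds 1/14, by much more than 1/120000
  -- each.
  have b1 : Real.exp (d / 3 / 2 - p * ((Finset.univ.filter fun C : Clause n =>
      Priv S y C ∧ Supports φ y C).card : ℝ) * (1 * 0.39)) ≤ Real.exp (-(d / 120000)) :=
    Real.exp_le_exp.2 (by norm_num at hm ⊢; linarith)
  have b2 : Real.exp (d / 7 / 2 - p * ((Finset.univ.filter fun C : Clause n =>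
      Priv S y C ∧ Supports φ y C).card : ℝ) * (1 / 2 * 0.39)) ≤ Real.exp (-(d / 120000)) :=
    Real.exp_le_exp.2 (by norm_num at hm ⊢; linarith)
  have c1 := a1.trans b1
  have c2 := a2.trans b2
  have := add_le_add c1 (add_le_add c2 (add_le_add a3 a4))
  refine this.trans (le_of_eq ?_)
  ring

end PlantedSAT

/-! ### Union bounds for dense sets and for sets with many faulty variables. -/

namespace PlantedSAT

variable {n : ℕ}

/-- With the base `n / (|S| d)` the two terms of the exponent in `pexp_pow_overlap_le` become `8
|S|` and `8 |S| / d`. Markov's inequality then charges `|S| d / n` for each unit of overlap. -/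
lemma pexp_pow_overlap_le_exp {p : ℝ} (h0 : 0 ≤ p) (h1 : p ≤ 1) (φ : Assignment n) {d : ℝ}
    (hd : d = n ^ 2 * p) (hd1 : 1 ≤ d) {S : Finset (Fin n)} (hS : 1 ≤ S.card)
    (hSn : S.card * d ≤ n) :
    pexp (wt p φ) (fun ω => (n / (S.card * d)) ^ overlap (formulaOf ω) Clause.vars S) ≤
      Real.exp (16 * S.card) := by
  have hs : (1 : ℝ) ≤ S.card := by exact_mod_cast hS
  have hsd : 0 < S.card * d := by positivity
  refine (pexp_pow_overlap_le h0 h1 φ S ((one_le_div hsd).2 hSn)).trans (Real.exp_le_exp.2 ?_)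
  have hn : (0 : ℝ) < n := hsd.trans_le hSn
  have hp : p = d / n ^ 2 := by
    rw [hd, mul_div_cancel_left₀ _ (by positivity)]
  have : p * (8 * (S.card ^ 2 * n) * (n / (S.card * d)) + 8 * S.card ^ 3 *
      (n / (S.card * d)) ^ 2) = 8 * S.card + 8 * S.card / d := by
    rw [hp]
    clear hp hd
    have h2 : (S.card : ℝ) ≠ 0 := by positivity
    have h3 : d ≠ 0 := by positivity
    field_simp
  rw [this]
  clear this hp
  have : 8 * (S.card : ℝ) / d ≤ 8 * S.card := div_le_self (by positivity) hd1
  linarith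

lemma ind_le_pow {k m : ℕ} {z : ℝ} (hz : 1 ≤ z) : ind (k ≤ m) ≤ z⁻¹ ^ k * z ^ m := by
  have hz0 : 0 < z := by linarith
  unfold ind
  split_ifs with h
  · rw [inv_pow, ← div_eq_inv_mul, one_le_div (by positivity)]
    exact pow_le_pow_right₀ hz h
  · positivity

/-- The powers of `n` cancel, and `s ^ s / s! ≤ exp s` absorbs the remaining power of `s`. -/
lemma choose_mul_le (s : ℕ) (hn : 0 < n) {d : ℝ} (hd : 0 ≤ d) :
    (n.choose s : ℝ) * ((s * d / n) ^ s * Real.exp (16 * s)) ≤ (Real.exp 17 * d) ^ s := by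
  have hn' : (0 : ℝ) < n := by exact_mod_cast hn
  have h1 : (n.choose s : ℝ) ≤ n ^ s / s.factorial := Nat.choose_le_pow_div s n
  have h2 : (s : ℝ) ^ s / s.factorial ≤ Real.exp s := Real.pow_div_factorial_le_exp _ (by positivity) s
  calc (n.choose s : ℝ) * ((s * d / n) ^ s * Real.exp (16 * s))
      ≤ n ^ s / s.factorial * ((s * d / n) ^ s * Real.exp (16 * s)) :=
        mul_le_mul_of_nonneg_right h1 (by positivity)
    _ = (s ^ s / s.factorial) * (d ^ s * Real.exp (16 * s)) := by
        rw [div_pow, mul_pow]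
        field_simp
    _ ≤ Real.exp s * (d ^ s * Real.exp (16 * s)) := mul_le_mul_of_nonneg_right h2 (by positivity)
    _ = (Real.exp 17 * d) ^ s := by
        rw [mul_pow, ← Real.exp_nat_mul, mul_left_comm, ← Real.exp_add, mul_comm]
        ring_nf

/-- Small sets have no positive surplus with high probability. -/
lemma pexp_not_sparse_le {p : ℝ} (h0 : 0 ≤ p) (h1 : p ≤ 1) (φ : Assignment n) {d : ℝ}
    (hd : d = n ^ 2 * p) (hd1 : 1 ≤ d) {s₀ : ℕ} (hs₀ : s₀ * d ≤ n) :
    pexp (wt p φ) (fun ω => ind (¬ Sparse (formulaOf ω) Clause.vars s₀)) ≤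
      ∑ s ∈ Finset.Icc 1 s₀, s * d / n * (Real.exp 17 * d) ^ s := by
  have hpt : ∀ ω : Clause n → Bool × (Fin n → Bool),
      ind (¬ Sparse (formulaOf ω) Clause.vars s₀) ≤ ∑ s ∈ Finset.Icc 1 s₀,
        ∑ S ∈ (Finset.univ : Finset (Fin n)).powersetCard s,
          ind (s + 1 ≤ overlap (formulaOf ω) Clause.vars S) := by
    intro ω
    refine le_trans (ind_mono ?_) ((ind_exists_le _ _).trans
      (Finset.sum_le_sum fun s _ => ind_exists_le _ _))
    intro h
    rw [Sparse] at h
    push Not at h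
    obtain ⟨S, hS, hov⟩ := h
    have hne : 1 ≤ S.card := by
      rw [Nat.one_le_iff_ne_zero]
      intro h0
      rw [Finset.card_eq_zero] at h0
      subst h0
      simp [overlap] at hov
    exact ⟨S.card, Finset.mem_Icc.2 ⟨hne, hS⟩, S,
      Finset.mem_powersetCard.2 ⟨Finset.subset_univ _, rfl⟩, hov⟩
  refine (pexp_mono (wt_nonneg h0 h1 φ) hpt).trans ?_
  rw [pexp_sum]
  refine Finset.sum_le_sum fun s hs => ?_
  rw [pexp_sum]
  obtain ⟨hs1, hss⟩ := Finset.mem_Icc.1 hs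
  have hs1' : (1 : ℝ) ≤ s := by exact_mod_cast hs1
  have hss' : (s : ℝ) ≤ s₀ := by exact_mod_cast hss
  have hsn : s * d ≤ n := (mul_le_mul_of_nonneg_right hss' (by linarith)).trans hs₀
  have hsd : 0 < s * d := by positivity
  have hn : (0 : ℝ) < n := hsd.trans_le hsn
  have hone : ∀ S ∈ (Finset.univ : Finset (Fin n)).powersetCard s,
      pexp (wt p φ) (fun ω => ind (s + 1 ≤ overlap (formulaOf ω) Clause.vars S)) ≤
        (s * d / n) ^ (s + 1) * Real.exp (16 * s) := by
    intro S hS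
    have hc := (Finset.mem_powersetCard.1 hS).2
    have hz : 1 ≤ n / (s * d) := (one_le_div hsd).2 hsn
    refine (pexp_mono (wt_nonneg h0 h1 φ) fun ω => ind_le_pow hz).trans ?_
    rw [pexp_const_mul, inv_div]
    refine mul_le_mul_of_nonneg_left ?_ (by positivity)
    have := pexp_pow_overlap_le_exp h0 h1 φ hd hd1 (S := S) (by omega) (by rwa [hc])
    rwa [hc] at this
  refine (Finset.sum_le_sum hone).trans ?_
  rw [Finset.sum_const, Finset.card_powersetCard, Finset.card_univ, Fintype.card_fin, nsmul_eq_mul]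
  have h2 := choose_mul_le s (by exact_mod_cast hn) (by linarith : 0 ≤ d)
  have h3 := mul_le_mul_of_nonneg_left h2 (by positivity : 0 ≤ s * d / n)
  refine le_trans (le_of_eq ?_) h3
  rw [pow_succ]
  ring

/-- Many variables of `S` have faulty private clauses. -/
def BadSet (d : ℝ) (φ : Assignment n) (κ : Finset (Fin n) × Fin n → ℕ) (F : Formula n)
    (a : Clause n → Fin n → Bool) (S : Finset (Fin n)) : Prop :=
  S.card ≤ overlap F Clause.vars S + 1 ∧
    ∃ Y ⊆ S, S.card ≤ 8 * Y.card ∧ ∀ y ∈ Y, PrivFaulty d φ κ S y F a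

lemma prod_ind {κ : Type*} (s : Finset κ) (P : κ → Prop) :
    ∏ k ∈ s, ind (P k) = ind (∀ k ∈ s, P k) := by
  by_cases h : ∀ k ∈ s, P k
  · rw [ind, if_pos h]
    exact Finset.prod_eq_one fun k hk => by simp [ind, h k hk]
  · rw [ind, if_neg h]
    push Not at h
    obtain ⟨k, hk, hn⟩ := h
    exact Finset.prod_eq_zero hk (by simp [ind, hn])

/-- The overlap depends only on clauses with two variables in `S`, none of which is private. This
makes it independent of the faults in private clauses. -/
lemma pow_overlap_dependsOn (S : Finset (Fin n)) (z : ℝ) :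
    DependsOn (fun ω : Clause n → Bool × (Fin n → Bool) =>
      z ^ overlap (formulaOf ω) Clause.vars S) {C | 2 ≤ (C.vars ∩ S).card} := by
  intro ω ω' h
  have : overlap (formulaOf ω) Clause.vars S = overlap (formulaOf ω') Clause.vars S := by
    rw [overlap, overlap, formulaOf, formulaOf, Finset.sum_filter, Finset.sum_filter]
    refine Finset.sum_congr rfl fun C _ => ?_
    by_cases hC : 2 ≤ (C.vars ∩ S).card
    · rw [h C hC]
    · rw [show (C.vars ∩ S).card - 1 = 0 by omega, ite_self, ite_self]
  simp only [this]

lemma privFaulty_dependsOn (d : ℝ) (φ : Assignment n) (κ : Finset (Fin n) × Fin n → ℕ)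
    (S : Finset (Fin n)) (y : Fin n) :
    DependsOn (fun ω : Clause n → Bool × (Fin n → Bool) =>
      ind (PrivFaulty d φ κ S y (formulaOf ω) fun C => (ω C).2)) {C | Priv S y C} := by
  intro ω ω' h
  have hF : ∀ C, Priv S y C → (C ∈ formulaOf ω ↔ C ∈ formulaOf ω') := fun C hC => by
    rw [mem_formulaOf, mem_formulaOf, h C hC]
  have hfil : ∀ q : Clause n → Prop, (∀ C, q C → Priv S y C) →
      ((formulaOf ω).filter q) = (formulaOf ω').filter q := fun q hq => by
    ext C
    rw [Finset.mem_filter, Finset.mem_filter]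
    exact and_congr_left fun hC => hF C (hq C hC)
  have h1 : ((formulaOf ω).filter fun C => Priv S y C ∧ Supports φ y C) =
      (formulaOf ω').filter fun C => Priv S y C ∧ Supports φ y C := by
    convert hfil (fun C => Priv S y C ∧ Supports φ y C) (fun C hC => hC.1)
  have h2 : ((formulaOf ω).filter fun C => (Priv S y C ∧ Supports φ y C) ∧ (ω C).2 y = true) =
      (formulaOf ω').filter fun C => (Priv S y C ∧ Supports φ y C) ∧ (ω' C).2 y = true := by
    ext C
    rw [Finset.mem_filter, Finset.mem_filter]
    constructor
    · rintro ⟨h1, h2, h3⟩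
      exact ⟨(hF C h2.1).1 h1, h2, by rwa [← h C h2.1]⟩
    · rintro ⟨h1, h2, h3⟩
      exact ⟨(hF C h2.1).2 h1, h2, by rwa [h C h2.1]⟩
  have h3 : ∀ t, ((formulaOf ω).filter fun C => Priv S y C ∧ κ (C.vars, y) < t) =
      (formulaOf ω').filter fun C => Priv S y C ∧ κ (C.vars, y) < t := fun t => by
    convert hfil (fun C => Priv S y C ∧ κ (C.vars, y) < t) (fun C hC => hC.1)
  have h4 : ∀ t, ∑ C ∈ formulaOf ω with Priv S y C ∧ κ (C.vars, y) < t,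
      (if (ω C).2 y = true then sgn φ y C else 0) =
      ∑ C ∈ formulaOf ω' with Priv S y C ∧ κ (C.vars, y) < t,
      (if (ω' C).2 y = true then sgn φ y C else 0) := fun t => by
    rw [h3]
    refine Finset.sum_congr rfl fun C hC => ?_
    rw [h C (Finset.mem_filter.1 hC).2.1]
  simp only [PrivFaulty, h4]
  simp only [h1, h2, h3]

/-- Sets with many faulty variables are unlikely. -/
lemma pexp_badSet_le {p : ℝ} (h0 : 0 ≤ p) (h1 : p ≤ 1) (φ : Assignment n)
    (κ : Finset (Fin n) × Fin n → ℕ) {d : ℝ}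
    (hd : d = n ^ 2 * p) (hd1 : 1 ≤ d) {s₀ s₁ : ℕ} (hs₀ : s₀ * d ≤ n) (hs₁ : 1 ≤ s₁)
    (hch : ∀ s ≤ s₀, 0.49 * (n : ℝ) ^ 2 ≤ ((n - s).choose 2 : ℕ)) {η : ℝ} (hη0 : 0 ≤ η)
    (hη1 : η ≤ 1) (hη : (6 + 32 * d) * Real.exp (-(d / 120000)) ≤ η ^ 8) :
    pexp (wt p φ) (fun ω => ind (∃ s ∈ Finset.Icc s₁ s₀,
        ∃ S ∈ (Finset.univ : Finset (Fin n)).powersetCard s,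
          BadSet d φ κ (formulaOf ω) (fun C => (ω C).2) S)) ≤
      ∑ s ∈ Finset.Icc s₁ s₀, n * (2 * Real.exp 17 * d * η) ^ s := by
  refine (pexp_mono (wt_nonneg h0 h1 φ) fun ω => (ind_exists_le _ _).trans
      (Finset.sum_le_sum fun s _ => ind_exists_le _ _)).trans ?_
  rw [pexp_sum]
  refine Finset.sum_le_sum fun s hs => ?_
  rw [pexp_sum]
  obtain ⟨hs1, hss⟩ := Finset.mem_Icc.1 hs
  have hs1' : (1 : ℝ) ≤ s := by exact_mod_cast hs₁.trans hs1
  have hss' : (s : ℝ) ≤ s₀ := by exact_mod_cast hss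
  have hsn : s * d ≤ n := (mul_le_mul_of_nonneg_right hss' (by linarith)).trans hs₀
  have hsd : 0 < s * d := by positivity
  have hn : (0 : ℝ) < n := hsd.trans_le hsn
  have hz : 1 ≤ n / (s * d) := (one_le_div hsd).2 hsn
  have hz0 : 0 < n / (s * d) := by linarith
  have hone : ∀ S ∈ (Finset.univ : Finset (Fin n)).powersetCard s,
      pexp (wt p φ) (fun ω => ind (BadSet d φ κ (formulaOf ω) (fun C => (ω C).2) S)) ≤
        2 ^ s * (n / (s * d) * ((s * d / n) ^ s * Real.exp (16 * s)) * η ^ s) := by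
    intro S hS
    have hc := (Finset.mem_powersetCard.1 hS).2
    -- At most `2 ^ s` sets `Y` are possible. An overlap of at least `s - 1` costs `(s d / n) ^ (s -
    -- 1)`, written here as `n / (s d) * (s d / n) ^ s`.
    have hpt : ∀ ω : Clause n → Bool × (Fin n → Bool),
        ind (BadSet d φ κ (formulaOf ω) (fun C => (ω C).2) S) ≤
        ∑ Y ∈ S.powerset with s ≤ 8 * Y.card, (n / (s * d) * (s * d / n) ^ s) *
          ((n / (s * d)) ^ overlap (formulaOf ω) Clause.vars S *
            ∏ y ∈ Y, ind (PrivFaulty d φ κ S y (formulaOf ω) fun C => (ω C).2)) := by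
      intro ω
      refine le_trans (ind_mono (Q := ∃ Y ∈ S.powerset.filter fun Y => s ≤ 8 * Y.card,
        s ≤ overlap (formulaOf ω) Clause.vars S + 1 ∧
          ∀ y ∈ Y, PrivFaulty d φ κ S y (formulaOf ω) fun C => (ω C).2) ?_)
        ((ind_exists_le _ _).trans (Finset.sum_le_sum fun Y _ => ?_))
      · rintro ⟨h1, Y, hY, h2, h3⟩
        rw [hc] at h1 h2
        exact ⟨Y, Finset.mem_filter.2 ⟨Finset.mem_powerset.2 hY, h2⟩, h1, h3⟩
      · rw [ind_and, prod_ind, ← mul_assoc]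
        refine mul_le_mul_of_nonneg_right ((ind_le_pow hz).trans (le_of_eq ?_)) (ind_nonneg _)
        rw [inv_div, pow_succ]
        ring
    refine (pexp_mono (wt_nonneg h0 h1 φ) hpt).trans ?_
    rw [pexp_sum]
    have hY : ∀ Y ∈ S.powerset.filter fun Y => s ≤ 8 * Y.card,
        pexp (wt p φ) (fun ω => (n / (s * d) * (s * d / n) ^ s) *
          ((n / (s * d)) ^ overlap (formulaOf ω) Clause.vars S *
            ∏ y ∈ Y, ind (PrivFaulty d φ κ S y (formulaOf ω) fun C => (ω C).2))) ≤
        n / (s * d) * ((s * d / n) ^ s * Real.exp (16 * s)) * η ^ s := by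
      intro Y hY
      obtain ⟨hYS, hY8⟩ := Finset.mem_filter.1 hY
      rw [Finset.mem_powerset] at hYS
      rw [pexp_const_mul, pexp_mul_prod (sum_wt p φ) (pow_overlap_dependsOn S _)
        (fun y _ => privFaulty_dependsOn d φ κ S y)]
      · have e1 := pexp_pow_overlap_le_exp h0 h1 φ hd hd1 (S := S) (by omega) (by rwa [hc])
        rw [hc] at e1
        -- Each faulty variable contributes `η ^ 8`, and `8 * Y.card ≥ s`.
        have e2 : ∏ y ∈ Y, pexp (wt p φ) (fun ω =>
            ind (PrivFaulty d φ κ S y (formulaOf ω) fun C => (ω C).2)) ≤ η ^ s := by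
          calc ∏ y ∈ Y, pexp (wt p φ) (fun ω =>
                  ind (PrivFaulty d φ κ S y (formulaOf ω) fun C => (ω C).2))
              ≤ ∏ y ∈ Y, η ^ 8 := by
                refine Finset.prod_le_prod
                  (fun y _ => pexp_nonneg (wt_nonneg h0 h1 φ) fun ω => ind_nonneg _)
                  fun y hy => le_trans ?_ hη
                rw [hd]
                exact pexp_ind_privFaulty_le h0 h1 φ κ (hYS hy) (hc ▸ hch s hss)
            _ = η ^ (8 * Y.card) := by rw [Finset.prod_const, ← pow_mul]
            _ ≤ η ^ s := pow_le_pow_of_le_one hη0 hη1 hY8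
        have e3 := mul_le_mul e1 e2 (Finset.prod_nonneg fun y _ =>
          pexp_nonneg (wt_nonneg h0 h1 φ) fun ω => ind_nonneg _) (Real.exp_pos _).le
        have e4 := mul_le_mul_of_nonneg_left e3
          (by positivity : 0 ≤ n / (s * d) * (s * d / n) ^ s)
        refine e4.trans (le_of_eq ?_)
        ring
      · intro y hy
        rw [Set.disjoint_left]
        intro C hC hCy
        change 2 ≤ (C.vars ∩ S).card at hC
        change C.vars ∩ S = {y} at hCy
        rw [hCy, Finset.card_singleton] at hC
        omega
      · intro y hy x hx hyx
        rw [Set.disjoint_left]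
        intro C hCy hCx
        change C.vars ∩ S = {y} at hCy
        change C.vars ∩ S = {x} at hCx
        exact hyx (Finset.singleton_injective (hCy.symm.trans hCx))
    refine (Finset.sum_le_sum hY).trans ?_
    rw [Finset.sum_const, nsmul_eq_mul]
    refine mul_le_mul_of_nonneg_right ?_ (by positivity)
    have := Finset.card_filter_le S.powerset fun Y => s ≤ 8 * Y.card
    rw [Finset.card_powerset, hc] at this
    exact_mod_cast this
  refine (Finset.sum_le_sum hone).trans ?_
  rw [Finset.sum_const, Finset.card_powersetCard, Finset.card_univ, Fintype.card_fin, nsmul_eq_mul]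
  have h2 := choose_mul_le s (by exact_mod_cast hn) (by linarith : 0 ≤ d)
  have h3 : n / (s * d) ≤ n := div_le_self hn.le (by nlinarith)
  calc (n.choose s : ℝ) * (2 ^ s * (n / (s * d) * ((s * d / n) ^ s * Real.exp (16 * s)) * η ^ s))
      = n / (s * d) * (2 ^ s * η ^ s) *
          ((n.choose s : ℝ) * ((s * d / n) ^ s * Real.exp (16 * s))) := by ring
    _ ≤ n * (2 ^ s * η ^ s) * (Real.exp 17 * d) ^ s := by
        refine mul_le_mul (mul_le_mul_of_nonneg_right h3 (by positivity)) h2 (by positivity)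
          (by positivity)
    _ = n * (2 * Real.exp 17 * d * η) ^ s := by
        rw [mul_pow, mul_pow, mul_pow, mul_pow]
        ring

end PlantedSAT

/-! ### Transfer from the product space to the planted model. -/

namespace PlantedSAT

section UniformAverage

variable {X Y : Type*}

/-- The average of `f` over a finite type. -/
noncomputable def uavg (f : X → ℝ) : ℝ := (∑ᶠ x, f x) / Nat.card X

lemma uavg_eq [Fintype X] (f : X → ℝ) : uavg f = (∑ x, f x) / Fintype.card X := by
  rw [uavg, finsum_eq_sum_of_fintype, Nat.card_eq_fintype_card]

variable [Finite X] [Finite Y]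

lemma uavg_mono {f g : X → ℝ} (h : ∀ x, f x ≤ g x) : uavg f ≤ uavg g := by
  have := Fintype.ofFinite X
  rw [uavg_eq, uavg_eq]
  exact div_le_div_of_nonneg_right (Finset.sum_le_sum fun x _ => h x) (by positivity)

lemma uavg_const [Nonempty X] (c : ℝ) : uavg (fun _ : X => c) = c := by
  have := Fintype.ofFinite X
  have : (Fintype.card X : ℝ) ≠ 0 := by exact_mod_cast Fintype.card_ne_zero
  rw [uavg_eq, Finset.sum_const, nsmul_eq_mul, Finset.card_univ, mul_div_cancel_left₀ _ this]

lemma uavg_sub (f g : X → ℝ) : uavg (fun x => f x - g x) = uavg f - uavg g := by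
  have := Fintype.ofFinite X
  rw [uavg_eq, uavg_eq, uavg_eq, Finset.sum_sub_distrib, sub_div]

lemma uavg_prod (f : X → Y → ℝ) :
    uavg (fun z : X × Y => f z.1 z.2) = uavg fun x => uavg fun y => f x y := by
  have := Fintype.ofFinite X
  have := Fintype.ofFinite Y
  simp only [uavg_eq]
  rw [Fintype.sum_prod_type, Fintype.card_prod, ← Finset.sum_div, div_div, Nat.cast_mul, mul_comm]

lemma uavg_comm (f : X → Y → ℝ) :
    (uavg fun x => uavg fun y => f x y) = uavg fun y => uavg fun x => f x y := by
  have := Fintype.ofFinite X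
  have := Fintype.ofFinite Y
  simp only [uavg_eq]
  rw [← Finset.sum_div, ← Finset.sum_div, Finset.sum_comm, div_div, div_div, mul_comm]

lemma uavg_equiv (e : X ≃ Y) (f : Y → ℝ) : uavg (fun x => f (e x)) = uavg f := by
  have := Fintype.ofFinite X
  have := Fintype.ofFinite Y
  rw [uavg_eq, uavg_eq, Equiv.sum_comp e f, Fintype.card_congr e]

lemma sum_mul_uavg {κ : Type*} (s : Finset κ) (w : κ → ℝ) (f : κ → X → ℝ) :
    ∑ k ∈ s, w k * uavg (f k) = uavg fun x => ∑ k ∈ s, w k * f k x := by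
  have := Fintype.ofFinite X
  simp only [uavg_eq]
  rw [Finset.sum_comm, Finset.sum_div]
  exact Finset.sum_congr rfl fun k _ => by rw [← Finset.mul_sum, mul_div_assoc]

lemma card_subtype_div (P : X → Prop) :
    (Nat.card {x // P x} : ℝ) / (Nat.card X : ℝ) = uavg fun x => ind (P x) := by
  have := Fintype.ofFinite X
  rw [uavg_eq, Nat.card_eq_fintype_card, Nat.card_eq_fintype_card, Fintype.card_subtype]
  congr 1
  simp only [ind]
  rw [Finset.sum_boole]

end UniformAverage

/-- Restricting a uniformly random `0/1`-vector to a subset of the indices. -/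
lemma uavg_restrict {ι : Type*} [Finite ι] (P : ι → Prop)
    (f : ({i // P i} → Bool) → ℝ) :
    uavg f = uavg fun a : ι → Bool => f fun i => a i := by
  have h := uavg_equiv (Equiv.piEquivPiSubtypeProd P fun _ => Bool)
    fun z : ({i // P i} → Bool) × ({i // ¬ P i} → Bool) => f z.1
  rw [uavg_prod (fun x (_ : {i // ¬ P i} → Bool) => f x)] at h
  simp only [uavg_const] at h
  exact h.symm

section Rank

variable {M : Type*}

lemma exists_rank [Fintype M] {r : M → ℕ} (hr : Function.Injective r) :
    ∃ π : M ≃ Fin (Fintype.card M), ∀ e e', π e < π e' ↔ r e < r e' := by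
  let _ := LinearOrder.lift' r hr
  exact ⟨(Fintype.orderIsoFinOfCardEq M rfl).symm.toEquiv, fun e e' =>
    (Fintype.orderIsoFinOfCardEq M rfl).symm.lt_iff_lt⟩

/-- The only order automorphism of `Fin m` is the identity. -/
lemma rank_unique {m : ℕ} {π π' : M ≃ Fin m} (h : ∀ e e', π e < π e' ↔ π' e < π' e') : π = π' := by
  let f : Fin m ≃o Fin m := (StrictMono.orderIsoOfSurjective (fun i => π' (π.symm i))
    (fun i j hij => (h _ _).1 (by simpa using hij)) (π.symm.trans π').surjective)
  have hf : f = OrderIso.refl _ := Subsingleton.elim _ _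
  ext1 e
  have h2 : f (π e) = π e := by rw [hf]; rfl
  have h3 : f (π e) = π' (π.symm (π e)) := rfl
  rw [Equiv.symm_apply_apply] at h3
  rw [← h2, h3]

/-- The uniformly random order that a uniformly random permutation of a larger set induces. -/
lemma uavg_rank [Fintype M] {K : Type*} [Finite K] (k : M ↪ K) (b : K → ℕ) (hb : Function.Injective b)
    (f : M ≃ Fin (Fintype.card M) → ℝ) :
    ∃ R : Equiv.Perm K → (M ≃ Fin (Fintype.card M)),
      (∀ σ e e', R σ e < R σ e' ↔ b (σ (k e)) < b (σ (k e'))) ∧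
      uavg f = uavg fun σ => f (R σ) := by
  have hinj : ∀ σ : Equiv.Perm K, Function.Injective fun e => b (σ (k e)) := fun σ =>
    hb.comp (σ.injective.comp k.injective)
  choose R hR using fun σ => exists_rank (hinj σ)
  refine ⟨R, hR, ?_⟩
  -- Permuting the embedded copy of `M` before applying `σ` permutes the induced ranking, so its law
  -- is invariant under all permutations of `M` and hence uniform.
  have hcomp : ∀ (τ : Equiv.Perm M) (σ : Equiv.Perm K),
      R (σ * τ.viaEmbedding k) = τ.trans (R σ) := by
    intro τ σ
    refine rank_unique fun e e' => ?_
    rw [hR, Equiv.trans_apply, Equiv.trans_apply, hR, Equiv.Perm.mul_apply, Equiv.Perm.mul_apply,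
      Equiv.Perm.viaEmbedding_apply, Equiv.Perm.viaEmbedding_apply]
  have h1 : ∀ τ : Equiv.Perm M, (uavg fun σ => f (R σ)) = uavg fun σ => f (τ.trans (R σ)) := by
    intro τ
    rw [← uavg_equiv (Equiv.mulRight (τ.viaEmbedding k)) fun σ => f (R σ)]
    simp only [Equiv.coe_mulRight, hcomp]
  have h2 : ∀ σ, (uavg fun τ : Equiv.Perm M => f (τ.trans (R σ))) = uavg f := by
    intro σ
    let e : Equiv.Perm M ≃ (M ≃ Fin (Fintype.card M)) :=
      { toFun := fun τ => τ.trans (R σ)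
        invFun := fun π => π.trans (R σ).symm
        left_inv := fun τ => by ext; simp
        right_inv := fun π => by ext; simp }
    exact uavg_equiv e f
  calc uavg f = uavg fun _ : Equiv.Perm K => uavg f := (uavg_const _).symm
    _ = uavg fun σ => uavg fun τ : Equiv.Perm M => f (τ.trans (R σ)) := by simp only [h2]
    _ = uavg fun τ : Equiv.Perm M => uavg fun σ => f (τ.trans (R σ)) := uavg_comm _
    _ = uavg fun _ : Equiv.Perm M => uavg fun σ => f (R σ) := by simp only [← h1]
    _ = _ := uavg_const _

end Rank

variable {n : ℕ}

lemma formulaProb_eq_prod (p : ℝ) (φ : Assignment n) (F : Formula n) :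
    formulaProb p φ F = ∏ C : Clause n, if Satisfies φ C then (if C ∈ F then p else 1 - p)
      else (if C ∈ F then 0 else 1) := by
  rw [formulaProb]
  have hmem : ∀ C : Clause n, C ∈ satClauses φ ↔ Satisfies φ C := fun C => by simp [satClauses]
  split_ifs with h
  · rw [Finset.prod_ite]
    have h1 : ∏ C : Clause n with ¬ Satisfies φ C, (if C ∈ F then (0 : ℝ) else 1) = 1 := by
      refine Finset.prod_eq_one fun C hC => if_neg fun hCF => ?_
      exact (Finset.mem_filter.1 hC).2 ((hmem C).1 (h hCF))
    rw [h1, mul_one, Finset.prod_ite, Finset.prod_const, Finset.prod_const, Finset.filter_filter,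
      Finset.filter_filter]
    congr 3
    · ext C
      simp only [Finset.mem_filter, Finset.mem_univ, true_and]
      exact ⟨fun hC => ⟨(hmem C).1 (h hC), hC⟩, fun hC => hC.2⟩
    · ext C
      simp only [Finset.mem_filter, Finset.mem_univ, true_and, Finset.mem_sdiff, hmem]
  · obtain ⟨C, hCF, hC⟩ := Finset.not_subset.1 h
    refine (Finset.prod_eq_zero (Finset.mem_univ C) ?_).symm
    rw [if_neg (fun h => hC ((hmem C).2 h)), if_pos hCF]

/-- In the product space the formula has the planted law, and the messages on all potential edges
are uniform and independent of it. -/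
lemma pexp_eq_sum_formulaProb (p : ℝ) (φ : Assignment n)
    (h : Formula n → (Clause n → Fin n → Bool) → ℝ) :
    pexp (wt p φ) (fun ω => h (formulaOf ω) fun C => (ω C).2) =
      ∑ F : Formula n, formulaProb p φ F * uavg (h F) := by
  let e : (Clause n → Bool × (Fin n → Bool)) ≃ Formula n × (Clause n → Fin n → Bool) :=
    { toFun := fun ω => (formulaOf ω, fun C => (ω C).2)
      invFun := fun x C => (decide (C ∈ x.1), x.2 C)
      left_inv := fun ω => by
        funext C
        refine Prod.ext ?_ rfl
        simp [mem_formulaOf]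
      right_inv := fun x => by
        refine Prod.ext ?_ rfl
        ext C
        simp [mem_formulaOf] }
  have hw : ∀ ω : Clause n → Bool × (Fin n → Bool), ∏ C, wt p φ C (ω C) =
      formulaProb p φ (formulaOf ω) / Fintype.card (Clause n → Fin n → Bool) := by
    intro ω
    simp only [wt, formulaProb_eq_prod, mem_formulaOf, Finset.prod_mul_distrib, Finset.prod_const,
      Finset.card_univ]
    rw [div_eq_mul_inv, mul_comm]
    congr 1
    simp
  have h2 : pexp (wt p φ) (fun ω => h (formulaOf ω) fun C => (ω C).2) =
      ∑ x : Formula n × (Clause n → Fin n → Bool),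
        formulaProb p φ x.1 / Fintype.card (Clause n → Fin n → Bool) * h x.1 x.2 := by
    rw [pexp, ← Equiv.sum_comp e]
    exact Finset.sum_congr rfl fun ω _ => by rw [hw]; rfl
  rw [h2, Fintype.sum_prod_type]
  refine Finset.sum_congr rfl fun F _ => ?_
  simp only [uavg_eq]
  rw [← Finset.mul_sum]
  ring

lemma formulaProb_nonneg {p : ℝ} (h0 : 0 ≤ p) (h1 : p ≤ 1) (φ : Assignment n) (F : Formula n) :
    0 ≤ formulaProb p φ F := by
  have : 0 ≤ 1 - p := by linarith
  unfold formulaProb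
  split_ifs <;> positivity

lemma sum_formulaProb (p : ℝ) (φ : Assignment n) : ∑ F : Formula n, formulaProb p φ F = 1 := by
  have h := pexp_eq_sum_formulaProb p φ fun _ _ => 1
  rw [pexp_one (sum_wt p φ)] at h
  simpa only [uavg_const, mul_one] using h.symm

/-- In a sparse formula no two clauses have the same variables. -/
lemma Sparse.vars_injOn {F : Formula n} {s₀ : ℕ} (hs : 3 ≤ s₀) (h : Sparse F Clause.vars s₀) :
    Set.InjOn Clause.vars (F : Set (Clause n)) := by
  intro C hC D hD hCD
  by_contra hne
  have h1 := h C.vars (by rw [C.card_vars]; exact hs)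
  -- Two clauses on the same three variables have overlap 2 + 2 > 3.
  have h2 : ∑ B ∈ {C, D}, ((B.vars ∩ C.vars).card - 1) ≤ overlap F Clause.vars C.vars :=
    Finset.sum_le_sum_of_subset (Finset.insert_subset hC (Finset.singleton_subset_iff.2 hD))
  rw [Finset.sum_pair hne, ← hCD, Finset.inter_self, C.card_vars] at h2
  rw [C.card_vars] at h1
  omega

lemma uavg_messages (F : Formula n) (f : Messages F → ℝ) :
    uavg f = uavg fun a : Clause n → Fin n → Bool => f fun e => a e.1.1 e.1.2 := by
  rw [uavg_restrict (fun e : Clause n × Fin n => e.1 ∈ F ∧ e.1.Mentions e.2) f]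
  exact (uavg_equiv (Equiv.curry (Clause n) (Fin n) Bool).symm
    fun a : Clause n × Fin n → Bool => f fun e => a e).symm

/-- Bounds for the random formula and `0/1`-vectors on all potential message edges, which hold for
each fixed order of the potential edges, carry over to the planted model. -/
lemma one_sub_le_plantedProb {p : ℝ} (h0 : 0 ≤ p) (h1 : p ≤ 1)
    (E : (φ : Assignment n) → (F : Formula n) → Messages F → EdgeOrder F → Prop)
    {s₀ : ℕ} (hs₀ : 3 ≤ s₀)
    (G : Assignment n → (Finset (Fin n) × Fin n → ℕ) → Formula n → (Clause n → Fin n → Bool) → Prop)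
    (hG : ∀ φ F α π κ a, Sparse F Clause.vars s₀ → (∀ e, α e = a e.1.1 e.1.2) →
      (∀ e e', π e < π e' ↔ κ (e.1.1.vars, e.1.2) < κ (e'.1.1.vars, e'.1.2)) →
      ¬ E φ F α π → G φ κ F a) {B₁ B₂ : ℝ}
    (hB₁ : ∀ φ : Assignment n, pexp (wt p φ) (fun ω => ind (¬ Sparse (formulaOf ω) Clause.vars s₀)) ≤ B₁)
    (hB₂ : ∀ (φ : Assignment n) κ, pexp (wt p φ) (fun ω => ind (G φ κ (formulaOf ω) fun C => (ω C).2)) ≤ B₂) :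
    1 - (B₁ + B₂) ≤ plantedProb n p E := by
  -- The key of a message edge forgets the signs in the clause, so that the order is invariant under
  -- flips. In a sparse formula the keys still separate the edges; all other formulas are charged to
  -- the first term of `hfrac`.
  let K := Finset (Fin n) × Fin n
  let b : K → ℕ := fun x => Fintype.equivFin K x
  have hb : Function.Injective b := Fin.val_injective.comp (Fintype.equivFin K).injective
  have hfrac : ∀ φ F, uavg (fun ω : Messages F × EdgeOrder F => ind (¬ E φ F ω.1 ω.2)) ≤
      ind (¬ Sparse F Clause.vars s₀) +
        uavg fun σ : Equiv.Perm K => uavg fun a : Clause n → Fin n → Bool =>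
          ind (G φ (fun x => b (σ x)) F a) := by
    intro φ F
    by_cases hF : Sparse F Clause.vars s₀
    · rw [ind, if_neg (not_not.2 hF), zero_add]
      let k : MsgEdge F ↪ K := ⟨fun e => (e.1.1.vars, e.1.2), fun e e' h => by
        have h2 := hF.vars_injOn hs₀ e.2.1 e'.2.1 (Prod.ext_iff.1 h).1
        exact Subtype.ext (Prod.ext h2 (Prod.ext_iff.1 h).2)⟩
      rw [uavg_prod (fun α π => ind (¬ E φ F α π)), uavg_comm]
      obtain ⟨R, hR, hav⟩ := uavg_rank k b hb fun π => uavg fun α => ind (¬ E φ F α π)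
      rw [hav]
      refine uavg_mono fun σ => ?_
      rw [uavg_messages]
      refine uavg_mono fun a => ind_mono fun h => ?_
      exact hG φ F _ _ _ _ hF (fun e => rfl) (hR σ) h
    · rw [ind, if_pos hF]
      have e1 : uavg (fun ω : Messages F × EdgeOrder F => ind (¬ E φ F ω.1 ω.2)) ≤
          uavg fun ω : Messages F × EdgeOrder F => (1 : ℝ) := uavg_mono fun ω => by
        unfold ind
        split_ifs <;> norm_num
      have : Nonempty (EdgeOrder F) := ⟨Fintype.equivFin _⟩
      rw [uavg_const] at e1
      have e2 : uavg (fun _ : Equiv.Perm K => uavg fun _ : Clause n → Fin n → Bool => (0 : ℝ)) ≤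
          uavg fun σ : Equiv.Perm K => uavg fun a : Clause n → Fin n → Bool =>
          ind (G φ (fun x => b (σ x)) F a) :=
        uavg_mono fun σ => uavg_mono fun a => ind_nonneg _
      rw [uavg_const, uavg_const] at e2
      linarith
  have hφ : ∀ φ, 1 - (B₁ + B₂) ≤ ∑ F : Formula n, formulaProb p φ F *
      ((Nat.card {ω : Messages F × EdgeOrder F // E φ F ω.1 ω.2} : ℝ) /
        (Nat.card (Messages F × EdgeOrder F) : ℝ)) := by
    intro φ
    have e1 : ∀ F : Formula n, (Nat.card {ω : Messages F × EdgeOrder F // E φ F ω.1 ω.2} : ℝ) /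
        (Nat.card (Messages F × EdgeOrder F) : ℝ) =
        1 - uavg (fun ω : Messages F × EdgeOrder F => ind (¬ E φ F ω.1 ω.2)) := by
      intro F
      have : Nonempty (EdgeOrder F) := ⟨Fintype.equivFin _⟩
      rw [card_subtype_div, ← uavg_const (X := Messages F × EdgeOrder F) (1 : ℝ), ← uavg_sub]
      congr 1
      funext ω
      by_cases h : E φ F ω.1 ω.2 <;> simp [ind, h]
    have e2 : ∑ F : Formula n, formulaProb p φ F * (ind (¬ Sparse F Clause.vars s₀) +
        uavg fun σ : Equiv.Perm K => uavg fun a : Clause n → Fin n → Bool =>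
          ind (G φ (fun x => b (σ x)) F a)) ≤ B₁ + B₂ := by
      simp only [mul_add, Finset.sum_add_distrib]
      refine add_le_add ?_ ?_
      · have := hB₁ φ
        rw [pexp_eq_sum_formulaProb p φ fun F _ => ind (¬ Sparse F Clause.vars s₀)] at this
        simpa only [uavg_const] using this
      · rw [sum_mul_uavg]
        refine le_trans (uavg_mono fun σ => ?_) (uavg_const (X := Equiv.Perm K) B₂).le
        rw [← pexp_eq_sum_formulaProb p φ fun F a => ind (G φ (fun x => b (σ x)) F a)]
        exact hB₂ φ _
    have e3 : ∑ F : Formula n, formulaProb p φ F *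
        uavg (fun ω : Messages F × EdgeOrder F => ind (¬ E φ F ω.1 ω.2)) ≤ B₁ + B₂ :=
      (Finset.sum_le_sum fun F _ => mul_le_mul_of_nonneg_left (hfrac φ F)
        (formulaProb_nonneg h0 h1 φ F)).trans e2
    simp only [e1, mul_sub, mul_one, Finset.sum_sub_distrib, sum_formulaProb]
    linarith
  have hsum : plantedProb n p E = ∑ φ : Assignment n, (1 / 2 : ℝ) ^ n * ∑ F : Formula n,
      formulaProb p φ F * ((Nat.card {ω : Messages F × EdgeOrder F // E φ F ω.1 ω.2} : ℝ) /
        (Nat.card (Messages F × EdgeOrder F) : ℝ)) := by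
    rw [plantedProb]
    refine Finset.sum_congr rfl fun φ _ => ?_
    rw [Finset.mul_sum]
    exact Finset.sum_congr rfl fun F _ => by ring
  rw [hsum]
  calc 1 - (B₁ + B₂) = ∑ _φ : Assignment n, (1 / 2 : ℝ) ^ n * (1 - (B₁ + B₂)) := by
        rw [Finset.sum_const, nsmul_eq_mul, Finset.card_univ, ← mul_assoc, mul_comm (Nat.cast _),
          half_pow_mul_card, one_mul]
    _ ≤ _ := Finset.sum_le_sum fun φ _ => mul_le_mul_of_nonneg_left (hφ φ) (by positivity)

lemma plantedProb_le_one {p : ℝ} (h0 : 0 ≤ p) (h1 : p ≤ 1)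
    (E : (φ : Assignment n) → (F : Formula n) → Messages F → EdgeOrder F → Prop) :
    plantedProb n p E ≤ 1 := by
  have hF : ∀ φ : Assignment n, ∑ F : Formula n, (1 / 2 : ℝ) ^ n * formulaProb p φ F *
      ((Nat.card {ω : Messages F × EdgeOrder F // E φ F ω.1 ω.2} : ℝ) /
        (Nat.card (Messages F × EdgeOrder F) : ℝ)) ≤ (1 / 2 : ℝ) ^ n := by
    intro φ
    calc _ ≤ ∑ F : Formula n, (1 / 2 : ℝ) ^ n * formulaProb p φ F := by
          refine Finset.sum_le_sum fun F _ => mul_le_of_le_one_right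
            (mul_nonneg (by positivity) (formulaProb_nonneg h0 h1 φ F)) ?_
          refine div_le_one_of_le₀ ?_ (by positivity)
          exact_mod_cast Nat.card_le_card_of_injective _ Subtype.val_injective
      _ = (1 / 2 : ℝ) ^ n := by rw [← Finset.mul_sum, sum_formulaProb, mul_one]
  refine (Finset.sum_le_sum fun φ _ => hF φ).trans (le_of_eq ?_)
  rw [Finset.sum_const, nsmul_eq_mul, Finset.card_univ, mul_comm, half_pow_mul_card]

end PlantedSAT

/-! ### Choice of the constants and the limit. -/

namespace PlantedSAT

/-- With `b = exp 18 * d` and `η = b ^ (-21)`, the bound `6 + 32 d ≤ b` reduces the claim to `b ^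
169 * exp (-(d / 120000)) ≤ 1`, where 169 = 21 · 8 + 1. Exponential decay gives this for large `d`.
-/
lemma exists_forall_exp_neg_le : ∃ d₀ : ℝ, 960 ≤ d₀ ∧ ∀ d, d₀ ≤ d →
    (6 + 32 * d) * Real.exp (-(d / 120000)) ≤ (((Real.exp 18 * d) ^ 21)⁻¹) ^ 8 := by
  have h1 : Tendsto (fun d : ℝ => (Real.exp 18 * 120000) ^ 169 *
      ((d / 120000) ^ 169 * Real.exp (-(d / 120000)))) atTop (𝓝 0) := by
    simpa only [mul_zero, Function.comp_def, id] using
      ((Real.tendsto_pow_mul_exp_neg_atTop_nhds_zero 169).comp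
        (tendsto_id.atTop_div_const (by norm_num : (0 : ℝ) < 120000))).const_mul
          ((Real.exp 18 * 120000) ^ 169)
  obtain ⟨d₀, hd₀⟩ := eventually_atTop.1 (h1.eventually_le_const zero_lt_one)
  refine ⟨max 960 d₀, le_max_left _ _, fun d hd => ?_⟩
  have hd1 : 960 ≤ d := (le_max_left _ _).trans hd
  have h2 := hd₀ d ((le_max_right _ _).trans hd)
  have he : (19 : ℝ) ≤ Real.exp 18 := by linarith [Real.add_one_le_exp (18 : ℝ)]
  have hb : 0 < Real.exp 18 * d := by positivity
  have he2 : (33 : ℝ) ≤ Real.exp 18 := by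
    have h3 : Real.exp 18 = Real.exp 9 ^ 2 := by rw [← Real.exp_nat_mul]; norm_num
    nlinarith [Real.add_one_le_exp (9 : ℝ)]
  have h3 : 6 + 32 * d ≤ Real.exp 18 * d := by nlinarith
  rw [inv_pow, ← pow_mul, ← one_div, le_div_iff₀ (by positivity)]
  calc (6 + 32 * d) * Real.exp (-(d / 120000)) * (Real.exp 18 * d) ^ (21 * 8)
      ≤ Real.exp 18 * d * Real.exp (-(d / 120000)) * (Real.exp 18 * d) ^ (21 * 8) := by gcongr
    _ = (Real.exp 18 * 120000) ^ 169 * ((d / 120000) ^ 169 * Real.exp (-(d / 120000))) := by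
        rw [← mul_assoc, ← mul_pow, show Real.exp 18 * 120000 * (d / 120000) = Real.exp 18 * d by
          ring]
        ring
    _ ≤ 1 := h2

lemma le_choose_two {n s : ℕ} (hn : 1000 ≤ n) (hs : 1000 * s ≤ n) :
    0.49 * (n : ℝ) ^ 2 ≤ ((n - s).choose 2 : ℕ) := by
  have h1 : ((n - s : ℕ) : ℝ) = n - s := Nat.cast_sub (by omega)
  rw [Nat.cast_choose_two, h1]
  have h2 : (1000 : ℝ) * s ≤ n := by exact_mod_cast hs
  have h3 : (1000 : ℝ) ≤ n := by exact_mod_cast hn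
  have h4 : 0.999 * (n : ℝ) ≤ n - s := by linarith
  have h5 : 0.998 * (n : ℝ) ≤ n - s - 1 := by linarith
  have := mul_le_mul h4 h5 (by positivity) (by linarith)
  nlinarith

/-- A quantitative form of the theorem, at a fixed number of variables. -/
lemma one_sub_le_plantedProb_componentsAtMostOneCycle {n : ℕ} {p d : ℝ} (hd : d = (n : ℝ) ^ 2 * p)
    (hd1 : 960 ≤ d)
    (hη : (6 + 32 * d) * Real.exp (-(d / 120000)) ≤ (((Real.exp 18 * d) ^ 21)⁻¹) ^ 8)
    (hn : 1000 ≤ n) (h1 : 1000 * Real.log n ≤ n) (h2 : Real.log n * d ≤ n)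
    (h3 : 24 * Real.log (Real.exp 18 * d) ≤ Real.log n) :
    1 - 2 * (Real.log n ^ 2 * d * Real.exp (-(Real.log n / 2))) ≤
      plantedProb n p fun φ F α π =>
        ComponentsAtMostOneCycle (nonCoreGraph F (core d F φ α π)) := by
  set L := Real.log n with hL
  set b := Real.exp 18 * d with hb
  set l := Real.log b with hl
  have hn0 : (0 : ℝ) < n := by positivity
  have hn1 : (1000 : ℝ) ≤ n := by exact_mod_cast hn
  have hnL : Real.exp L = n := Real.exp_log hn0
  have hb0 : 0 < b := by positivity
  have hbl : Real.exp l = b := Real.exp_log hb0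
  have hl18 : 18 ≤ l := by
    rw [hl, hb, Real.log_mul (Real.exp_pos _).ne' (by positivity), Real.log_exp]
    linarith [Real.log_nonneg (show (1 : ℝ) ≤ d by linarith)]
  have hL0 : 432 ≤ L := by linarith
  have hb1 : 1 ≤ b := by rw [← hbl]; exact Real.one_le_exp (by linarith)
  have he : 2 * Real.exp 17 ≤ Real.exp 18 := by
    rw [show (18 : ℝ) = 17 + 1 by norm_num, Real.exp_add, mul_comm]
    have := Real.add_one_le_exp (1 : ℝ)
    gcongr
    linarith
  have hb17 : 2 * Real.exp 17 * d ≤ b := by rw [hb]; gcongr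
  have hb17' : Real.exp 17 * d ≤ b := by
    refine le_trans ?_ hb17
    have : 0 ≤ Real.exp 17 * d := by positivity
    linarith
  have hp0 : 0 ≤ p := by
    by_contra! h
    have : (n : ℝ) ^ 2 * p < 0 := mul_neg_of_pos_of_neg (by positivity) h
    linarith
  have hp1 : p ≤ 1 := by
    have h5 : d ≤ n := by nlinarith
    by_contra! h
    have h6 : (n : ℝ) ^ 2 * 1 < (n : ℝ) ^ 2 * p := by gcongr
    nlinarith
  -- This `s₀` keeps `b ^ s₀ ≤ √n`, so the sparsity bound wins by its factor `1 / n`. About a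
  -- quarter of it suffices for `s₁`: then `b ^ (-20 s₁) ≤ n ^ (-5/2)` beats the factor `n`, and `L
  -- ≥ 24 l` leaves room for `2 s₁ + 3 ≤ s₀`.
  set s₀ := ⌊L / (2 * l)⌋₊ with hs₀
  set s₁ := ⌈L / (8 * l)⌉₊ with hs₁
  have hx : 6 ≤ L / (4 * l) := by rw [le_div_iff₀ (by positivity)]; linarith
  have e2 : L / (2 * l) = 2 * (L / (4 * l)) := by field_simp; norm_num
  have e8 : L / (8 * l) = L / (4 * l) / 2 := by field_simp; norm_num
  have hs₀le : (s₀ : ℝ) ≤ L / (2 * l) := Nat.floor_le (by positivity)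
  have hs₀gt : L / (2 * l) < s₀ + 1 := Nat.lt_floor_add_one _
  have hs₁ge : L / (8 * l) ≤ s₁ := Nat.le_ceil _
  have hs₁lt : (s₁ : ℝ) < L / (8 * l) + 1 := Nat.ceil_lt_add_one (by positivity)
  have hs₀L : (s₀ : ℝ) ≤ L := hs₀le.trans (div_le_self (by linarith) (by linarith))
  have hs : 2 * s₁ + 3 ≤ s₀ := by
    have : (2 * s₁ + 3 : ℝ) < s₀ + 1 := by linarith
    have : 2 * s₁ + 3 < s₀ + 1 := by exact_mod_cast this
    omega
  have hs₁2 : 2 ≤ s₁ := by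
    have : (2 : ℝ) < s₁ := by linarith
    exact_mod_cast this.le
  have hbs₀ : b ^ s₀ ≤ Real.exp (L / 2) := by
    rw [← hbl, ← Real.exp_nat_mul, Real.exp_le_exp]
    calc (s₀ : ℝ) * l ≤ L / (2 * l) * l := by gcongr
      _ = L / 2 := by field_simp
  have hbs₁ : (b ^ 20)⁻¹ ^ s₁ ≤ Real.exp (-(5 / 2 * L)) := by
    rw [← hbl, ← Real.exp_nat_mul, ← Real.exp_neg, ← Real.exp_nat_mul, Real.exp_le_exp]
    have : L / (8 * l) * l ≤ s₁ * l := by gcongr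
    have e : L / (8 * l) * l = L / 8 := by field_simp
    push_cast
    linarith
  have hs₀d : (s₀ : ℝ) * d ≤ n := le_trans (by gcongr) h2
  have hch : ∀ s ≤ s₀, 0.49 * (n : ℝ) ^ 2 ≤ ((n - s).choose 2 : ℕ) := by
    intro s hs
    refine le_choose_two hn ?_
    have : (s : ℝ) ≤ s₀ := by exact_mod_cast hs
    have : (1000 * s : ℝ) ≤ n := by linarith
    exact_mod_cast this
  have hB₁ : ∑ s ∈ Finset.Icc 1 s₀, (s : ℝ) * d / n * (Real.exp 17 * d) ^ s ≤
      L ^ 2 * d * Real.exp (-(L / 2)) := by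
    have hterm : ∀ s ∈ Finset.Icc 1 s₀, (s : ℝ) * d / n * (Real.exp 17 * d) ^ s ≤
        L * d / n * Real.exp (L / 2) := by
      intro s hs
      have h4 : (s : ℝ) ≤ L := le_trans (by exact_mod_cast (Finset.mem_Icc.1 hs).2) hs₀L
      have h5 : (Real.exp 17 * d) ^ s ≤ Real.exp (L / 2) :=
        calc (Real.exp 17 * d) ^ s ≤ b ^ s := by gcongr
          _ ≤ b ^ s₀ := pow_le_pow_right₀ hb1 (Finset.mem_Icc.1 hs).2
          _ ≤ _ := hbs₀
      gcongr
    refine (Finset.sum_le_card_nsmul _ _ _ hterm).trans ?_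
    rw [Nat.card_Icc, Nat.add_sub_cancel, nsmul_eq_mul]
    calc (s₀ : ℝ) * (L * d / n * Real.exp (L / 2)) ≤ L * (L * d / n * Real.exp (L / 2)) := by
          gcongr
      _ = L ^ 2 * d * (Real.exp (L / 2) * (Real.exp L)⁻¹) := by rw [hnL]; ring
      _ = _ := by
          rw [← Real.exp_neg, ← Real.exp_add]
          ring_nf
  have hB₂ : ∑ s ∈ Finset.Icc s₁ s₀, (n : ℝ) * (2 * Real.exp 17 * d * (b ^ 21)⁻¹) ^ s ≤
      L ^ 2 * d * Real.exp (-(L / 2)) := by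
    -- One of the 21 powers of `b` pays for the choice of `S` and `Y`.
    have hq : 2 * Real.exp 17 * d * (b ^ 21)⁻¹ ≤ (b ^ 20)⁻¹ :=
      calc 2 * Real.exp 17 * d * (b ^ 21)⁻¹ ≤ b * (b ^ 21)⁻¹ := by gcongr
        _ = (b ^ 20)⁻¹ := by field_simp
    have hterm : ∀ s ∈ Finset.Icc s₁ s₀, (n : ℝ) * (2 * Real.exp 17 * d * (b ^ 21)⁻¹) ^ s ≤
        n * Real.exp (-(5 / 2 * L)) := by
      intro s hs
      have h5 : (2 * Real.exp 17 * d * (b ^ 21)⁻¹) ^ s ≤ Real.exp (-(5 / 2 * L)) :=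
        calc (2 * Real.exp 17 * d * (b ^ 21)⁻¹) ^ s ≤ (b ^ 20)⁻¹ ^ s := by gcongr
          _ ≤ (b ^ 20)⁻¹ ^ s₁ := pow_le_pow_of_le_one (by positivity)
              (inv_le_one_of_one_le₀ (one_le_pow₀ hb1)) (Finset.mem_Icc.1 hs).1
          _ ≤ _ := hbs₁
      gcongr
    refine (Finset.sum_le_card_nsmul _ _ _ hterm).trans ?_
    rw [nsmul_eq_mul]
    have hc : ((Finset.Icc s₁ s₀).card : ℝ) ≤ L := by
      refine le_trans ?_ hs₀L
      rw [Nat.card_Icc]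
      exact_mod_cast (by omega : s₀ + 1 - s₁ ≤ s₀)
    have e1 : (n : ℝ) * Real.exp (-(5 / 2 * L)) ≤ Real.exp (-(L / 2)) := by
      rw [← hnL, ← Real.exp_add, Real.exp_le_exp]
      linarith
    have e3 : L ≤ L ^ 2 * d := by nlinarith
    calc ((Finset.Icc s₁ s₀).card : ℝ) * (n * Real.exp (-(5 / 2 * L)))
        ≤ L * Real.exp (-(L / 2)) := by gcongr
      _ ≤ _ := by gcongr
  have hmain := one_sub_le_plantedProb hp0 hp1
    (fun φ F α π => ComponentsAtMostOneCycle (nonCoreGraph F (core d F φ α π)))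
    (s₀ := s₀) (by omega)
    (fun φ κ F a => ∃ s ∈ Finset.Icc s₁ s₀, ∃ S ∈ (Finset.univ : Finset (Fin n)).powersetCard s,
      BadSet d φ κ F a S) ?_
    (fun φ => (pexp_not_sparse_le hp0 hp1 φ hd (by linarith) hs₀d).trans hB₁)
    (fun φ κ => (pexp_badSet_le hp0 hp1 φ κ hd (by linarith) hs₀d (by omega) hch
      (by positivity) (inv_le_one_of_one_le₀ (one_le_pow₀ hb1)) hη).trans hB₂)
  · linarith
  · intro φ F α π κ a hsp hα hπ hE
    by_contra hbad
    refine hE (componentsAtMostOneCycle_of_sparse (by linarith) hs hs₁2 hsp fun S hS₁ hS₀ hr => ?_)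
    exact hbad ⟨S.card, Finset.mem_Icc.2 ⟨hS₁, hS₀⟩, S,
      Finset.mem_powersetCard.2 ⟨Finset.subset_univ S, rfl⟩, hr.1,
      exists_privFaulty hd1 hα hπ (hsp S hS₀) hr⟩

end PlantedSAT

theorem mainTheorem3 :
    ∃ d₀ : ℝ, 0 < d₀ ∧ ∀ (D : ℝ) (p : ℕ → ℝ),
      (∀ᶠ n : ℕ in atTop, d₀ / (n : ℝ) ^ 2 ≤ p n ∧ p n ≤ D / (n : ℝ) ^ 2) →
      Tendsto
        (fun n : ℕ => PlantedSAT.plantedProb n (p n) fun φ F α π =>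
          PlantedSAT.ComponentsAtMostOneCycle
            (PlantedSAT.nonCoreGraph F (PlantedSAT.core ((n : ℝ) ^ 2 * p n) F φ α π)))
        atTop (𝓝 1) := by
  obtain ⟨d₀, hd₀, hη⟩ := PlantedSAT.exists_forall_exp_neg_le
  refine ⟨d₀, by linarith, fun D p hp => ?_⟩
  have hlog : Tendsto (fun n : ℕ => Real.log n) atTop atTop :=
    Real.tendsto_log_atTop.comp tendsto_natCast_atTop_atTop
  have hsmall : ∀ c : ℝ, ∀ᶠ n : ℕ in atTop, c * Real.log n ≤ n := by
    intro c
    have h1 := (Real.isLittleO_log_id_atTop.comp_tendsto tendsto_natCast_atTop_atTop).const_mul_left c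
    filter_upwards [h1.bound one_pos] with n hn
    simp only [Function.comp_apply, id, one_mul, Real.norm_eq_abs, Nat.abs_cast] at hn
    exact (le_abs_self _).trans hn
  have hlim : Tendsto (fun n : ℕ => 1 - 2 * (Real.log n ^ 2 * D * Real.exp (-(Real.log n / 2))))
      atTop (𝓝 1) := by
    -- In terms of `x = log n / 2` the error is `8 D x² exp (-x)`.
    have h1 := ((Real.tendsto_pow_mul_exp_neg_atTop_nhds_zero 2).comp
      (hlog.atTop_div_const (by norm_num : (0 : ℝ) < 2))).const_mul (8 * D)
    have h2 := h1.const_sub 1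
    simp only [mul_zero, sub_zero, Function.comp_def] at h2
    refine h2.congr fun n => ?_
    ring
  have hev : ∀ᶠ n : ℕ in atTop, 960 ≤ (n : ℝ) ^ 2 * p n ∧ p n ≤ 1 ∧ 0 ≤ p n ∧
      1 - 2 * (Real.log n ^ 2 * D * Real.exp (-(Real.log n / 2))) ≤
        PlantedSAT.plantedProb n (p n) fun φ F α π => PlantedSAT.ComponentsAtMostOneCycle
          (PlantedSAT.nonCoreGraph F (PlantedSAT.core ((n : ℝ) ^ 2 * p n) F φ α π)) := by
    filter_upwards [hp, eventually_ge_atTop 1000, hsmall 1000, hsmall D, hlog.eventually_ge_atTop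
      (24 * Real.log (Real.exp 18 * D)), tendsto_natCast_atTop_atTop.eventually_ge_atTop D]
      with n hpn hn h1 h2 h3 h4
    have hn1 : (1000 : ℝ) ≤ n := by exact_mod_cast hn
    have hn0 : (0 : ℝ) < (n : ℝ) ^ 2 := by positivity
    have hl : d₀ ≤ (n : ℝ) ^ 2 * p n := by
      rw [mul_comm, ← div_le_iff₀ hn0]; exact hpn.1
    have hu : (n : ℝ) ^ 2 * p n ≤ D := by
      rw [mul_comm, ← le_div_iff₀ hn0]; exact hpn.2
    have hL : 0 ≤ Real.log n := Real.log_nonneg (by linarith)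
    refine ⟨hd₀.trans hl, ?_, le_trans (by positivity) hpn.1, ?_⟩
    · refine hpn.2.trans ((div_le_one hn0).2 ?_)
      nlinarith
    refine le_trans ?_ (PlantedSAT.one_sub_le_plantedProb_componentsAtMostOneCycle rfl
      (hd₀.trans hl) (hη _ hl) hn h1 ?_ ?_)
    · gcongr
    · refine le_trans ?_ h2
      rw [mul_comm]
      gcongr
    · have hb : 0 < Real.exp 18 * ((n : ℝ) ^ 2 * p n) := mul_pos (Real.exp_pos _) (by linarith)
      refine le_trans ?_ h3
      gcongr
  refine tendsto_of_tendsto_of_tendsto_of_le_of_le' hlim tendsto_const_nhds ?_ ?_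
  · filter_upwards [hev] with n hn using hn.2.2.2
  · filter_upwards [hev] with n hn using PlantedSAT.plantedProb_le_one hn.2.2.1 hn.2.1 _
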